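/- There are an algorithm and a constant $C$ with the following guarantee. The input is a non-complete connected finite simple graph $G$ with $n$ vertices, $m$ edges and maximum degree $\Delta \ge 3$, given by adjacency lists (each in arbitrary order), together with a sequence $(p_1,\dots,p_s)$ of non-negative integers, where $s \ge 2$ and $\sum_{i=1}^s p_i \ge \Delta - s$. After at most $C\,(n+m)$ steps the algorithm halts and outputs a partition of $V(G)$ into $s$ (possibly empty) sets $V_1,\dots,V_s$, presented by giving for each vertex the index of its part, such that for each $i \in \{1,\dots,s\}$ the induced subgraph $G[V_i]$ is $p_i$-degenerate, that is, every non-empty subgraph of $G[V_i]$ contains a vertex of degree at most $p_i$ in that subgraph. The constant $C$ is independent of $G$, $s$ and $p_1,\dots,p_s$. Here an algorithm is a program of a unit-cost random access machine with finitely many registers and arrays of non-negative integers, whose elementary steps are assignment of a constant, copying, addition, truncated subtraction, reading or writing an array cell, and comparison of two registers; it works with every word bound $W \ge C\,(n+m)$ that exceeds all numbers in the input (including $n$, $s$ and the $p_i$), i.e. all numbers that occur during the computation are smaller than $W$. -/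

import Mathlib

/-- A graph is `d`-degenerate if every non-empty subgraph contains a vertex whose degree in that
subgraph is at most `d`. -/
def SimpleGraph.IsDegenerate {V : Type*} (G : SimpleGraph V) (d : ℕ) : Prop :=
  ∀ H : G.Subgraph, H.verts.Nonempty → ∃ v ∈ H.verts, (H.neighborSet v).encard ≤ (d : ℕ∞)

/-! ### A random access machine with unit costs and bounded words

The machine has registers and arrays, all of whose cells hold natural numbers. A program is a
finite text, so it uses only finitely many registers and (names of) arrays. Each elementary
instruction and each evaluation of a test costs one step. The only arithmetic is addition
and truncated subtraction, and all numbers have to stay below a word bound `W`. -/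

namespace RAM

/-- The contents of the registers and of the arrays. -/
structure State where
  /-- the content of register `x` -/
  reg : ℕ → ℕ
  /-- the content of cell `i` of array `a` -/
  arr : ℕ → ℕ → ℕ

/-- `x := v` -/
def State.setReg (σ : State) (x v : ℕ) : State :=
  { σ with reg := Function.update σ.reg x v }

/-- `a[i] := v` -/
def State.setArr (σ : State) (a i v : ℕ) : State :=
  { σ with arr := Function.update σ.arr a (Function.update (σ.arr a) i v) }

/-- All numbers in the state are smaller than `W`. -/
def State.Fits (W : ℕ) (σ : State) : Prop :=
  (∀ x, σ.reg x < W) ∧ ∀ a i, σ.arr a i < W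

/-- Elementary instructions; `x y z` are registers, `a` is the name of an array, `k` a numeral. -/
inductive Instr where
  /-- `x := k` -/
  | const (x k : ℕ)
  /-- `x := y` -/
  | copy (x y : ℕ)
  /-- `x := y + z` -/
  | add (x y z : ℕ)
  /-- `x := max (y - z) 0` -/
  | sub (x y z : ℕ)
  /-- `x := a[y]` -/
  | load (x a y : ℕ)
  /-- `a[x] := y` -/
  | store (a x y : ℕ)

/-- The effect of an elementary instruction. -/
def Instr.apply : Instr → State → State
  | const x k, σ => σ.setReg x k
  | copy x y, σ => σ.setReg x (σ.reg y)
  | add x y z, σ => σ.setReg x (σ.reg y + σ.reg z)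
  | sub x y z, σ => σ.setReg x (σ.reg y - σ.reg z)
  | load x a y, σ => σ.setReg x (σ.arr a (σ.reg y))
  | store a x y, σ => σ.setArr a (σ.reg x) (σ.reg y)

/-- The instruction does not overflow the word bound `W`. (The results of the instructions not
listed are numbers already present in the state, or smaller.) -/
def Instr.NoOverflow (W : ℕ) : Instr → State → Prop
  | const _ k, _ => k < W
  | add _ y z, σ => σ.reg y + σ.reg z < W
  | _, _ => True

/-- Tests compare the contents of two registers. -/
inductive Test where
  | lt (x y : ℕ)
  | le (x y : ℕ)
  | eq (x y : ℕ)
  | ne (x y : ℕ)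

/-- The test succeeds. -/
def Test.Holds : Test → State → Prop
  | lt x y, σ => σ.reg x < σ.reg y
  | le x y, σ => σ.reg x ≤ σ.reg y
  | eq x y, σ => σ.reg x = σ.reg y
  | ne x y, σ => σ.reg x ≠ σ.reg y

/-- Programs. -/
inductive Program where
  /-- do nothing -/
  | skip
  /-- a single elementary instruction -/
  | instr (i : Instr)
  /-- first `c`, then `d` -/
  | seq (c d : Program)
  /-- if `b` then `c` else `d` -/
  | cond (b : Test) (c d : Program)
  /-- while `b` do `c` -/
  | loop (b : Test) (c : Program)

/-- `Runs W c σ t σ'`: with words bounded by `W`, the program `c` started in the state `σ` never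
overflows and halts after exactly `t` steps in the state `σ'`. -/
inductive Runs (W : ℕ) : Program → State → ℕ → State → Prop where
  | skip (σ : State) : Runs W .skip σ 0 σ
  | instr (i : Instr) (σ : State) (h : i.NoOverflow W σ) :
      Runs W (.instr i) σ 1 (i.apply σ)
  | seq {c d : Program} {σ σ₁ σ₂ : State} {t₁ t₂ : ℕ}
      (hc : Runs W c σ t₁ σ₁) (hd : Runs W d σ₁ t₂ σ₂) :
      Runs W (.seq c d) σ (t₁ + t₂) σ₂
  | cond_true {b : Test} {c d : Program} {σ σ' : State} {t : ℕ}
      (hb : b.Holds σ) (hc : Runs W c σ t σ') :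
      Runs W (.cond b c d) σ (1 + t) σ'
  | cond_false {b : Test} {c d : Program} {σ σ' : State} {t : ℕ}
      (hb : ¬ b.Holds σ) (hd : Runs W d σ t σ') :
      Runs W (.cond b c d) σ (1 + t) σ'
  | loop_done {b : Test} {c : Program} {σ : State} (hb : ¬ b.Holds σ) :
      Runs W (.loop b c) σ 1 σ
  | loop_step {b : Test} {c : Program} {σ σ₁ σ₂ : State} {t₁ t₂ : ℕ}
      (hb : b.Holds σ) (hc : Runs W c σ t₁ σ₁) (hl : Runs W (.loop b c) σ₁ t₂ σ₂) :
      Runs W (.loop b c) σ (1 + t₁ + t₂) σ₂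

end RAM

/-- `adj` lists, for every vertex, its neighbours without repetition and in any order. -/
def IsAdjacencyLists {n : ℕ} (G : SimpleGraph (Fin n)) (adj : Fin n → List (Fin n)) : Prop :=
  ∀ v, (adj v).Nodup ∧ ∀ w, w ∈ adj v ↔ G.Adj v w

/-- The initial state for a graph on the vertices `0, …, n - 1` given by adjacency lists and a
sequence `p` of length `s`. Register `0` holds `n` and register `1` holds `s`. Array `1` is the
concatenation of the adjacency lists of `0, …, n - 1`, and cell `v ≤ n` of array `0` holds the total
length of the lists of the vertices smaller than `v`, so that the list of `v` occupies the cells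
from `arr 0 v` to `arr 0 (v + 1) - 1` of array `1`. Array `2` holds the sequence `p`.
Everything else is `0`. -/
def inputState {n s : ℕ} (adj : Fin n → List (Fin n)) (p : Fin s → ℕ) : RAM.State where
  reg x := if x = 0 then n else if x = 1 then s else 0
  arr a i :=
    if a = 0 then
      if i ≤ n then ∑ u : Fin n, if u.val < i then (adj u).length else 0 else 0
    else if a = 1 then
      (((List.finRange n).flatMap adj).map Fin.val).getD i 0
    else if a = 2 then
      if h : i < s then p ⟨i, h⟩ else 0
    else 0

/-- In its final state `σ` the machine presents the partition `V`: cell `v` of array `3` holds the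
index `i` (counted from `0`) of the part `V i` that contains the vertex `v`. -/
def IsOutput {n s : ℕ} (σ : RAM.State) (V : Fin s → Set (Fin n)) : Prop :=
  ∀ (v : Fin n) (i : Fin s), v ∈ V i ↔ σ.arr 3 v = i

/-! Call a vertex stuck if every part `i` already contains at least `p i + 1` of its neighbours. A
vertex that is not stuck can join some part, and the part stays degenerate (`ValidCol.set`). Since
the numbers `p i + 1` sum to at least `Δ`, a vertex with an uncoloured neighbour is never stuck
(`Instance.not_stuck`). Colouring in the reverse of a search order therefore succeeds everywhere
except possibly at the root `r`. The root is chosen as the end of an inextensible path, so that all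
its neighbours lie on that path.

If `r` is stuck, all the counts are tight: its degree is `Δ`, and part `i` contains exactly `p i +
1` of its neighbours. Hence the uncoloured vertex, the hole, may change places with any neighbour
(`Instance.validCol_moveHole`). As soon as the hole reaches a vertex that is not stuck, the
colouring can be completed. What is needed is a walk of linear total size along which the hole
cannot remain stuck.

One turn of the hole around a cycle through `r` shifts the colours of the cycle by one place. If the
cycle has no chord at `r` (an ear), comparing the tight counts at `r` before and after the turn
forces two colours to agree (`Instance.rotation_eq`), and a second turn forces another equality
(`Instance.ear_two`). A further closed walk, which meets the ear only at its first vertex, then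
carries the colour of a third neighbour of `r` into that vertex, and a turn in the opposite
direction yields a contradiction unless the three neighbours of `r` have the same colour
(`Instance.not_stuckAlong_ear` and its variant). As `Δ ≥ 3` and at least two colours occur around a
stuck vertex, the third neighbour can be chosen so that the colours are not all equal. This settles
the case of a gap between the positions of the neighbours of `r` on the path.

Without a gap, these neighbours form the final segment of the path before `r`. They are not a
clique, for otherwise connectedness would make the graph complete (`not_clique`). So some neighbour
`v` of `r` is adjacent to exactly one of two consecutive vertices `u`, `w` of the segment. Seen from
`v`, the cycle through `r`, `w`, `u` is an ear, and two turns force `u`, `v`, `w` to share a colour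
(`Instance.not_stuckAlong_diamond`). If they do share one, a closed walk first brings another colour
to `u`.

The time is linear because the adjacency list of each vertex is read a bounded number of times. Two
places need an argument: a colour rejected at a vertex is charged to a neighbour of that colour, and
an unsuccessful scan in the search for `v` is charged to the degree of the vertex for which it is
made (`sub_le_length`). -/

namespace RAM

/-! ### Weakest preconditions with time credits. -/

/-- `wp W c k σ Q`: started in `σ` with `k` credits, the program `c` halts without overflow after at
most `k` steps, and the remaining credits and the final state satisfy `Q`. -/
def wp (W : ℕ) (c : Program) (k : ℕ) (σ : State) (Q : ℕ → State → Prop) : Prop :=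
  ∃ (t : ℕ) (σ' : State), Runs W c σ t σ' ∧ t ≤ k ∧ Q (k - t) σ'

@[simp] theorem reg_setReg (σ : State) (x v y : ℕ) :
    (σ.setReg x v).reg y = if y = x then v else σ.reg y := by
  simp [State.setReg, Function.update_apply]

@[simp] theorem arr_setReg (σ : State) (x v : ℕ) : (σ.setReg x v).arr = σ.arr := rfl

@[simp] theorem reg_setArr (σ : State) (a i v : ℕ) : (σ.setArr a i v).reg = σ.reg := rfl

@[simp] theorem arr_setArr (σ : State) (a i v b : ℕ) :
    (σ.setArr a i v).arr b = if b = a then Function.update (σ.arr a) i v else σ.arr b := by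
  simp [State.setArr, Function.update_apply]

variable {W : ℕ} {k : ℕ} {σ : State} {Q : ℕ → State → Prop}

theorem wp_mono {c : Program} {Q' : ℕ → State → Prop} (h : wp W c k σ Q)
    (hQ : ∀ k' σ', k' ≤ k → Q k' σ' → Q' k' σ') : wp W c k σ Q' := by
  obtain ⟨t, σ', hr, ht, hq⟩ := h
  exact ⟨t, σ', hr, ht, hQ _ _ (Nat.sub_le _ _) hq⟩

/-- Use of a bound on the running time of `c` in a context with more credits. -/
theorem wp_of_spec {c : Program} {T : ℕ} {P : State → Prop} (h : wp W c T σ fun _ => P)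
    (hT : T ≤ k) (hQ : ∀ k' σ', k ≤ k' + T → P σ' → Q k' σ') : wp W c k σ Q := by
  obtain ⟨t, σ', hr, ht, hq⟩ := h
  exact ⟨t, σ', hr, by omega, hQ _ _ (by omega) hq⟩

@[simp] theorem wp_skip : wp W .skip k σ Q ↔ Q k σ := by
  constructor
  · rintro ⟨t, σ', hr, ht, hq⟩
    cases hr
    simpa using hq
  · intro h
    exact ⟨0, σ, .skip σ, by omega, by simpa using h⟩

theorem wp_instr {i : Instr} :
    wp W (.instr i) k σ Q ↔ i.NoOverflow W σ ∧ 1 ≤ k ∧ Q (k - 1) (i.apply σ) := by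
  constructor
  · rintro ⟨t, σ', hr, ht, hq⟩
    cases hr with
    | instr _ _ h => exact ⟨h, ht, hq⟩
  · rintro ⟨h, hk, hq⟩
    exact ⟨1, _, .instr i σ h, hk, hq⟩

@[simp] theorem wp_const {x c : ℕ} :
    wp W (.instr (.const x c)) k σ Q ↔ c < W ∧ 1 ≤ k ∧ Q (k - 1) (σ.setReg x c) := wp_instr

@[simp] theorem wp_copy {x y : ℕ} :
    wp W (.instr (.copy x y)) k σ Q ↔ 1 ≤ k ∧ Q (k - 1) (σ.setReg x (σ.reg y)) := by
  rw [wp_instr]; simp [Instr.NoOverflow, Instr.apply]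

@[simp] theorem wp_add {x y z : ℕ} :
    wp W (.instr (.add x y z)) k σ Q ↔
      σ.reg y + σ.reg z < W ∧ 1 ≤ k ∧ Q (k - 1) (σ.setReg x (σ.reg y + σ.reg z)) := wp_instr

@[simp] theorem wp_sub {x y z : ℕ} :
    wp W (.instr (.sub x y z)) k σ Q ↔
      1 ≤ k ∧ Q (k - 1) (σ.setReg x (σ.reg y - σ.reg z)) := by
  rw [wp_instr]; simp [Instr.NoOverflow, Instr.apply]

@[simp] theorem wp_load {x a y : ℕ} :
    wp W (.instr (.load x a y)) k σ Q ↔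
      1 ≤ k ∧ Q (k - 1) (σ.setReg x (σ.arr a (σ.reg y))) := by
  rw [wp_instr]; simp [Instr.NoOverflow, Instr.apply]

@[simp] theorem wp_store {a x y : ℕ} :
    wp W (.instr (.store a x y)) k σ Q ↔
      1 ≤ k ∧ Q (k - 1) (σ.setArr a (σ.reg x) (σ.reg y)) := by
  rw [wp_instr]; simp [Instr.NoOverflow, Instr.apply]

@[simp] theorem wp_seq {c d : Program} :
    wp W (.seq c d) k σ Q ↔ wp W c k σ fun k' σ' => wp W d k' σ' Q := by
  constructor
  · rintro ⟨t, σ', hr, ht, hq⟩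
    cases hr with
    | seq hc hd =>
      exact ⟨_, _, hc, by omega, _, _, hd, by omega, by rwa [Nat.sub_sub]⟩
  · rintro ⟨t, σ', hr, ht, t', σ'', hr', ht', hq⟩
    exact ⟨_, _, .seq hr hr', by omega, by rwa [← Nat.sub_sub]⟩

@[simp] theorem wp_cond {b : Test} {c d : Program} :
    wp W (.cond b c d) k σ Q ↔
      1 ≤ k ∧ (b.Holds σ → wp W c (k - 1) σ Q) ∧ (¬ b.Holds σ → wp W d (k - 1) σ Q) := by
  constructor
  · rintro ⟨t, σ', hr, ht, hq⟩
    cases hr with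
    | cond_true hb hc =>
      exact ⟨by omega, fun _ => ⟨_, _, hc, by omega, by rwa [Nat.sub_sub]⟩, fun h => absurd hb h⟩
    | cond_false hb hc =>
      exact ⟨by omega, fun h => absurd h hb, fun _ => ⟨_, _, hc, by omega, by rwa [Nat.sub_sub]⟩⟩
  · rintro ⟨hk, h1, h2⟩
    by_cases hb : b.Holds σ
    · obtain ⟨t, σ', hr, ht, hq⟩ := h1 hb
      exact ⟨_, _, .cond_true hb hr, by omega, by rwa [← Nat.sub_sub]⟩
    · obtain ⟨t, σ', hr, ht, hq⟩ := h2 hb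
      exact ⟨_, _, .cond_false hb hr, by omega, by rwa [← Nat.sub_sub]⟩

/-- The credits serve as variant of the loop. -/
theorem wp_loop {b : Test} {c : Program} (I : ℕ → State → Prop) (h0 : I k σ)
    (hstep : ∀ k σ, I k σ → 1 ≤ k ∧ (b.Holds σ → wp W c (k - 1) σ I) ∧
      (¬ b.Holds σ → Q (k - 1) σ)) : wp W (.loop b c) k σ Q := by
  induction k using Nat.strong_induction_on generalizing σ with
  | _ k ih =>
    obtain ⟨hk, h1, h2⟩ := hstep k σ h0
    by_cases hb : b.Holds σ
    · obtain ⟨t, σ', hr, ht, hq⟩ := h1 hb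
      -- The test itself costs a credit, so the credits drop strictly even if the body costs
      -- nothing.
      obtain ⟨t', σ'', hr', ht', hq'⟩ := ih (k - 1 - t) (by omega) hq
      refine ⟨_, _, .loop_step hb hr hr', by omega, ?_⟩
      rwa [show k - (1 + t + t') = k - 1 - t - t' by omega]
    · exact ⟨1, σ, .loop_done hb, hk, h2 hb⟩

@[simp] theorem holds_lt {x y : ℕ} : (Test.lt x y).Holds σ ↔ σ.reg x < σ.reg y := Iff.rfl
@[simp] theorem holds_le {x y : ℕ} : (Test.le x y).Holds σ ↔ σ.reg x ≤ σ.reg y := Iff.rfl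
@[simp] theorem holds_eq {x y : ℕ} : (Test.eq x y).Holds σ ↔ σ.reg x = σ.reg y := Iff.rfl
@[simp] theorem holds_ne {x y : ℕ} : (Test.ne x y).Holds σ ↔ σ.reg x ≠ σ.reg y := Iff.rfl

end RAM

/-! ### Partial colourings and holes. -/

/-- A finite simple graph on `0, …, n - 1` given by adjacency lists of natural numbers. -/
structure NatGraph (n : ℕ) (nl : ℕ → List ℕ) : Prop where
  nodup : ∀ v, (nl v).Nodup
  lt : ∀ {u v}, u ∈ nl v → u < n
  symm : ∀ {u v}, u ∈ nl v → v ∈ nl u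
  irrefl : ∀ v, v ∉ nl v

namespace NatGraph

/-- The number of neighbours of `v` with colour `c`. -/
def colCount (nl : ℕ → List ℕ) (col : ℕ → ℕ) (v c : ℕ) : ℕ :=
  (nl v).countP fun u => col u = c

/-- Every nonempty finite subset of `A` has an element with at most `d` neighbours in it. -/
def DegenerateOn (nl : ℕ → List ℕ) (A : Set ℕ) (d : ℕ) : Prop :=
  ∀ X : Finset ℕ, X.Nonempty → ↑X ⊆ A → ∃ v ∈ X, (nl v).countP (· ∈ X) ≤ d

/-- A partial colouring: `0` means uncoloured, and `i + 1` stands for the part `i`. -/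
structure ValidCol (nl : ℕ → List ℕ) (s : ℕ) (p : ℕ → ℕ) (col : ℕ → ℕ) : Prop where
  le : ∀ v, col v ≤ s
  deg : ∀ i < s, DegenerateOn nl {v | col v = i + 1} (p i)

/-- No part can take the vertex `v`. -/
def Stuck (nl : ℕ → List ℕ) (s : ℕ) (p : ℕ → ℕ) (col : ℕ → ℕ) (v : ℕ) : Prop :=
  ∀ i < s, p i + 1 ≤ colCount nl col v (i + 1)

/-- Colour the uncoloured vertex `v` with the colour of `u`, which becomes uncoloured. -/
def moveHole (col : ℕ → ℕ) (v u : ℕ) : ℕ → ℕ :=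
  Function.update (Function.update col v (col u)) u 0

/-- The colouring after the uncoloured vertex has moved from `v` along a walk. -/
def walkCol : (ℕ → ℕ) → ℕ → List ℕ → (ℕ → ℕ)
  | col, _, [] => col
  | col, v, u :: w => walkCol (moveHole col v u) u w

/-- No part can take the uncoloured vertex at any time while it moves from `v` along a walk. -/
def StuckAlong (nl : ℕ → List ℕ) (s : ℕ) (p : ℕ → ℕ) : (ℕ → ℕ) → ℕ → List ℕ → Prop
  | col, v, [] => Stuck nl s p col v
  | col, v, u :: w => Stuck nl s p col v ∧ StuckAlong nl s p (moveHole col v u) u w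

/-- Consecutive vertices of `v :: w` are adjacent. -/
def IsWalkFrom (nl : ℕ → List ℕ) : ℕ → List ℕ → Prop
  | _, [] => True
  | v, u :: w => u ∈ nl v ∧ IsWalkFrom nl u w

/-- All vertices have colours at most `s`, and `v` is the only uncoloured vertex. -/
structure HoleCol (n s : ℕ) (col : ℕ → ℕ) (v : ℕ) : Prop where
  le : ∀ x, col x ≤ s
  hole : ∀ x < n, col x = 0 ↔ x = v

variable {n s : ℕ} {nl : ℕ → List ℕ} {p : ℕ → ℕ}

theorem sum_countP_le (l : List ℕ) (f : ℕ → ℕ) (m : ℕ) :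
    ∑ i ∈ Finset.range m, l.countP (fun u => f u = i) ≤ l.length := by
  induction l with
  | nil => simp
  | cons a l ih =>
    simp only [List.countP_cons, Finset.sum_add_distrib, List.length_cons]
    refine Nat.add_le_add ih ?_
    simp [Finset.sum_ite_eq]
    split <;> simp

theorem sum_colCount_le (col : ℕ → ℕ) (v : ℕ) :
    ∑ i ∈ Finset.range s, colCount nl col v (i + 1) + colCount nl col v 0 ≤ (nl v).length := by
  have := sum_countP_le (nl v) col (s + 1)
  rwa [Finset.sum_range_succ'] at this

theorem validCol_zero : ValidCol nl s p fun _ => 0 := by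
  refine ⟨fun _ => Nat.zero_le _, fun i _ X hX hA => ?_⟩
  obtain ⟨x, hx⟩ := hX
  simpa using hA hx

/-- A subset of the enlarged part that contains `v` has `v` itself as its vertex of small degree;
any other subset was already present before. -/
theorem ValidCol.set (G : NatGraph n nl) {col : ℕ → ℕ} (h : ValidCol nl s p col) {v i : ℕ}
    (hi : i < s) (hc : colCount nl col v (i + 1) ≤ p i) :
    ValidCol nl s p (Function.update col v (i + 1)) := by
  refine ⟨fun x => ?_, fun j hj X hX hA => ?_⟩
  · by_cases hx : x = v
    · simp [hx]; omega
    · simpa [hx] using h.le x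
  · by_cases hvX : v ∈ X
    · have hji : j = i := by
        have := hA hvX
        simp at this
        exact this.symm
      subst hji
      refine ⟨v, hvX, le_trans ?_ hc⟩
      refine List.countP_mono_left fun u hu hux => ?_
      have huv : u ≠ v := fun e => G.irrefl v (e ▸ hu)
      have := hA (by simpa using hux : u ∈ X)
      simpa [huv] using this
    · refine h.deg j hj X hX fun x hx => ?_
      have hxv : x ≠ v := fun e => hvX (e ▸ hx)
      have := hA hx
      simpa [hxv] using this

theorem ValidCol.unset {col : ℕ → ℕ} (h : ValidCol nl s p col) (v : ℕ) :
    ValidCol nl s p (Function.update col v 0) := by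
  refine ⟨fun x => ?_, fun j hj X hX hA => ?_⟩
  · by_cases hx : x = v
    · simp [hx]
    · simpa [hx] using h.le x
  · refine h.deg j hj X hX fun x hx => ?_
    have := hA hx
    by_cases hxv : x = v
    · simp [hxv] at this
    · simpa [hxv] using this

/-! ### Tight counts at a stuck vertex. -/

/-- The hypotheses of the partition theorem, in terms of natural numbers. -/
structure Instance (n : ℕ) (nl : ℕ → List ℕ) (s : ℕ) (p : ℕ → ℕ) (Δ : ℕ) : Prop where
  graph : NatGraph n nl
  deg_le : ∀ v, (nl v).length ≤ Δ
  le_sum : Δ ≤ ∑ i ∈ Finset.range s, (p i + 1)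
  three_le : 3 ≤ Δ
  two_le : 2 ≤ s
  pos : 0 < n
  conn : ∀ A : Set ℕ, (∃ v < n, v ∈ A) → (∀ v ∈ A, ∀ u ∈ nl v, u ∈ A) → ∀ v < n, v ∈ A
  not_complete : ∃ u < n, ∃ v < n, u ≠ v ∧ v ∉ nl u

variable {Δ : ℕ}

namespace Instance

/-- The lower bounds `p i + 1` sum to at least `Δ`, while the counts sum to at most the degree; so
no bound is exceeded. -/
theorem colCount_eq (I : Instance n nl s p Δ) {col : ℕ → ℕ} {v : ℕ} (h : Stuck nl s p col v) :
    ∀ i < s, colCount nl col v (i + 1) = p i + 1 := by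
  have h1 := sum_colCount_le (nl := nl) (s := s) col v
  have h2 := I.deg_le v
  have h3 := I.le_sum
  intro i hi
  refine ((Finset.sum_eq_sum_iff_of_le fun j hj => h j (Finset.mem_range.1 hj)).1 ?_ i
    (Finset.mem_range.2 hi)).symm
  have h4 := Finset.sum_le_sum (s := Finset.range s) fun j hj => h j (Finset.mem_range.1 hj)
  omega

theorem length_eq (I : Instance n nl s p Δ) {col : ℕ → ℕ} {v : ℕ} (h : Stuck nl s p col v) :
    (nl v).length = Δ := by
  have h1 := sum_colCount_le (nl := nl) (s := s) col v
  have h2 := I.deg_le v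
  have h3 := I.le_sum
  have h4 := Finset.sum_le_sum (s := Finset.range s) fun j hj => h j (Finset.mem_range.1 hj)
  omega

/-- An uncoloured neighbour leaves at most `Δ - 1` coloured ones, too few to block all the parts.
This drives the greedy colouring. -/
theorem not_stuck (I : Instance n nl s p Δ) {col : ℕ → ℕ} {u v : ℕ} (hu : u ∈ nl v)
    (hc : col u = 0) : ¬ Stuck nl s p col v := by
  intro h
  have h1 := sum_colCount_le (nl := nl) (s := s) col v
  have h2 := I.deg_le v
  have h3 := I.le_sum
  have h4 := Finset.sum_le_sum (s := Finset.range s) fun j hj => h j (Finset.mem_range.1 hj)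
  have h5 : 0 < colCount nl col v 0 := List.countP_pos_iff.2 ⟨u, hu, by simpa using hc⟩
  omega

/-- The uncoloured vertex may move to a neighbour. -/
theorem validCol_moveHole (I : Instance n nl s p Δ) {col : ℕ → ℕ} {u v : ℕ}
    (h : ValidCol nl s p col) (hs : Stuck nl s p col v) (hu : u ∈ nl v)
    (hc : col u ≠ 0) : ValidCol nl s p (moveHole col v u) := by
  have huv : u ≠ v := fun e => I.graph.irrefl v (e ▸ hu)
  obtain ⟨i, hi⟩ := Nat.exists_eq_succ_of_ne_zero hc
  have his : i < s := by have := h.le u; omega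
  -- Uncolouring `u` first lowers the count of its colour around `v` from `p i + 1` to `p i`, which
  -- makes room for `v`.
  have h1 := (h.unset u).set I.graph (v := v) (i := i) his ?_
  · rw [moveHole, Function.update_comm huv.symm, hi]
    exact h1
  · have h2 := I.colCount_eq hs i his
    obtain ⟨l₁, l₂, hl⟩ := List.append_of_mem hu
    have hn := I.graph.nodup v
    have hmem : ∀ x ∈ l₁ ++ l₂, x ≠ u := by
      rw [hl, List.nodup_middle, List.nodup_cons] at hn
      rintro x hx rfl
      exact hn.1 hx
    have h3 : ∀ l : List ℕ, (∀ x ∈ l, x ≠ u) →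
        l.countP (fun x => decide (Function.update col u 0 x = i + 1)) =
          l.countP (fun x => decide (col x = i + 1)) := by
      intro l hl
      refine List.countP_congr fun x hx => ?_
      simp [hl x hx]
    simp only [colCount, hl, List.countP_append, List.countP_cons] at h2 ⊢
    rw [h3 l₁ fun x hx => hmem x (by simp [hx]), h3 l₂ fun x hx => hmem x (by simp [hx])]
    simp [hi] at h2 ⊢
    omega

end Instance

/-! ### Moving the hole along walks. -/

theorem HoleCol.moveHole (G : NatGraph n nl) {col : ℕ → ℕ} {u v : ℕ} (h : HoleCol n s col v)
    (hu : u ∈ nl v) : HoleCol n s (moveHole col v u) u := by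
  have huv : u ≠ v := fun e => G.irrefl v (e ▸ hu)
  have hun := G.lt hu
  refine ⟨fun x => ?_, fun x hx => ?_⟩
  · unfold NatGraph.moveHole
    by_cases h1 : x = u
    · simp [h1]
    · by_cases h2 : x = v
      · subst h2; simpa [h1] using h.le u
      · simpa [h1, h2] using h.le x
  · unfold NatGraph.moveHole
    by_cases h1 : x = u
    · simp [h1]
    · by_cases h2 : x = v
      · subst h2; simpa [h1, (h.hole u hun)] using huv
      · simpa [h1, h2] using h.hole x hx

theorem HoleCol.walkCol (G : NatGraph n nl) {w : List ℕ} : ∀ {col : ℕ → ℕ} {v : ℕ},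
    HoleCol n s col v → IsWalkFrom nl v w → HoleCol n s (walkCol col v w) (w.getLastD v) := by
  induction w with
  | nil => intro col v h _; exact h
  | cons u w ih =>
    intro col v h hw
    rw [List.getLastD_cons]
    exact ih (h.moveHole G hw.1) hw.2

theorem walkCol_append (w₁ w₂ : List ℕ) : ∀ (col : ℕ → ℕ) (v : ℕ),
    walkCol col v (w₁ ++ w₂) = walkCol (walkCol col v w₁) (w₁.getLastD v) w₂ := by
  induction w₁ with
  | nil => intro col v; rfl
  | cons u w ih => intro col v; rw [List.getLastD_cons]; exact ih _ _

theorem isWalkFrom_append (w₁ w₂ : List ℕ) : ∀ v : ℕ,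
    IsWalkFrom nl v (w₁ ++ w₂) ↔ IsWalkFrom nl v w₁ ∧ IsWalkFrom nl (w₁.getLastD v) w₂ := by
  induction w₁ with
  | nil => intro v; simp [IsWalkFrom]
  | cons u w ih => intro v; rw [List.getLastD_cons]; simp [IsWalkFrom, ih, and_assoc]

theorem StuckAlong.stuck {col : ℕ → ℕ} {v : ℕ} {w : List ℕ} (h : StuckAlong nl s p col v w) :
    Stuck nl s p col v := by
  cases w with
  | nil => exact h
  | cons u w => exact h.1

theorem StuckAlong.of_append {w₁ w₂ : List ℕ} : ∀ {col : ℕ → ℕ} {v : ℕ},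
    StuckAlong nl s p col v (w₁ ++ w₂) →
    StuckAlong nl s p (walkCol col v w₁) (w₁.getLastD v) w₂ := by
  induction w₁ with
  | nil => intro col v h; exact h
  | cons u w ih =>
    intro col v h
    rw [List.getLastD_cons]
    exact ih h.2

/-! ### Rotation of colours along closed walks. -/

/-- The list `q 0, …, q (K - 1)`. -/
abbrev tab (K : ℕ) (q : ℕ → ℕ) : List ℕ := (List.range K).map q

theorem tab_succ (K : ℕ) (q : ℕ → ℕ) : tab (K + 1) q = q 0 :: tab K fun t => q (t + 1) := by
  simp [tab, List.range_succ_eq_map]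

theorem tab_succ' (K : ℕ) (q : ℕ → ℕ) : tab (K + 1) q = tab K q ++ [q K] := by
  simp [tab, List.range_succ]

/-- Each move hands a vertex's colour back to its predecessor. The induction peels off the first
move, after which the hole starts from `q 0` and the rest of the sequence is still untouched. -/
theorem walkCol_tab (K : ℕ) : ∀ (q : ℕ → ℕ) (f : ℕ → ℕ) (r : ℕ),
    (∀ t ≤ K, ∀ t' ≤ K, q t = q t' → t = t') → (∀ t ≤ K, q t ≠ r) →
    walkCol f r (tab (K + 1) q) r = f (q 0) ∧
    (∀ t < K, walkCol f r (tab (K + 1) q) (q t) = f (q (t + 1))) ∧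
    walkCol f r (tab (K + 1) q) (q K) = 0 ∧
    ∀ x, x ≠ r → (∀ t ≤ K, q t ≠ x) → walkCol f r (tab (K + 1) q) x = f x := by
  induction K with
  | zero =>
    intro q f r hinj hr
    have h0 := hr 0 le_rfl
    refine ⟨by simp [tab, walkCol, moveHole, h0.symm], by simp,
      by simp [tab, walkCol, moveHole], ?_⟩
    intro x hx hq
    simp [tab, walkCol, moveHole, hx, (hq 0 le_rfl).symm]
  | succ K ih =>
    intro q f r hinj hr
    have h0 := hr 0 (Nat.zero_le _)
    have hne : ∀ t ≤ K, q (t + 1) ≠ q 0 := fun t ht e => by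
      have := hinj (t + 1) (by omega) 0 (by omega) e
      omega
    obtain ⟨h1, h2, h3, h4⟩ := ih (fun t => q (t + 1)) (moveHole f r (q 0)) (q 0)
      (fun t ht t' ht' e => by
        have := hinj (t + 1) (by omega) (t' + 1) (by omega) e
        omega) hne
    have hw : walkCol f r (tab (K + 1 + 1) q) =
        walkCol (moveHole f r (q 0)) (q 0) (tab (K + 1) fun t => q (t + 1)) := by
      rw [tab_succ]; rfl
    have hf : ∀ t ≤ K, moveHole f r (q 0) (q (t + 1)) = f (q (t + 1)) := fun t ht => by
      simp [moveHole, hne t ht, hr (t + 1) (by omega)]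
    rw [hw]
    refine ⟨?_, ?_, h3, ?_⟩
    · rw [h4 r h0.symm fun t ht => hr (t + 1) (by omega)]
      simp [moveHole, h0.symm]
    · intro t ht
      rcases t with _ | t
      · rw [h1, hf 0 (Nat.zero_le _)]
      · rw [h2 t (by omega), hf (t + 1) (by omega)]
    · intro x hx hq
      rw [h4 x (hq 0 (Nat.zero_le _)).symm fun t ht => hq (t + 1) (by omega)]
      simp [moveHole, hx, (hq 0 (Nat.zero_le _)).symm]

/-- `g` arises from `f` by moving each of the colours on the sequence `q` one place forward. -/
structure IsRotation (K : ℕ) (q : ℕ → ℕ) (r : ℕ) (f g : ℕ → ℕ) : Prop where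
  other : ∀ x, x ≠ r → (∀ t ≤ K, q t ≠ x) → g x = f x
  succ : ∀ t < K, g (q t) = f (q (t + 1))
  last : g (q K) = f (q 0)

/-- Before the last move `r` holds the colour of `q 0`; returning the hole to `r` passes this colour
on to `q K`. -/
theorem isRotation_walkCol {K : ℕ} {q : ℕ → ℕ} {r : ℕ}
    (hinj : ∀ t ≤ K, ∀ t' ≤ K, q t = q t' → t = t') (hr : ∀ t ≤ K, q t ≠ r) (f : ℕ → ℕ) :
    IsRotation K q r f (walkCol f r (tab (K + 1) q ++ [r])) := by
  obtain ⟨h1, h2, h3, h4⟩ := walkCol_tab K q f r hinj hr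
  have hl : (tab (K + 1) q).getLastD r = q K := by rw [tab_succ']; simp
  rw [walkCol_append, hl]
  set c := walkCol f r (tab (K + 1) q)
  refine ⟨fun x hx hq => ?_, fun t ht => ?_, ?_⟩
  · simp [walkCol, moveHole, hx, (hq K le_rfl).symm, h4 x hx hq]
  · have hne : q t ≠ q K := fun e => by have := hinj t ht.le K le_rfl e; omega
    simp [walkCol, moveHole, hne, hr t ht.le, h2 t ht]
  · simp [walkCol, moveHole, hr K le_rfl, h1]

/-- Only `a` and `b` change colour. Under `f` the colour `f b` is contributed by `b`, and by `a`
exactly if `f a = f b`; under `g` the vertex `b` contributes exactly if `f a = f b`. Equal counts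
leave one contribution, which must come from `a`. -/
theorem eq_of_countP_eq {l : List ℕ} {f g : ℕ → ℕ} {a b : ℕ} (hl : l.Nodup) (hab : a ≠ b)
    (ha : a ∈ l) (hb : b ∈ l) (hfg : ∀ x ∈ l, x ≠ a → x ≠ b → g x = f x) (hgb : g b = f a)
    (hc : l.countP (fun x => f x = f b) = l.countP (fun x => g x = f b)) : g a = f b := by
  have hp : l.Perm (a :: b :: (l.erase a).erase b) :=
    (List.perm_cons_erase ha).trans
      (List.Perm.cons a (List.perm_cons_erase ((List.mem_erase_of_ne hab.symm).2 hb)))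
  have hc' : ((l.erase a).erase b).countP (fun x => decide (f x = f b)) =
      ((l.erase a).erase b).countP (fun x => decide (g x = f b)) := by
    refine List.countP_congr fun x hx => ?_
    have hx1 := (List.Nodup.mem_erase_iff (hl.erase a)).1 hx
    have hx2 := (List.Nodup.mem_erase_iff hl).1 hx1.2
    rw [hfg x hx2.2 hx2.1 hx1.1]
  rw [hp.countP_eq, hp.countP_eq] at hc
  simp only [List.countP_cons, hc', hgb] at hc
  by_contra hne
  simp [hne] at hc

namespace Instance

/-- Among the neighbours of `r` only `q 0` and `q K` are recoloured, and `q K` receives the colour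
of `q 0`. Since `r` is stuck before and after, the colour that `q K` loses must reappear at `q 0`,
which receives that of `q 1`. -/
theorem rotation_eq (I : Instance n nl s p Δ) {K : ℕ} {q : ℕ → ℕ} {r : ℕ} {f g : ℕ → ℕ}
    (hinj : ∀ t ≤ K, ∀ t' ≤ K, q t = q t' → t = t') (hK : 1 ≤ K)
    (h0 : q 0 ∈ nl r) (hl : q K ∈ nl r) (hint : ∀ t, 0 < t → t < K → q t ∉ nl r)
    (hf : HoleCol n s f r) (hrot : IsRotation K q r f g)
    (hsf : Stuck nl s p f r) (hsg : Stuck nl s p g r) : f (q 1) = f (q K) := by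
  have hlr : q K ≠ r := fun e => I.graph.irrefl r (e ▸ hl)
  have hfl : f (q K) ≠ 0 := fun e => hlr ((hf.hole _ (I.graph.lt hl)).1 e)
  have hab : q 0 ≠ q K := fun e => by have := hinj 0 (by omega) K le_rfl e; omega
  have key := eq_of_countP_eq (f := f) (g := g) (I.graph.nodup r) hab h0 hl ?_ hrot.last ?_
  · rw [hrot.succ 0 (by omega)] at key
    exact key
  · intro x hx hxa hxb
    refine hrot.other x (fun e => I.graph.irrefl r (e ▸ hx)) fun t ht e => ?_
    have ht0 : t ≠ 0 := by rintro rfl; exact hxa e.symm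
    have htK : t ≠ K := by rintro rfl; exact hxb e.symm
    exact hint t (by omega) (by omega) (e ▸ hx)
  · obtain ⟨i, hi⟩ := Nat.exists_eq_succ_of_ne_zero hfl
    have his : i < s := by have := hf.le (q K); omega
    have h1 := I.colCount_eq hsf i his
    have h2 := I.colCount_eq hsg i his
    unfold colCount at h1 h2
    rw [hi, Nat.succ_eq_add_one, h1, h2]

/-! ### Ears, feeders and diamonds. -/

/-- The data of a closed walk `r, q 0, …, q K, r` along a cycle whose only edges at `r` are the
first and the last one. -/
structure IsEar (n : ℕ) (nl : ℕ → List ℕ) (r K : ℕ) (q : ℕ → ℕ) : Prop where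
  two_le : 2 ≤ K
  inj : ∀ t ≤ K, ∀ t' ≤ K, q t = q t' → t = t'
  first : q 0 ∈ nl r
  last : q K ∈ nl r
  inner : ∀ t, 0 < t → t < K → q t ∉ nl r
  walk : ∀ t < K, q (t + 1) ∈ nl (q t)
  ne : ∀ t ≤ K, q t ≠ r

theorem isWalkFrom_tab (K : ℕ) : ∀ (q : ℕ → ℕ) (r : ℕ), q 0 ∈ nl r →
    (∀ t < K, q (t + 1) ∈ nl (q t)) → IsWalkFrom nl r (tab (K + 1) q) := by
  induction K with
  | zero => intro q r h0 _; simp [tab, IsWalkFrom, h0]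
  | succ K ih =>
    intro q r h0 hw
    rw [tab_succ]
    exact ⟨h0, ih _ _ (hw 0 (by omega)) fun t ht => hw (t + 1) (by omega)⟩

theorem isWalkFrom_closed (G : NatGraph n nl) {K : ℕ} {q : ℕ → ℕ} {r : ℕ} (h0 : q 0 ∈ nl r)
    (hw : ∀ t < K, q (t + 1) ∈ nl (q t)) (hl : q K ∈ nl r) :
    IsWalkFrom nl r (tab (K + 1) q ++ [r]) := by
  rw [isWalkFrom_append]
  refine ⟨isWalkFrom_tab K q r h0 hw, ?_⟩
  have hl' : (tab (K + 1) q).getLastD r = q K := by rw [tab_succ']; simp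
  rw [hl']
  exact ⟨G.symm hl, trivial⟩

theorem getLastD_closed (l : List ℕ) (r v : ℕ) : (l ++ [r]).getLastD v = r := by simp

theorem IsEar.isWalkFrom (G : NatGraph n nl) {r K : ℕ} {q : ℕ → ℕ} (h : IsEar n nl r K q) :
    IsWalkFrom nl r (tab (K + 1) q ++ [r]) :=
  isWalkFrom_closed G h.first h.walk h.last

theorem IsEar.reverse (G : NatGraph n nl) {r K : ℕ} {q : ℕ → ℕ} (h : IsEar n nl r K q) :
    IsEar n nl r K fun t => q (K - t) where
  two_le := h.two_le
  inj t ht t' ht' e := by have := h.inj _ (by omega) _ (by omega) e; omega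
  first := by simpa using h.last
  last := by simpa using h.first
  inner t h1 h2 := h.inner _ (by omega) (by omega)
  walk t ht := by
    have := h.walk (K - (t + 1)) (by omega)
    rw [show K - (t + 1) + 1 = K - t by omega] at this
    exact G.symm this
  ne t _ := h.ne _ (by omega)

/-- What is known after one and after two turns around an ear. -/
theorem ear_one (I : Instance n nl s p Δ) {r K : ℕ} {q : ℕ → ℕ} (h : IsEar n nl r K q)
    {f : ℕ → ℕ} (hf : HoleCol n s f r) {w : List ℕ}
    (hs : StuckAlong nl s p f r (tab (K + 1) q ++ [r] ++ w)) :
    f (q 1) = f (q K) ∧ ∃ g, IsRotation K q r f g ∧ HoleCol n s g r ∧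
      StuckAlong nl s p g r w := by
  have h1 := hs.of_append
  rw [getLastD_closed] at h1
  have hrot := isRotation_walkCol h.inj h.ne f
  have hg := hf.walkCol I.graph (h.isWalkFrom I.graph)
  rw [getLastD_closed] at hg
  exact ⟨I.rotation_eq h.inj (by have := h.two_le; omega) h.first h.last h.inner hf hrot hs.stuck
    h1.stuck, _, hrot, hg, h1⟩

/-- The equality from the second turn, read through the rotation of the first, becomes `f (q 2) = f
(q 0)`. It makes the two final colours at `q 0` and `q (K - 1)` equal. -/
theorem ear_two (I : Instance n nl s p Δ) {r K : ℕ} {q : ℕ → ℕ} (h : IsEar n nl r K q)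
    {f : ℕ → ℕ} (hf : HoleCol n s f r) {w : List ℕ}
    (hs : StuckAlong nl s p f r (tab (K + 1) q ++ [r] ++ (tab (K + 1) q ++ [r] ++ w))) :
    f (q 1) = f (q K) ∧ f (q 2) = f (q 0) ∧ ∃ g, HoleCol n s g r ∧ StuckAlong nl s p g r w ∧
      (∀ x, x ≠ r → (∀ t ≤ K, q t ≠ x) → g x = f x) ∧ g (q 0) = f (q 0) ∧
      g (q (K - 1)) = f (q 0) := by
  have hK := h.two_le
  obtain ⟨h1, g, hrot, hg, hs⟩ := I.ear_one h hf hs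
  obtain ⟨h2, g', hrot', hg', hs'⟩ := I.ear_one h hg hs
  rw [hrot.succ 1 (by omega), hrot.last] at h2
  refine ⟨h1, h2, g', hg', hs', fun x hx hq => ?_, ?_, ?_⟩
  · rw [hrot'.other x hx hq, hrot.other x hx hq]
  · rw [hrot'.succ 0 (by omega), hrot.succ 1 (by omega), h2]
  · rw [hrot'.succ (K - 1) (by omega), Nat.sub_add_cancel (by omega), hrot.last]

/-- A closed walk `r, e 0, …, e M, r` whose last vertex is the first vertex of an ear. -/
structure IsFeeder (nl : ℕ → List ℕ) (r K : ℕ) (q : ℕ → ℕ) (M : ℕ) (e : ℕ → ℕ) : Prop where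
  inj : ∀ t ≤ M, ∀ t' ≤ M, e t = e t' → t = t'
  first : e 0 ∈ nl r
  walk : ∀ t < M, e (t + 1) ∈ nl (e t)
  ne : ∀ t ≤ M, e t ≠ r
  last : e M = q 0
  disj : ∀ t < M, ∀ t' ≤ K, e t ≠ q t'
  pos : 0 < M

/-- After two turns `q 0` and `q (K - 1)` share a colour. The feeder replaces only the first of
these by the colour of `e 0`, whereas the turn in the reverse direction requires them to be equal.
-/
theorem not_stuckAlong_ear (I : Instance n nl s p Δ) {r K M : ℕ} {q e : ℕ → ℕ}
    (h : IsEar n nl r K q) (he : IsFeeder nl r K q M e) {f : ℕ → ℕ} (hf : HoleCol n s f r)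
    (hne : f (e 0) ≠ f (q 0)) :
    ¬ StuckAlong nl s p f r (tab (K + 1) q ++ [r] ++ (tab (K + 1) q ++ [r] ++
      (tab (M + 1) e ++ [r] ++ (tab (K + 1) (fun t => q (K - t)) ++ [r])))) := by
  intro hs
  have hK := h.two_le
  have hM := he.pos
  obtain ⟨-, -, g, hg, hs, hother, hg0, hg1⟩ := I.ear_two h hf hs
  have hrot := isRotation_walkCol he.inj he.ne g
  have hg' := hg.walkCol I.graph (isWalkFrom_closed I.graph he.first he.walk
    (by rw [he.last]; exact h.first))
  have hs' := hs.of_append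
  rw [getLastD_closed] at hs' hg'
  rw [← List.append_nil (tab (K + 1) (fun t => q (K - t)) ++ [r])] at hs'
  obtain ⟨h1, -⟩ := I.ear_one (h.reverse I.graph) hg' hs'
  rw [Nat.sub_self] at h1
  have h2 := hrot.last
  rw [he.last] at h2
  -- The feeder meets the ear only in `q 0`, and `2 ≤ K` separates `q 0` from `q (K - 1)`.
  have h3 := hrot.other (q (K - 1)) (h.ne _ (by omega)) fun t ht e' => by
    rcases Nat.lt_or_ge t M with h' | h'
    · exact he.disj t h' (K - 1) (by omega) e'
    · obtain rfl : t = M := by omega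
      rw [he.last] at e'
      have := h.inj 0 (by omega) (K - 1) (by omega) e'
      omega
  rw [h2, h3, hg1, hother _ (he.ne 0 (by omega)) fun t ht e' => he.disj 0 hM t ht e'.symm] at h1
  exact hne h1.symm

/-- As before, after an additional turn around the ear. -/
theorem not_stuckAlong_ear' (I : Instance n nl s p Δ) {r K M : ℕ} {q e : ℕ → ℕ}
    (h : IsEar n nl r K q) (he : IsFeeder nl r K q M e) {f : ℕ → ℕ} (hf : HoleCol n s f r)
    (heq : f (e 0) = f (q 0)) (hne : f (q K) ≠ f (q 0)) :
    ¬ StuckAlong nl s p f r (tab (K + 1) q ++ [r] ++ (tab (K + 1) q ++ [r] ++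
      (tab (K + 1) q ++ [r] ++
      (tab (M + 1) e ++ [r] ++ (tab (K + 1) (fun t => q (K - t)) ++ [r]))))) := by
  intro hs
  have hK := h.two_le
  obtain ⟨h1, g, hrot, hg, hs⟩ := I.ear_one h hf hs
  refine I.not_stuckAlong_ear h he hg ?_ hs
  -- The extra turn gives `q 0` the colour `f (q 1) = f (q K)`, while `e 0` lies off the ear and
  -- keeps `f (q 0)`.
  rw [hrot.succ 0 (by omega), h1,
    hrot.other _ (he.ne 0 (by omega)) fun t ht e' => he.disj 0 he.pos t ht e'.symm, heq]
  exact hne.symm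

/-- Seen from `v`, the vertices `r`, `w`, `u` form an ear because `w` is not adjacent to `v`. When
the hole moves from `r` to `v`, the colour of `v` passes to `r`; the two equalities of `ear_two`
then make the original colours of `u`, `v`, `w` agree. -/
theorem not_stuckAlong_diamond (I : Instance n nl s p Δ) {r u v w : ℕ} (hvr : v ∈ nl r)
    (hur : u ∈ nl r) (hwr : w ∈ nl r) (huw : u ∈ nl w) (huv : u ∈ nl v) (hwv : w ∉ nl v)
    (hwv' : w ≠ v) {f : ℕ → ℕ} (hf : HoleCol n s f r) (hne : ¬ (f u = f v ∧ f w = f v)) :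
    ¬ StuckAlong nl s p f r [v, r, w, u, v, r, w, u, v] := by
  intro hs
  have G := I.graph
  have hirr : ∀ {x y}, x ∈ nl y → x ≠ y := fun h e => G.irrefl _ (e ▸ h)
  have e1 := hirr hvr
  have e2 := hirr hur
  have e3 := hirr hwr
  have e4 := hirr huw
  have e5 := hirr huv
  let q : ℕ → ℕ := fun t => if t = 0 then r else if t = 1 then w else u
  have hear : IsEar n nl v 2 q := by
    refine ⟨le_rfl, ?_, G.symm hvr, huv, ?_, ?_, ?_⟩
    · intro t ht t' ht' e
      interval_cases t <;> interval_cases t' <;> simp [q, *] at e ⊢ <;>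
        first | exact e2 e.symm | exact e3 e.symm | exact e4 e.symm
    · intro t h1 h2
      interval_cases t
      simpa [q] using hwv
    · intro t ht
      interval_cases t
      · simpa [q] using hwr
      · simpa [q] using huw
    · intro t ht
      interval_cases t <;> simp [q, e5, hwv', e1.symm]
  -- After the initial move to `v`, the remaining list is two turns around the ear at `v`.
  have hs' : StuckAlong nl s p (moveHole f r v) v
      (tab (2 + 1) q ++ [v] ++ (tab (2 + 1) q ++ [v] ++ [])) := by
    exact hs.2
  obtain ⟨h1, h2, -⟩ := I.ear_two hear (hf.moveHole G hvr) hs'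
  simp [q, moveHole, e1.symm, e2, e3, e5, hwv'] at h1 h2
  exact hne ⟨h2, h1.trans h2⟩

/-- A diamond together with a closed walk that brings a new colour into it. -/
theorem not_stuckAlong_diamond' (I : Instance n nl s p Δ) {r u v w : ℕ} (hvr : v ∈ nl r)
    (hur : u ∈ nl r) (hwr : w ∈ nl r) (huw : u ∈ nl w) (huv : u ∈ nl v) (hwv : w ∉ nl v)
    (hwv' : w ≠ v) {f : ℕ → ℕ} (hf : HoleCol n s f r) (hu : f u = f v) (hw : f w = f v)
    {M : ℕ} {e : ℕ → ℕ} (hinj : ∀ t ≤ M, ∀ t' ≤ M, e t = e t' → t = t') (h0 : e 0 ∈ nl r)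
    (hwalk : ∀ t < M, e (t + 1) ∈ nl (e t)) (hner : ∀ t ≤ M, e t ≠ r) (hlast : e M = u)
    (hcol : f (e 0) ≠ f v) (hmem : (∀ t ≤ M, e t ≠ w) ∨ ∃ t < M, e t = w ∧ e (t + 1) = u) :
    ¬ StuckAlong nl s p f r (tab (M + 1) e ++ [r] ++ [v, r, w, u, v, r, w, u, v]) := by
  intro hs
  have hrot := isRotation_walkCol hinj hner f
  have hg := hf.walkCol I.graph (isWalkFrom_closed I.graph h0 hwalk (hlast ▸ hur))
  have hs' := hs.of_append
  rw [getLastD_closed] at hs' hg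
  refine I.not_stuckAlong_diamond hvr hur hwr huw huv hwv hwv' hg ?_ hs'
  rintro ⟨h1, h2⟩
  have h3 := hrot.last
  rw [hlast] at h3
  -- Either the walk misses `w`, or `w` immediately precedes `u` and inherits its colour; in both
  -- cases `w` ends with the old common colour, while `u` gets that of `e 0`.
  have h4 : walkCol f r (tab (M + 1) e ++ [r]) w = f v := by
    rcases hmem with h | ⟨t, ht, rfl, he⟩
    · rw [hrot.other w (fun e => I.graph.irrefl r (e ▸ hwr)) h, hw]
    · rw [hrot.succ t ht, he, hu]
  rw [h3, ← h2, h4] at h1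
  exact hcol h1

end Instance

end NatGraph

/-! ### Memory layout and traversal of adjacency lists. -/

namespace RAM

/-- Sequential composition of a list of programs. -/
def block : List Program → Program
  | [] => .skip
  | c :: cs => .seq c (block cs)

/-- `x := k` -/
abbrev ct (x k : ℕ) : Program := .instr (.const x k)
/-- `x := y` -/
abbrev cp (x y : ℕ) : Program := .instr (.copy x y)
/-- `x := y + z` -/
abbrev ad (x y z : ℕ) : Program := .instr (.add x y z)
/-- `x := y - z` -/
abbrev sb (x y z : ℕ) : Program := .instr (.sub x y z)
/-- `x := a[y]` -/
abbrev ld (x a y : ℕ) : Program := .instr (.load x a y)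
/-- `a[x] := y` -/
abbrev st (a x y : ℕ) : Program := .instr (.store a x y)

section

variable {W k : ℕ} {σ : State} {Q : ℕ → State → Prop}

@[simp] theorem wp_block_nil : wp W (block []) k σ Q ↔ Q k σ := wp_skip

@[simp] theorem wp_block_cons {c : Program} {cs : List Program} :
    wp W (block (c :: cs)) k σ Q ↔ wp W c k σ fun k' σ' => wp W (block cs) k' σ' Q := wp_seq

end

/-- The part of the state that the program never changes; register `2` holds `0` and register `3`
holds `1`. -/
structure Base (n s : ℕ) (A₀ A₁ p : ℕ → ℕ) (σ : State) : Prop where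
  reg0 : σ.reg 0 = n
  reg1 : σ.reg 1 = s
  reg2 : σ.reg 2 = 0
  reg3 : σ.reg 3 = 1
  arr0 : σ.arr 0 = A₀
  arr1 : σ.arr 1 = A₁
  arr2 : σ.arr 2 = p

/-- The total size of a graph. -/
def size (n : ℕ) (nl : ℕ → List ℕ) : ℕ := ∑ v ∈ Finset.range n, ((nl v).length + 1)

/-- An instance of the partition problem together with its representation in the memory. -/
structure Env (W n s : ℕ) (nl : ℕ → List ℕ) (A₀ A₁ p : ℕ → ℕ) (Δ : ℕ) : Prop where
  inst : NatGraph.Instance n nl s p Δ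
  off_succ : ∀ v < n, A₀ (v + 1) = A₀ v + (nl v).length
  off_lt : ∀ v ≤ n, A₀ v < W
  get : ∀ v < n, ∀ k (h : k < (nl v).length), A₁ (A₀ v + k) = (nl v)[k]
  word : 1000 * size n nl ≤ W

theorem length_lt_size {n : ℕ} {nl : ℕ → List ℕ} {v : ℕ} (hv : v < n) :
    (nl v).length + 1 ≤ size n nl :=
  Finset.single_le_sum (f := fun v => (nl v).length + 1) (fun _ _ => Nat.zero_le _)
    (Finset.mem_range.2 hv)

theorem le_size {n : ℕ} {nl : ℕ → List ℕ} : n ≤ size n nl := by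
  unfold size
  rw [Finset.sum_add_distrib]
  simp

/-- Execute `body` for all neighbours of the vertex in register `rv`; register `22` holds the
current neighbour. -/
def forNbr (rv : ℕ) (body : Program) : Program :=
  block [ld 20 0 rv, ad 23 rv 3, ld 21 0 23,
    .loop (.lt 20 21) (block [ld 22 1 20, body, ad 20 20 3])]

variable {W n s Δ : ℕ} {nl : ℕ → List ℕ} {A₀ A₁ p : ℕ → ℕ} {σ : State}

theorem Base.setReg (h : Base n s A₀ A₁ p σ) {x v : ℕ} (hx : 4 ≤ x) :
    Base n s A₀ A₁ p (σ.setReg x v) := by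
  obtain ⟨h0, h1, h2, h3, h4, h5, h6⟩ := h
  constructor <;> simp [*] <;> omega

theorem Base.setArr (h : Base n s A₀ A₁ p σ) {a i v : ℕ} (ha : 3 ≤ a) :
    Base n s A₀ A₁ p (σ.setArr a i v) := by
  obtain ⟨h0, h1, h2, h3, h4, h5, h6⟩ := h
  constructor <;> simp [*] <;> omega

theorem Base.of_frame (h : Base n s A₀ A₁ p σ) {σ' : State} (hr : ∀ x < 4, σ'.reg x = σ.reg x)
    (ha : ∀ a < 3, σ'.arr a = σ.arr a) : Base n s A₀ A₁ p σ' := by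
  obtain ⟨h0, h1, h2, h3, h4, h5, h6⟩ := h
  constructor <;> simp [*]

/-- Besides the body, each neighbour costs a test, a load and an increment, hence `T + 3`; the
remaining `4` are the set-up and the final test. The invariant must survive arbitrary values of the
loop registers, which is why `h0` and `hbody` quantify over them. -/
theorem wp_forNbr (E : Env W n s nl A₀ A₁ p Δ) {rv T : ℕ} {body : Program}
    (Inv : List ℕ → State → Prop) (hB : Base n s A₀ A₁ p σ) (hv : σ.reg rv < n)
    (hrv : rv ≠ 20) (h0 : ∀ a b c, Inv [] (((σ.setReg 20 a).setReg 23 b).setReg 21 c))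
    (hbody : ∀ pre u suf σ', nl (σ.reg rv) = pre ++ u :: suf → Base n s A₀ A₁ p σ' →
      Inv pre σ' → wp W body T (σ'.setReg 22 u) fun _ σ'' => Base n s A₀ A₁ p σ'' ∧
        σ''.reg 20 = σ'.reg 20 ∧ σ''.reg 21 = σ'.reg 21 ∧
        ∀ z, Inv (pre ++ [u]) (σ''.setReg 20 z)) :
    wp W (forNbr rv body) ((T + 3) * (nl (σ.reg rv)).length + 4) σ fun _ σ' =>
      Base n s A₀ A₁ p σ' ∧ Inv (nl (σ.reg rv)) σ' := by
  have hw : σ.reg rv + 1 < W := by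
    have := E.word; have := le_size (n := n) (nl := nl); have := length_lt_size (nl := nl) hv
    omega
  generalize hv' : σ.reg rv = v at *
  simp only [forNbr, wp_block_cons, wp_load, wp_add, reg_setReg, arr_setReg, hB.reg3, hv',
    hB.arr0, if_neg hrv, wp_block_nil]
  simp only [Nat.reduceEqDiff, if_false]
  refine ⟨by omega, hw, by omega, by omega, ?_⟩
  refine wp_loop (fun k σ' => ∃ pre suf, nl v = pre ++ suf ∧ Base n s A₀ A₁ p σ' ∧ Inv pre σ' ∧
    σ'.reg 20 = A₀ v + pre.length ∧ σ'.reg 21 = A₀ (v + 1) ∧ (T + 3) * suf.length + 1 ≤ k)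
    ⟨[], nl v, rfl, ((hB.setReg (by decide)).setReg (by decide)).setReg (by decide), h0 _ _ _,
      by simp, by simp, by omega⟩ ?_
  rintro k σ' ⟨pre, suf, hps, hB', hI, h20, h21, hk⟩
  refine ⟨by omega, fun hb => ?_, fun hb => ?_⟩
  · have hlen : (nl v).length = pre.length + suf.length := by rw [hps]; simp
    rw [holds_lt, h20, h21, E.off_succ v hv, hlen] at hb
    obtain ⟨u, suf, rfl⟩ : ∃ u suf', suf = u :: suf' := by
      cases suf with
      | nil => simp at hb
      | cons u suf' => exact ⟨u, suf', rfl⟩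
    have hget : A₁ (A₀ v + pre.length) = u := by
      rw [E.get v hv pre.length (by rw [hlen]; simp)]
      simp [hps]
    rw [List.length_cons, Nat.mul_add, Nat.mul_one] at hk
    have hoff := E.off_lt (v + 1) (by omega)
    rw [E.off_succ v hv, hlen] at hoff
    simp only [wp_block_cons, wp_load, h20, hB'.arr1, hget, wp_add, wp_block_nil]
    refine ⟨by omega, ?_⟩
    refine wp_of_spec (hbody pre u suf σ' hps hB' hI) (by omega) ?_
    rintro k' σ'' hk' ⟨hB'', h20', h21', hI'⟩
    rw [hB''.reg3, h20', h20]
    simp only [List.length_cons] at hoff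
    refine ⟨by omega, by omega, pre ++ [u], suf, by simp [hps], hB''.setReg (by decide), hI' _,
      by simp; omega, by simp [h21', h21], by omega⟩
  · have hlen : (nl v).length = pre.length + suf.length := by rw [hps]; simp
    rw [holds_lt, h20, h21, E.off_succ v hv, hlen] at hb
    obtain rfl : suf = [] := List.eq_nil_of_length_eq_zero (by omega)
    rw [List.append_nil] at hps
    exact ⟨hB', hps ▸ hI⟩

/-! ### Colouring a single vertex. -/

/-- Try to colour the vertex in register `24`. Array `4` holds the colours, array `5` is used to
count the colours of the neighbours; the colour (or `0`, if there is none) is left in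
register `29`. -/
def tryColour : Program :=
  block [forNbr 24 (block [ld 25 4 22, ld 26 5 25, ad 26 26 3, st 5 25 26]),
    cp 27 2, cp 28 1, cp 29 2,
    .loop (.lt 27 28) (block [ld 25 2 27, ad 27 27 3, ld 26 5 27,
      .cond (.le 26 25) (block [cp 29 27, cp 28 2]) .skip]),
    forNbr 24 (block [ld 25 4 22, st 5 25 2]),
    st 4 24 29]

/-- The result of `tryColour`. -/
structure TryPost (s : ℕ) (nl : ℕ → List ℕ) (p : ℕ → ℕ) (σ σ' : State) : Prop where
  reg : ∀ x, x < 20 ∨ 29 < x ∨ x = 24 → σ'.reg x = σ.reg x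
  arr : ∀ a, a ≠ 4 → σ'.arr a = σ.arr a
  col : σ'.arr 4 = Function.update (σ.arr 4) (σ.reg 24) (σ'.reg 29)
  res : σ'.reg 29 = 0 ∧ NatGraph.Stuck nl s p (σ.arr 4) (σ.reg 24) ∨
    ∃ i < s, σ'.reg 29 = i + 1 ∧ NatGraph.colCount nl (σ.arr 4) (σ.reg 24) (i + 1) ≤ p i

/-- The cost depends only on the degree, not on `s`: the colours are tried in order, and each
rejected one occurs at a neighbour. The counters are erased by a second traversal, so array `5` can
be reused without being cleared as a whole. -/
theorem wp_tryColour (E : Env W n s nl A₀ A₁ p Δ) (hB : Base n s A₀ A₁ p σ) {v : ℕ}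
    (h24 : σ.reg 24 = v) (hv : v < n) (h5 : ∀ c, σ.arr 5 c = 0) :
    wp W tryColour (40 * ((nl v).length + 1)) σ fun _ σ' => TryPost s nl p σ σ' := by
  have hword := E.word
  have hlenW := length_lt_size (nl := nl) hv
  generalize hcol : σ.arr 4 = col
  unfold tryColour
  rw [wp_block_cons]
  refine wp_of_spec (wp_forNbr E (T := 4) (fun pre σ' =>
    (∀ c, σ'.arr 5 c = pre.countP fun u => col u = c) ∧
    (∀ x, x < 20 ∨ 29 < x ∨ x = 24 → σ'.reg x = σ.reg x) ∧ ∀ a, a ≠ 5 → σ'.arr a = σ.arr a)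
    hB (by omega) (by decide) ?_ ?_) (by rw [h24]; omega) ?_
  · intro a b c
    refine ⟨by simp [h5], fun x hx => ?_, by simp⟩
    simp only [reg_setReg]
    rw [if_neg (by omega), if_neg (by omega), if_neg (by omega)]
  · rintro pre u suf σ' hps hB' ⟨hc, hr, ha⟩
    have hlt : σ'.arr 5 (col u) + 1 < W := by
      rw [hc]
      have h1 := List.countP_le_length (p := fun x => decide (col x = col u)) (l := pre)
      rw [h24] at hps
      have h2 : pre.length ≤ (nl v).length := by rw [hps]; simp
      omega
    simp only [wp_block_cons, wp_load, wp_add, wp_store, wp_block_nil, reg_setReg, arr_setReg,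
      ha 4 (by decide), hcol]
    simp only [if_true, Nat.reduceEqDiff, if_false, hB'.reg3]
    refine ⟨by omega, by omega, hlt, by omega, by omega, ?_, by simp, by simp, fun z => ⟨?_, ?_, ?_⟩⟩
    · exact ((((hB'.setReg (by decide)).setReg (by decide)).setReg (by decide)).setReg
        (by decide)).setArr (by decide)
    · intro c
      simp only [arr_setReg, arr_setArr, if_true, Function.update_apply, List.countP_append, hc]
      by_cases h : c = col u
      · simp [h]
      · simp [h, Ne.symm h]
    · intro x hx
      simp only [reg_setReg, reg_setArr]
      rw [if_neg (by omega), if_neg (by omega), if_neg (by omega), if_neg (by omega),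
        if_neg (by omega), hr x hx]
    · intro a h
      simp [h, ha a h]
  rintro k₁ σ₁ hk₁ ⟨hB₁, hc₁, hr₁, ha₁⟩
  rw [h24] at hk₁ hc₁
  simp only [wp_block_cons, wp_copy, reg_setReg]
  simp only [Nat.reduceEqDiff, if_false, hB₁.reg2, hB₁.reg1]
  refine ⟨by omega, by omega, by omega, ?_⟩
  -- Introduced through an equation, the invariant stays folded while the effects of the program are
  -- simplified. Register `27` counts the colours tried; a zero in register `28` signals success and
  -- ends the loop.
  obtain ⟨I, hI⟩ : ∃ I : ℕ → State → Prop, I = fun k σ' => Base n s A₀ A₁ p σ' ∧ σ'.arr = σ₁.arr ∧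
      (∀ x, x < 20 ∨ 29 < x ∨ x = 24 → σ'.reg x = σ₁.reg x) ∧
      ((σ'.reg 28 = s ∧ σ'.reg 29 = 0 ∧ σ'.reg 27 ≤ s ∧
        (∀ i < σ'.reg 27, p i + 1 ≤ NatGraph.colCount nl col v (i + 1)) ∧
        8 * (nl v).length + 5 * (nl v).length + 30 ≤ k + 8 * σ'.reg 27) ∨
      (σ'.reg 28 = 0 ∧ 5 * (nl v).length + 20 ≤ k ∧ ∃ i < s, σ'.reg 29 = i + 1 ∧
        NatGraph.colCount nl col v (i + 1) ≤ p i)) :=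
    ⟨_, rfl⟩
  refine wp_mono (wp_loop I
    (Q := fun k σ' => 5 * (nl v).length + 19 ≤ k ∧ Base n s A₀ A₁ p σ' ∧ σ'.arr = σ₁.arr ∧
      (∀ x, x < 20 ∨ 29 < x ∨ x = 24 → σ'.reg x = σ₁.reg x) ∧
      (σ'.reg 29 = 0 ∧ NatGraph.Stuck nl s p col v ∨
        ∃ i < s, σ'.reg 29 = i + 1 ∧ NatGraph.colCount nl col v (i + 1) ≤ p i)) ?_ ?_) ?_
  · rw [hI]
    refine ⟨((hB₁.setReg (by decide)).setReg (by decide)).setReg (by decide), rfl, fun x hx => ?_,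
      Or.inl ⟨by simp, by simp, by simp, by simp, by simp; omega⟩⟩
    simp only [reg_setReg]
    rw [if_neg (by omega), if_neg (by omega), if_neg (by omega)]
  · intro k σ' hIk
    rw [hI] at hIk
    obtain ⟨hB', ha, hr, h⟩ := hIk
    rcases h with ⟨h28, h29, h27, hc, hk⟩ | ⟨h28, hk, h⟩
    -- Each rejected colour `i` accounts for at least `p i + 1 ≥ 1` neighbours, and different
    -- colours for different ones.
    · have hle : σ'.reg 27 ≤ (nl v).length := by
        have h1 := NatGraph.sum_colCount_le (nl := nl) (s := σ'.reg 27) col v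
        have h2 := Finset.sum_le_sum (s := Finset.range (σ'.reg 27)) (f := fun _ => 1)
          (g := fun i => NatGraph.colCount nl col v (i + 1)) fun i hi => by
            have := hc i (Finset.mem_range.1 hi); omega
        simp at h2
        omega
      refine ⟨by omega, fun hb => ?_, fun hb => ?_⟩
      · rw [holds_lt, h28] at hb
        simp only [wp_block_cons, wp_load, wp_add, wp_cond, wp_copy, wp_block_nil, wp_skip,
          reg_setReg, arr_setReg, holds_le]
        simp only [Nat.reduceEqDiff, if_false, if_true, hB'.reg3, hB'.reg2, hB'.arr2, ha, hc₁]
        rw [hI]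
        refine ⟨by omega, by omega, by omega, by omega, by omega, fun hle' => ?_, fun hgt => ?_⟩
        · refine ⟨by omega, by omega, ?_, ha, fun x hx => ?_, Or.inr ⟨?_, by omega, ?_⟩⟩
          · exact ((((hB'.setReg (by decide)).setReg (by decide)).setReg (by decide)).setReg
              (by decide)).setReg (by decide)
          · simp only [reg_setReg]
            rw [if_neg (by omega), if_neg (by omega), if_neg (by omega), if_neg (by omega),
              if_neg (by omega), hr x hx]
          · simp
          · exact ⟨σ'.reg 27, hb, by simp, hle'⟩
        · refine ⟨?_, ha, fun x hx => ?_, Or.inl ⟨by simp [h28], by simp [h29], by simp; omega,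
            ?_, by simp; omega⟩⟩
          · exact ((hB'.setReg (by decide)).setReg (by decide)).setReg (by decide)
          · simp only [reg_setReg]
            rw [if_neg (by omega), if_neg (by omega), if_neg (by omega), hr x hx]
          · simp only [reg_setReg, Nat.reduceEqDiff, if_false, if_true]
            intro i hi
            rcases Nat.lt_succ_iff_lt_or_eq.1 hi with hi | rfl
            · exact hc i hi
            · unfold NatGraph.colCount; omega
      · rw [holds_lt, h28] at hb
        refine ⟨by omega, hB', ha, hr, Or.inl ⟨h29, ?_⟩⟩
        rwa [show σ'.reg 27 = s by omega] at hc
    · refine ⟨by omega, fun hb => ?_, fun hb => ⟨by omega, hB', ha, hr, Or.inr h⟩⟩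
      rw [holds_lt, h28] at hb
      omega
  rintro k₂ σ₂ - ⟨hk₂, hB₂, ha₂, hr₂, h⟩
  have h24' : σ₂.reg 24 = v := by rw [hr₂ _ (by omega), hr₁ _ (by omega), h24]
  refine wp_of_spec (wp_forNbr E (T := 2) (fun pre σ' =>
    (∀ c, σ'.arr 5 c = 0 ∨ σ'.arr 5 c = σ₂.arr 5 c ∧ ∀ u ∈ pre, col u ≠ c) ∧
    σ'.reg 29 = σ₂.reg 29 ∧
    (∀ x, x < 20 ∨ 29 < x ∨ x = 24 → σ'.reg x = σ₂.reg x) ∧ ∀ a, a ≠ 5 → σ'.arr a = σ₂.arr a)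
    hB₂ (by omega) (by decide) ?_ ?_) (by rw [h24']; omega) ?_
  · intro a b c
    refine ⟨by simp, by simp, fun x hx => ?_, by simp⟩
    simp only [reg_setReg]
    rw [if_neg (by omega), if_neg (by omega), if_neg (by omega)]
  · rintro pre u suf σ' hps hB' ⟨hc, h29, hr, ha⟩
    simp only [wp_block_cons, wp_load, wp_store, wp_block_nil, reg_setReg, arr_setReg,
      ha 4 (by decide), ha₂, ha₁ 4 (by decide), hcol]
    simp only [if_true, Nat.reduceEqDiff, if_false, hB'.reg2]
    refine ⟨by omega, by omega, ?_, by simp, by simp, fun z => ⟨?_, ?_, ?_, ?_⟩⟩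
    · exact ((hB'.setReg (by decide)).setReg (by decide)).setArr (by decide)
    · intro c
      simp only [arr_setReg, arr_setArr, if_true, Function.update_apply]
      by_cases h : c = col u
      · simp [h]
      · rcases hc c with h' | ⟨h', h''⟩
        · simp [h, h']
        · right
          refine ⟨by simp [h, h', ha₂], fun x hx => ?_⟩
          rcases List.mem_append.1 hx with hx | hx
          · exact h'' x hx
          · obtain rfl := List.mem_singleton.1 hx
            exact Ne.symm h
    · simp [h29]
    · intro x hx
      simp only [reg_setReg, reg_setArr]
      rw [if_neg (by omega), if_neg (by omega), if_neg (by omega), hr x hx]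
    · intro a h
      simp [h, ha a h, ha₂]
  rintro k₃ σ₃ hk₃ ⟨hB₃, hc₃, h29₃, hr₃, ha₃⟩
  rw [h24'] at hc₃ hk₃
  simp only [wp_store, wp_block_nil]
  have h24'' : σ₃.reg 24 = v := by rw [hr₃ _ (by omega), h24']
  refine ⟨by omega, ⟨fun x hx => ?_, fun a h4 => ?_, ?_, ?_⟩⟩
  · rw [reg_setArr, hr₃ x hx, hr₂ x hx, hr₁ x hx]
  · rw [arr_setArr, if_neg h4]
    by_cases h : a = 5
    · subst h
      funext c
      rw [h5]
      rcases hc₃ c with h' | ⟨h', h''⟩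
      · exact h'
      -- A counter that was not erased belongs to a colour that no neighbour has, so it was zero
      -- already.
      · rw [h', ha₂, hc₁, List.countP_eq_zero]
        simpa using h''
    · rw [ha₃ a h, ha₂, ha₁ a h]
  · rw [arr_setArr, if_pos rfl, h24'', h24, ha₃ 4 (by decide), ha₂, ha₁ 4 (by decide), reg_setArr]
  · rw [reg_setArr, h29₃, h24, hcol]
    exact h

end RAM

/-! ### An inextensible path. -/

namespace RAM

/-- The part of the size of a graph that belongs to the first `L` vertices of an enumeration. -/
def partSize (nl : ℕ → List ℕ) (f : ℕ → ℕ) (L : ℕ) : ℕ :=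
  ∑ k ∈ Finset.range L, ((nl (f k)).length + 1)

variable {W n s Δ : ℕ} {nl : ℕ → List ℕ} {A₀ A₁ p : ℕ → ℕ} {σ : State}

theorem partSize_succ (f : ℕ → ℕ) (L : ℕ) :
    partSize nl f (L + 1) = partSize nl f L + ((nl (f L)).length + 1) :=
  Finset.sum_range_succ _ _

theorem le_partSize (f : ℕ → ℕ) (L : ℕ) : L ≤ partSize nl f L := by
  unfold partSize
  rw [Finset.sum_add_distrib]
  simp

theorem partSize_congr {f g : ℕ → ℕ} {L : ℕ} (h : ∀ k < L, f k = g k) :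
    partSize nl f L = partSize nl g L :=
  Finset.sum_congr rfl fun k hk => by rw [h k (Finset.mem_range.1 hk)]

/-- Distinct vertices contribute distinct summands of `size`. This converts bounds per vertex into
linear running times. -/
theorem partSize_le {f : ℕ → ℕ} {L : ℕ} (hlt : ∀ k < L, f k < n)
    (hinj : ∀ k < L, ∀ k' < L, f k = f k' → k = k') : partSize nl f L ≤ size n nl := by
  unfold partSize size
  rw [← Finset.sum_image (s := Finset.range L) (g := f) (f := fun v => (nl v).length + 1)]
  · refine Finset.sum_le_sum_of_subset fun v hv => ?_
    obtain ⟨k, hk, rfl⟩ := Finset.mem_image.1 hv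
    exact Finset.mem_range.2 (hlt k (Finset.mem_range.1 hk))
  · intro k hk k' hk' e
    exact hinj k (by simpa using hk) k' (by simpa using hk') e

/-- A path `path 1, …, path L`, with the positions of its vertices. -/
structure PathInv (n : ℕ) (nl : ℕ → List ℕ) (path pos : ℕ → ℕ) (L : ℕ) : Prop where
  one_le : 1 ≤ L
  lt : ∀ k, 1 ≤ k → k ≤ L → path k < n
  pos_path : ∀ k, 1 ≤ k → k ≤ L → pos (path k) = k
  path_pos : ∀ v, pos v ≠ 0 → pos v ≤ L ∧ path (pos v) = v
  adj : ∀ k, 1 ≤ k → k < L → path (k + 1) ∈ nl (path k)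

theorem PathInv.inj {path pos : ℕ → ℕ} {L : ℕ} (h : PathInv n nl path pos L) {k k' : ℕ}
    (hk : 1 ≤ k) (hkL : k ≤ L) (hk' : 1 ≤ k') (hkL' : k' ≤ L) (e : path k = path k') : k = k' := by
  rw [← h.pos_path k hk hkL, e, h.pos_path k' hk' hkL']

theorem PathInv.partSize_le {path pos : ℕ → ℕ} {L : ℕ} (h : PathInv n nl path pos L) :
    partSize nl (fun k => path (k + 1)) L ≤ size n nl :=
  RAM.partSize_le (fun k hk => h.lt _ (by omega) (by omega)) fun k hk k' hk' e => by
    have := h.inj (by omega) (by omega) (by omega) (by omega) e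
    omega

theorem PathInv.single {path pos : ℕ → ℕ} (hn : 0 < n) (hpos : ∀ v, pos v = 0) :
    PathInv n nl (Function.update path 1 0) (Function.update pos 0 1) 1 := by
  refine ⟨le_rfl, fun k h1 h2 => ?_, fun k h1 h2 => ?_, fun v hv => ?_, fun k h1 h2 => by omega⟩
  · obtain rfl : k = 1 := by omega
    simpa
  · obtain rfl : k = 1 := by omega
    simp
  · by_cases h : v = 0
    · simp [h]
    · simp [h, hpos] at hv

theorem PathInv.extend (G : NatGraph n nl) {path pos : ℕ → ℕ} {L u : ℕ}
    (h : PathInv n nl path pos L) (hu : u ∈ nl (path L)) (hpos : pos u = 0) :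
    PathInv n nl (Function.update path (L + 1) u) (Function.update pos u (L + 1)) (L + 1) := by
  have hL := h.one_le
  have hne : ∀ k, 1 ≤ k → k ≤ L → path k ≠ u := fun k h1 h2 e => by
    have := h.pos_path k h1 h2
    rw [e] at this
    omega
  refine ⟨by omega, fun k h1 h2 => ?_, fun k h1 h2 => ?_, fun v hv => ?_, fun k h1 h2 => ?_⟩
  · rcases Nat.lt_or_ge L k with h' | h'
    · obtain rfl : k = L + 1 := by omega
      simpa using G.lt hu
    · rw [Function.update_of_ne (by omega)]
      exact h.lt k h1 h'
  · rcases Nat.lt_or_ge L k with h' | h'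
    · obtain rfl : k = L + 1 := by omega
      simp
    · rw [Function.update_of_ne (by omega : k ≠ L + 1), Function.update_of_ne (hne k h1 h')]
      exact h.pos_path k h1 h'
  · by_cases hvu : v = u
    · subst hvu; simp
    · rw [Function.update_of_ne hvu] at hv ⊢
      obtain ⟨h1, h2⟩ := h.path_pos v hv
      exact ⟨by omega, by rw [Function.update_of_ne (by omega), h2]⟩
  · rw [Function.update_of_ne (by omega : k ≠ L + 1)]
    by_cases h' : k = L
    · subst h'; simpa
    · rw [Function.update_of_ne (by omega)]
      exact h.adj k h1 (by omega)

/-- Extend a path from the vertex `0` until all neighbours of the last vertex lie on it. Array `6`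
holds the path and array `7` the positions. -/
def findPath : Program :=
  block [cp 4 2, cp 5 3, st 6 5 4, st 7 4 5, cp 30 3,
    .loop (.eq 30 3) (block [cp 30 2,
      forNbr 4 (block [ld 32 7 22, .cond (.eq 32 2) (block [cp 31 22, cp 30 3]) .skip]),
      .cond (.eq 30 3) (block [cp 4 31, ad 5 5 3, st 6 5 4, st 7 4 5]) .skip])]

/-- The result of `findPath`. -/
structure PathPost (n s : ℕ) (nl : ℕ → List ℕ) (A₀ A₁ p : ℕ → ℕ) (σ σ' : State) : Prop where
  base : Base n s A₀ A₁ p σ'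
  arr : ∀ a, a ≠ 6 → a ≠ 7 → σ'.arr a = σ.arr a
  path : PathInv n nl (σ'.arr 6) (σ'.arr 7) (σ'.reg 5)
  last : σ'.reg 4 = σ'.arr 6 (σ'.reg 5)
  max : ∀ u ∈ nl (σ'.reg 4), σ'.arr 7 u ≠ 0

/-- Every list scanned is that of a new last vertex of the path, so no list is scanned twice.
Positions start at `1`, so that the initial `0` in array `7` means that a vertex is not on the path.
-/
theorem wp_findPath (E : Env W n s nl A₀ A₁ p Δ) (hB : Base n s A₀ A₁ p σ)
    (h7 : ∀ v, σ.arr 7 v = 0) :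
    wp W findPath (30 * size n nl) σ fun _ σ' => PathPost n s nl A₀ A₁ p σ σ' := by
  have hword := E.word
  have hn := E.inst.pos
  have hsize := le_size (n := n) (nl := nl)
  unfold findPath
  -- While the path may still grow, the list of its last vertex is not yet scanned, so only the
  -- first `σ'.reg 5 - 1` vertices have been paid for.
  obtain ⟨I, hI⟩ : ∃ I : ℕ → State → Prop, I = fun k σ' => Base n s A₀ A₁ p σ' ∧
      (∀ a, a ≠ 6 → a ≠ 7 → σ'.arr a = σ.arr a) ∧
      PathInv n nl (σ'.arr 6) (σ'.arr 7) (σ'.reg 5) ∧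
      σ'.reg 4 = σ'.arr 6 (σ'.reg 5) ∧
      (σ'.reg 30 = 1 ∧
        20 * size n nl + 5 ≤ k + 20 * partSize nl (fun k => σ'.arr 6 (k + 1)) (σ'.reg 5 - 1) ∨
      σ'.reg 30 = 0 ∧ 1 ≤ k ∧ ∀ u ∈ nl (σ'.reg 4), σ'.arr 7 u ≠ 0) := ⟨_, rfl⟩
  have hloop : ∀ k σ', I k σ' → 1 ≤ k ∧
      ((Test.eq 30 3).Holds σ' → wp W (block [cp 30 2,
        forNbr 4 (block [ld 32 7 22, .cond (.eq 32 2) (block [cp 31 22, cp 30 3]) .skip]),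
        .cond (.eq 30 3) (block [cp 4 31, ad 5 5 3, st 6 5 4, st 7 4 5]) .skip]) (k - 1) σ' I) ∧
      (¬ (Test.eq 30 3).Holds σ' → PathPost n s nl A₀ A₁ p σ σ') := by
    intro k σ' hIk
    rw [hI] at hIk
    obtain ⟨hB', ha, hP, h4, h⟩ := hIk
    have hps := hP.partSize_le
    rw [holds_eq, hB'.reg3]
    rcases h with ⟨h30, hk⟩ | ⟨h30, hk, hmax⟩
    · obtain ⟨L, hL⟩ : ∃ L, σ'.reg 5 = L + 1 := ⟨σ'.reg 5 - 1, by have := hP.one_le; omega⟩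
      rw [hL] at hP h4 hps
      rw [hL, Nat.add_sub_cancel] at hk
      rw [partSize_succ, ← h4] at hps
      have hLle := le_partSize (nl := nl) (fun k => σ'.arr 6 (k + 1)) L
      have hcur : σ'.reg 4 < n := by rw [h4]; exact hP.lt _ (by omega) le_rfl
      refine ⟨by omega, fun _ => ?_, fun h => absurd h30 h⟩
      rw [wp_block_cons, wp_copy]
      refine ⟨by omega, ?_⟩
      rw [wp_block_cons]
      refine wp_of_spec (wp_forNbr E (T := 4) (fun pre σ'' => σ''.arr = σ'.arr ∧
        σ''.reg 4 = σ'.reg 4 ∧ σ''.reg 5 = σ'.reg 5 ∧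
        (σ''.reg 30 = 1 ∧ σ''.reg 31 ∈ nl (σ'.reg 4) ∧ σ'.arr 7 (σ''.reg 31) = 0 ∨
          σ''.reg 30 = 0 ∧ ∀ u ∈ pre, σ'.arr 7 u ≠ 0)) (hB'.setReg (by decide)) (by simpa)
          (by decide) ?_ ?_) (by simp; omega) ?_
      · intro a b c
        simp [hB'.reg2]
      · rintro pre u suf σ'' hpre hB'' ⟨ha'', h4'', h5'', h''⟩
        simp only [reg_setReg, Nat.reduceEqDiff, if_false] at hpre
        simp [hB''.reg2, hB''.reg3, ha'', h4'', h5'']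
        refine ⟨fun h7 => ⟨?_, ?_⟩, fun h7 => ⟨?_, ?_⟩⟩
        · repeat' first | exact hB'' | refine Base.setReg ?_ (by decide)
        · exact ⟨by rw [hpre]; simp, h7⟩
        · repeat' first | exact hB'' | refine Base.setReg ?_ (by decide)
        · rcases h'' with h'' | ⟨h1, h2⟩
          · exact Or.inl h''
          · right
            refine ⟨h1, fun x hx => ?_⟩
            rcases hx with hx | rfl
            · exact h2 x hx
            · exact h7
      · simp only [reg_setReg, Nat.reduceEqDiff, if_false]
        rintro k₁ σ₁ hk₁ ⟨hB₁, ha₁, h4₁, h5₁, h₁⟩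
        simp only [wp_block_cons, wp_cond, wp_block_nil, wp_copy, wp_add, wp_store, wp_skip,
          holds_eq, hB₁.reg3, reg_setReg, reg_setArr]
        simp only [Nat.reduceEqDiff, if_false, if_true, h5₁, hL]
        refine ⟨by omega, fun h30₁ => ?_, fun h30₁ => ?_⟩
        · rcases h₁ with ⟨-, hmem, h7₁⟩ | ⟨h', -⟩
          · rw [hI]
            rw [h4] at hmem
            refine ⟨by omega, by omega, by omega, by omega, by omega, ?_, ?_, ?_, ?_, Or.inl ⟨?_, ?_⟩⟩
            · repeat' first
                | exact hB₁ | refine Base.setReg ?_ (by decide) | refine Base.setArr ?_ (by decide)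
            · intro a h6 h7
              simp [h6, h7, ha₁, ha a h6 h7]
            · simpa [ha₁] using hP.extend E.inst.graph hmem h7₁
            · simp
            · simpa using h30₁
            · simp only [reg_setReg, reg_setArr, arr_setReg, arr_setArr, Nat.reduceEqDiff,
                if_false, if_true, ha₁, Nat.add_sub_cancel]
              rw [partSize_congr (g := fun k => σ'.arr 6 (k + 1)), partSize_succ, ← h4]
              · omega
              · intro k hk
                rw [Function.update_of_ne (by omega)]
          · omega
        · rcases h₁ with ⟨h', -⟩ | ⟨h', hmax⟩
          · omega
          · rw [hI]
            refine ⟨hB₁, fun a h6 h7 => by rw [ha₁, ha a h6 h7], ?_, ?_, Or.inr ⟨h', by omega, ?_⟩⟩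
            · rw [ha₁, h5₁, hL]; exact hP
            · rw [ha₁, h5₁, h4₁, hL]; exact h4
            · rw [ha₁, h4₁]; exact hmax
    · exact ⟨hk, fun h => by omega, fun _ => ⟨hB', ha, hP, h4, hmax⟩⟩
  simp only [wp_block_cons, wp_copy, wp_store, reg_setReg, reg_setArr]
  simp only [Nat.reduceEqDiff, if_false, if_true, hB.reg2, hB.reg3]
  refine ⟨by omega, by omega, by omega, by omega, by omega,
    wp_loop I ?_ fun k σ' h => by simpa only [wp_block_nil] using hloop k σ' h⟩
  rw [hI]
  refine ⟨?_, fun a h6 h7 => by simp [h6, h7], ?_, by simp, Or.inl ⟨by simp, ?_⟩⟩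
  · repeat' first
      | exact hB | refine Base.setReg ?_ (by decide) | refine Base.setArr ?_ (by decide)
  · simpa using PathInv.single hn h7
  · simp [partSize]
    omega

/-! ### The search order. -/

/-- The order `ord 0, …, ord (tail - 1)` in which a search from `root` has found vertices. -/
structure SearchInv (n : ℕ) (nl : ℕ → List ℕ) (ord vis : ℕ → ℕ) (root tail : ℕ) : Prop where
  one_le : 1 ≤ tail
  zero : ord 0 = root
  lt : ∀ k < tail, ord k < n
  inj : ∀ k < tail, ∀ k' < tail, ord k = ord k' → k = k'
  vis : ∀ v, vis v ≠ 0 ↔ ∃ k < tail, ord k = v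
  parent : ∀ k < tail, 0 < k → ∃ k' < k, ord k' ∈ nl (ord k)

theorem SearchInv.single {ord vis : ℕ → ℕ} {root : ℕ} (hr : root < n) (h : ∀ v, vis v = 0) :
    SearchInv n nl (Function.update ord 0 root) (Function.update vis root 1) root 1 := by
  refine ⟨le_rfl, by simp, fun k hk => ?_, fun k hk k' hk' _ => by omega, fun v => ?_,
    fun k hk h => by omega⟩
  · obtain rfl : k = 0 := by omega
    simpa
  · by_cases hv : v = root
    · simp [hv]
    · simp [hv, h, Ne.symm hv]

theorem SearchInv.extend (G : NatGraph n nl) {ord vis : ℕ → ℕ} {root tail k u : ℕ}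
    (h : SearchInv n nl ord vis root tail) (hk : k < tail) (hu : u ∈ nl (ord k))
    (hvis : vis u = 0) :
    SearchInv n nl (Function.update ord tail u) (Function.update vis u 1) root (tail + 1) := by
  have hnew : ∀ k < tail, ord k ≠ u := fun k hk e => by
    have := (h.vis u).2 ⟨k, hk, e⟩
    omega
  have hold : ∀ k < tail, Function.update ord tail u k = ord k := fun k hk =>
    Function.update_of_ne (by omega) _ _
  have h1 := h.one_le
  refine ⟨by omega, by rw [hold 0 (by omega), h.zero], fun k hk => ?_, fun k hk k' hk' e => ?_,
    fun v => ⟨fun hv => ?_, ?_⟩, fun k' hk' h0 => ?_⟩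
  · rcases Nat.lt_succ_iff_lt_or_eq.1 hk with hk | rfl
    · rw [hold k hk]; exact h.lt k hk
    · simpa using G.lt hu
  · rcases Nat.lt_succ_iff_lt_or_eq.1 hk with hk | rfl <;>
      rcases Nat.lt_succ_iff_lt_or_eq.1 hk' with hk' | rfl
    · rw [hold k hk, hold k' hk'] at e
      exact h.inj k hk k' hk' e
    · rw [hold k hk] at e
      simp at e
      exact absurd e (hnew k hk)
    · rw [hold k' hk'] at e
      simp at e
      exact absurd e.symm (hnew k' hk')
    · rfl
  · by_cases hvu : v = u
    · exact ⟨tail, by omega, by simp [hvu]⟩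
    · rw [Function.update_of_ne hvu] at hv
      obtain ⟨k, hk, e⟩ := (h.vis v).1 hv
      exact ⟨k, by omega, by rw [hold k hk, e]⟩
  · rintro ⟨k, hk, e⟩
    rcases Nat.lt_succ_iff_lt_or_eq.1 hk with hk | rfl
    · rw [hold k hk] at e
      rw [Function.update_of_ne (e ▸ hnew k hk)]
      exact (h.vis v).2 ⟨k, hk, e⟩
    · simp at e
      simp [e]
  · rcases Nat.lt_succ_iff_lt_or_eq.1 hk' with hk' | rfl
    · obtain ⟨k'', hk'', hm⟩ := h.parent k' hk' h0
      exact ⟨k'', hk'', by rwa [hold k' hk', hold k'' (by omega)]⟩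
    · exact ⟨k, hk, by simpa [hold k hk] using G.symm hu⟩

/-- Breadth first search from the vertex in register `4`. Array `8` holds the queue, of length
register `6`, and array `9` marks the vertices found. -/
def search : Program :=
  block [cp 33 2, cp 6 3, st 8 2 4, st 9 4 3,
    .loop (.lt 33 6) (block [ld 34 8 33, ad 33 33 3,
      forNbr 34 (block [ld 35 9 22,
        .cond (.eq 35 2) (block [st 9 22 3, st 8 6 22, ad 6 6 3]) .skip])])]

/-- An enumeration of the vertices in which all but the first one have an earlier neighbour. -/
structure IsSearchOrder (n : ℕ) (nl : ℕ → List ℕ) (ord : ℕ → ℕ) (root tail : ℕ) : Prop where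
  one_le : 1 ≤ tail
  zero : ord 0 = root
  lt : ∀ k < tail, ord k < n
  inj : ∀ k < tail, ∀ k' < tail, ord k = ord k' → k = k'
  parent : ∀ k < tail, 0 < k → ∃ k' < k, ord k' ∈ nl (ord k)
  surj : ∀ v < n, ∃ k < tail, ord k = v

/-- The result of `search`. -/
structure SearchPost (n s : ℕ) (nl : ℕ → List ℕ) (A₀ A₁ p : ℕ → ℕ) (σ σ' : State) : Prop where
  base : Base n s A₀ A₁ p σ'
  arr : ∀ a, a ≠ 8 → a ≠ 9 → σ'.arr a = σ.arr a
  reg4 : σ'.reg 4 = σ.reg 4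
  reg5 : σ'.reg 5 = σ.reg 5
  order : IsSearchOrder n nl (σ'.arr 8) (σ.reg 4) (σ'.reg 6)

/-- Each queue entry is processed once and the entries are distinct. When the queue is exhausted,
the set of vertices found is closed under adjacency. -/
theorem wp_search (E : Env W n s nl A₀ A₁ p Δ) (hB : Base n s A₀ A₁ p σ)
    (h4 : σ.reg 4 < n) (h9 : ∀ v, σ.arr 9 v = 0) :
    wp W search (30 * size n nl) σ fun _ σ' => SearchPost n s nl A₀ A₁ p σ σ' := by
  have hword := E.word
  have hn := E.inst.pos
  have hsize := le_size (n := n) (nl := nl)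
  unfold search
  obtain ⟨I, hI⟩ : ∃ I : ℕ → State → Prop, I = fun k σ' => Base n s A₀ A₁ p σ' ∧
      (∀ a, a ≠ 8 → a ≠ 9 → σ'.arr a = σ.arr a) ∧ σ'.reg 4 = σ.reg 4 ∧ σ'.reg 5 = σ.reg 5 ∧
      SearchInv n nl (σ'.arr 8) (σ'.arr 9) (σ.reg 4) (σ'.reg 6) ∧
      σ'.reg 33 ≤ σ'.reg 6 ∧
      (∀ k < σ'.reg 33, ∀ u ∈ nl (σ'.arr 8 k), σ'.arr 9 u ≠ 0) ∧
      20 * size n nl + 5 ≤ k + 20 * partSize nl (σ'.arr 8) (σ'.reg 33) := ⟨_, rfl⟩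
  have hloop : ∀ k σ', I k σ' → 1 ≤ k ∧
      ((Test.lt 33 6).Holds σ' → wp W (block [ld 34 8 33, ad 33 33 3,
      forNbr 34 (block [ld 35 9 22,
        .cond (.eq 35 2) (block [st 9 22 3, st 8 6 22, ad 6 6 3]) .skip])]) (k - 1) σ' I) ∧
      (¬ (Test.lt 33 6).Holds σ' → SearchPost n s nl A₀ A₁ p σ σ') := by
    intro k σ' hIk
    rw [hI] at hIk
    obtain ⟨hB', ha, h4', h5', hS, hle, hcl, hk⟩ := hIk
    have hps : partSize nl (σ'.arr 8) (σ'.reg 6) ≤ size n nl := partSize_le hS.lt hS.inj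
    have hps' : partSize nl (σ'.arr 8) (σ'.reg 33) ≤ size n nl := partSize_le
      (fun k hk => hS.lt k (by omega)) fun k hk k' hk' => hS.inj k (by omega) k' (by omega)
    have h6le := le_partSize (nl := nl) (σ'.arr 8) (σ'.reg 6)
    rw [holds_lt]
    refine ⟨by omega, fun hlt => ?_, fun hge => ⟨hB', ha, h4', h5', ?_⟩⟩
    · have hps'' : partSize nl (σ'.arr 8) (σ'.reg 33 + 1) ≤ size n nl := partSize_le
        (fun k hk => hS.lt k (by omega)) fun k hk k' hk' => hS.inj k (by omega) k' (by omega)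
      rw [partSize_succ] at hps''
      simp only [wp_block_cons, wp_load, wp_add, reg_setReg, wp_block_nil]
      simp only [Nat.reduceEqDiff, if_false, hB'.reg3]
      refine ⟨by omega, by omega, by omega, ?_⟩
      refine wp_of_spec (wp_forNbr E (T := 5) (fun pre σ'' =>
        (∀ a, a ≠ 8 → a ≠ 9 → σ''.arr a = σ'.arr a) ∧
        σ''.reg 4 = σ.reg 4 ∧ σ''.reg 5 = σ.reg 5 ∧ σ''.reg 33 = σ'.reg 33 + 1 ∧
        SearchInv n nl (σ''.arr 8) (σ''.arr 9) (σ.reg 4) (σ''.reg 6) ∧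
        σ'.reg 33 + 1 ≤ σ''.reg 6 ∧ (∀ k ≤ σ'.reg 33, σ''.arr 8 k = σ'.arr 8 k) ∧
        (∀ u, σ'.arr 9 u ≠ 0 → σ''.arr 9 u ≠ 0) ∧
        ∀ u ∈ pre, σ''.arr 9 u ≠ 0)
          ((hB'.setReg (by decide)).setReg (by decide)) (by simpa using hS.lt _ hlt)
          (by decide) ?_ ?_) (by simp; omega) ?_
      · intro a b c
        simp [h4', h5', hS]
        omega
      · rintro pre u suf σ'' hpre hB'' ⟨ha'', h4'', h5'', h33'', hS'', hle'', hord, hmono, hvis⟩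
        simp only [reg_setReg, Nat.reduceEqDiff, if_false, if_true] at hpre
        have hu : u ∈ nl (σ''.arr 8 (σ'.reg 33)) := by
          rw [hord _ le_rfl, hpre]; simp
        have h6'' : σ''.reg 6 ≤ size n nl :=
          (le_partSize (nl := nl) (σ''.arr 8) _).trans (partSize_le hS''.lt hS''.inj)
        obtain ⟨J, hJ⟩ : ∃ J : State → Prop, J = fun τ => Base n s A₀ A₁ p τ ∧
          τ.reg 20 = σ''.reg 20 ∧ τ.reg 21 = σ''.reg 21 ∧
          (∀ a, a ≠ 8 → a ≠ 9 → τ.arr a = σ'.arr a) ∧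
          τ.reg 4 = σ.reg 4 ∧ τ.reg 5 = σ.reg 5 ∧ τ.reg 33 = σ'.reg 33 + 1 ∧
          SearchInv n nl (τ.arr 8) (τ.arr 9) (σ.reg 4) (τ.reg 6) ∧
          σ'.reg 33 + 1 ≤ τ.reg 6 ∧ (∀ k ≤ σ'.reg 33, τ.arr 8 k = σ'.arr 8 k) ∧
          (∀ u, σ'.arr 9 u ≠ 0 → τ.arr 9 u ≠ 0) ∧
          ∀ x ∈ pre ++ [u], τ.arr 9 x ≠ 0 := ⟨_, rfl⟩
        refine wp_mono (Q := fun _ => J) ?_ ?_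
        · simp only [wp_block_cons, wp_load, wp_cond, wp_block_nil, wp_store, wp_add, wp_skip,
            holds_eq, reg_setReg, arr_setReg, reg_setArr]
          simp only [Nat.reduceEqDiff, if_false, if_true, hB''.reg2, hB''.reg3]
          refine ⟨by omega, by omega, fun h0 => ⟨by omega, by omega, by omega, by omega, ?_⟩,
            fun h0 => ?_⟩
          · rw [hJ]
            refine ⟨?_, by simp, by simp, fun a h8 h9 => by simp [h8, h9, ha'' a h8 h9],
              by simp [h4''], by simp [h5''], by simp [h33''], ?_, by simp; omega, ?_, ?_, ?_⟩
            · repeat' first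
                | exact hB'' | refine Base.setReg ?_ (by decide)
                | refine Base.setArr ?_ (by decide)
            · simpa using hS''.extend E.inst.graph (by omega) hu h0
            · intro k hk
              simp only [arr_setReg, arr_setArr, if_true, Nat.reduceEqDiff, if_false]
              rw [Function.update_of_ne (by omega), hord k hk]
            · intro x hx
              simp only [arr_setReg, arr_setArr, Nat.reduceEqDiff, if_false, if_true,
                Function.update_apply]
              split_ifs
              · omega
              · exact hmono x hx
            · intro x hx
              simp only [List.mem_append, List.mem_singleton] at hx
              simp only [arr_setReg, arr_setArr, Nat.reduceEqDiff, if_false, if_true,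
                Function.update_apply]
              split_ifs with h
              · omega
              · rcases hx with hx | hx
                · exact hvis x hx
                · exact absurd hx h
          · rw [hJ]
            refine ⟨?_, by simp, by simp, fun a h8 h9 => by simp [ha'' a h8 h9],
              by simp [h4''], by simp [h5''], by simp [h33''], by simpa using hS'', by simpa,
              by simpa using hord, by simpa using hmono, ?_⟩
            · repeat' first | exact hB'' | refine Base.setReg ?_ (by decide)
            · intro x hx
              simp only [List.mem_append, List.mem_singleton] at hx
              rcases hx with hx | rfl
              · exact hvis x hx
              · exact h0
        · intro _ τ _ hτ
          rw [hJ] at hτ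
          obtain ⟨h1, h2, h3, h4, h5, h6, h7, h8, h9, h10, h11, h12⟩ := hτ
          exact ⟨h1, h2, h3, fun z => ⟨by simpa using h4, by simpa using h5, by simpa using h6,
            by simpa using h7, by simpa using h8, by simpa using h9, by simpa using h10,
            by simpa using h11, h12⟩⟩
      · simp only [reg_setReg, Nat.reduceEqDiff, if_false, if_true]
        rintro k₁ σ₁ hk₁ ⟨hB₁, ha₁, h4₁, h5₁, h33₁, hS₁, hle₁, hord₁, hmono₁, hvis₁⟩
        rw [hI]
        refine ⟨hB₁, fun a h8 h9 => by rw [ha₁ a h8 h9, ha a h8 h9], h4₁, h5₁, hS₁, by omega, ?_, ?_⟩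
        · intro j hj x hx
          rw [h33₁] at hj
          rw [hord₁ j (by omega)] at hx
          rcases Nat.lt_succ_iff_lt_or_eq.1 hj with hj | rfl
          · exact hmono₁ x (hcl j hj x hx)
          · exact hvis₁ x hx
        · rw [h33₁, partSize_congr (g := σ'.arr 8) fun k hk => hord₁ k (by omega), partSize_succ]
          omega
    · have heq : σ'.reg 33 = σ'.reg 6 := by omega
      refine ⟨hS.one_le, hS.zero, hS.lt, hS.inj, hS.parent, fun v hv => ?_⟩
      -- Connectedness in the form of closed sets: the vertices found include the root and all their
      -- neighbours, hence every vertex.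
      refine (hS.vis v).1 (E.inst.conn {v | σ'.arr 9 v ≠ 0} ⟨σ.reg 4, h4, ?_⟩ ?_ v hv)
      · exact (hS.vis _).2 ⟨0, hS.one_le, hS.zero⟩
      · intro x hx u hu
        obtain ⟨j, hj, rfl⟩ := (hS.vis x).1 hx
        exact hcl j (by omega) u hu
  simp only [wp_block_cons, wp_copy, wp_store, reg_setReg, reg_setArr]
  simp only [Nat.reduceEqDiff, if_false, hB.reg2, hB.reg3]
  refine ⟨by omega, by omega, by omega, by omega,
    wp_loop I ?_ fun k σ' h => by simpa only [wp_block_nil] using hloop k σ' h⟩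
  rw [hI]
  refine ⟨?_, fun a h6 h7 => by simp [h6, h7], by simp, by simp, ?_, by simp, by simp, ?_⟩
  · repeat' first
      | exact hB | refine Base.setReg ?_ (by decide) | refine Base.setArr ?_ (by decide)
  · simpa using SearchInv.single h4 h9
  · simp [partSize]
    omega

end RAM

/-! ### Greedy colouring and the moving hole. -/

namespace RAM

open NatGraph

variable {W n s Δ : ℕ} {nl : ℕ → List ℕ} {A₀ A₁ p : ℕ → ℕ} {σ : State}

/-- Colour the vertices in the reversed search order. -/
def greedy : Program :=
  block [cp 36 6, .loop (.lt 2 36) (block [sb 36 36 3, ld 24 8 36, tryColour])]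

/-- The result of `greedy`. -/
structure GreedyPost (n s : ℕ) (nl : ℕ → List ℕ) (A₀ A₁ p : ℕ → ℕ) (σ σ' : State) : Prop where
  base : Base n s A₀ A₁ p σ'
  arr : ∀ a, a ≠ 4 → σ'.arr a = σ.arr a
  reg : ∀ x < 20, σ'.reg x = σ.reg x
  valid : ValidCol nl s p (σ'.arr 4)
  coloured : ∀ v < n, v ≠ σ.reg 4 → σ'.arr 4 v ≠ 0
  root : σ'.reg 29 = 0 ∧ σ'.arr 4 (σ.reg 4) = 0 ∧ Stuck nl s p (σ'.arr 4) (σ.reg 4) ∨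
    σ'.reg 29 ≠ 0 ∧ σ'.arr 4 (σ.reg 4) ≠ 0

theorem TryPost.validCol (G : NatGraph n nl) {σ' : State} (h : TryPost s nl p σ σ')
    (hv : ValidCol nl s p (σ.arr 4)) : ValidCol nl s p (σ'.arr 4) := by
  rw [h.col]
  rcases h.res with ⟨h0, -⟩ | ⟨i, hi, h1, h2⟩
  · rw [h0]
    exact hv.unset _
  · rw [h1]
    exact hv.set G hi h2

theorem TryPost.base {σ' : State} (h : TryPost s nl p σ σ') (hB : Base n s A₀ A₁ p σ) :
    Base n s A₀ A₁ p σ' :=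
  hB.of_frame (fun x hx => h.reg x (by omega)) fun a ha => h.arr a (by omega)

/-- In reverse order, a vertex other than the root is treated while its earlier neighbour in the
search order is still uncoloured, hence it is not stuck. -/
theorem wp_greedy (E : Env W n s nl A₀ A₁ p Δ) (hB : Base n s A₀ A₁ p σ)
    (hord : IsSearchOrder n nl (σ.arr 8) (σ.reg 4) (σ.reg 6)) (h4 : ∀ v, σ.arr 4 v = 0)
    (h5 : ∀ c, σ.arr 5 c = 0) :
    wp W greedy (60 * size n nl) σ fun _ σ' => GreedyPost n s nl A₀ A₁ p σ σ' := by
  have hsize : partSize nl (σ.arr 8) (σ.reg 6) ≤ size n nl := partSize_le hord.lt hord.inj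
  have hle := le_partSize (nl := nl) (σ.arr 8) (σ.reg 6)
  have hone := hord.one_le
  obtain ⟨I, hI⟩ : ∃ I : ℕ → State → Prop, I = fun k σ' => Base n s A₀ A₁ p σ' ∧
      (∀ a, a ≠ 4 → σ'.arr a = σ.arr a) ∧ (∀ x < 20, σ'.reg x = σ.reg x) ∧
      ValidCol nl s p (σ'.arr 4) ∧ σ'.reg 36 ≤ σ.reg 6 ∧
      (∀ j < σ'.reg 36, σ'.arr 4 (σ.arr 8 j) = 0) ∧
      (∀ j < σ.reg 6, j ≠ 0 → σ'.reg 36 ≤ j → σ'.arr 4 (σ.arr 8 j) ≠ 0) ∧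
      (σ'.reg 36 = 0 →
        (σ'.reg 29 = 0 ∧ σ'.arr 4 (σ.reg 4) = 0 ∧ Stuck nl s p (σ'.arr 4) (σ.reg 4) ∨
          σ'.reg 29 ≠ 0 ∧ σ'.arr 4 (σ.reg 4) ≠ 0)) ∧
      50 * partSize nl (σ.arr 8) (σ'.reg 36) + 1 ≤ k := ⟨_, rfl⟩
  simp only [greedy, wp_block_cons, wp_copy, wp_block_nil]
  refine ⟨by omega, wp_loop I ?_ ?_⟩
  · rw [hI]
    refine ⟨hB.setReg (by decide), fun a _ => rfl, fun x hx => by simp; omega, ?_, by simp,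
      fun j _ => h4 _, fun j h1 _ h2 => ?_, fun h => ?_, by simp; omega⟩
    · have : σ.arr 4 = fun _ => 0 := funext h4
      rw [arr_setReg, this]
      exact validCol_zero
    · simp at h2; omega
    · simp at h; omega
  · intro k σ' hIk
    rw [hI] at hIk
    obtain ⟨hB', ha, hr, hV, hk36, hun, hco, hroot, hk⟩ := hIk
    rw [holds_lt, hB'.reg2]
    refine ⟨by omega, fun hpos => ?_, fun h => ?_⟩
    · obtain ⟨j, hj⟩ : ∃ j, σ'.reg 36 = j + 1 := ⟨σ'.reg 36 - 1, by omega⟩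
      rw [hj, partSize_succ] at hk
      simp only [wp_block_cons, wp_load, wp_sub, reg_setReg, wp_block_nil]
      simp only [if_true, hB'.reg3, hj, Nat.add_sub_cancel, arr_setReg,
        ha 8 (by decide)]
      refine ⟨by omega, by omega, ?_⟩
      have hlt := hord.lt j (by omega)
      set v := σ.arr 8 j with hv
      set τ := (σ'.setReg 36 j).setReg 24 v with hτ
      have hτ4 : τ.arr 4 = σ'.arr 4 := rfl
      have hτ24 : τ.reg 24 = v := by simp [hτ]
      refine wp_of_spec (wp_tryColour (σ := τ) (v := v) E
        ((hB'.setReg (by decide)).setReg (by decide)) hτ24 hlt fun c => ?_) (by omega) ?_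
      · rw [hτ, arr_setReg, arr_setReg, ha 5 (by decide)]; exact h5 c
      intro k₁ σ₁ hk₁ hT
      have hcol := hT.col
      have hres := hT.res
      rw [hτ4, hτ24] at hcol hres
      have h36 : σ₁.reg 36 = j := by rw [hT.reg 36 (by decide)]; simp [hτ]
      have hvcol := hun j (by omega)
      rw [hI]
      refine ⟨hT.base ((hB'.setReg (by decide)).setReg (by decide)), fun a h => ?_, fun x hx => ?_,
        hT.validCol E.inst.graph hV, by omega, fun i hi => ?_, fun i hi h0 hji => ?_, fun h0 => ?_,
        by rw [h36]; omega⟩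
      · rw [hT.arr a h]; exact ha a h
      · rw [hT.reg x (by omega), ← hr x hx, hτ, reg_setReg, reg_setReg, if_neg (by omega),
          if_neg (by omega)]
      · rw [hcol, Function.update_of_ne, hun i (by omega)]
        intro e
        have := hord.inj i (by omega) j (by omega) e
        omega
      · by_cases hij : i = j
        · subst hij
          rw [hcol, Function.update_self]
          rcases hres with ⟨-, hs⟩ | ⟨i', -, h', -⟩
          -- The earlier neighbour has not been treated yet.
          · obtain ⟨i', hi', hm⟩ := hord.parent i (by omega) (by omega)
            exact absurd hs (E.inst.not_stuck (E.inst.graph.symm (E.inst.graph.symm hm))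
              (hun i' (by omega)))
          · omega
        · rw [hcol, Function.update_of_ne]
          · exact hco i hi h0 (by omega)
          · intro e
            exact hij (hord.inj i (by omega) j (by omega) e)
      · obtain rfl : j = 0 := by omega
        have hv' : v = σ.reg 4 := hord.zero
        rw [← hv', hcol, Function.update_self]
        rcases hres with ⟨h1, h2⟩ | ⟨i', -, h', -⟩
        · left
          -- A failed attempt writes `0` into a cell that was `0`, so the root is stuck for the
          -- final colouring as well.
          have hupd := Function.update_eq_self v (σ'.arr 4)
          rw [hvcol] at hupd
          rw [h1, hupd]
          exact ⟨rfl, rfl, h2⟩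
        · right
          omega
    · have h0 : σ'.reg 36 = 0 := by omega
      refine ⟨hB', ha, hr, hV, fun v hv hne => ?_, hroot h0⟩
      obtain ⟨j, hj, rfl⟩ := hord.surj v hv
      refine hco j hj ?_ (by omega)
      rintro rfl
      exact hne hord.zero

/-- Move the uncoloured vertex from register `4` along the walk in array `12`, of length
register `7`, until it can be coloured. -/
def moveAlong : Program :=
  block [cp 24 4, cp 37 2, .loop (.lt 37 7) (block [ld 38 12 37, ld 39 4 38, st 4 24 39, st 4 38 2,
    cp 24 38, ad 37 37 3, tryColour, .cond (.eq 29 2) .skip (cp 37 7)])]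

/-- All vertices are coloured. -/
structure Coloured (n s : ℕ) (nl : ℕ → List ℕ) (A₀ A₁ p : ℕ → ℕ) (σ : State) : Prop where
  base : Base n s A₀ A₁ p σ
  valid : ValidCol nl s p (σ.arr 4)
  ne_zero : ∀ v < n, σ.arr 4 v ≠ 0

/-- As long as the colouring attempts fail, the hole is stuck at every vertex visited, which `hns`
excludes for the entire walk. Each step costs a constant times one more than the degree of the new
vertex, so the total is governed by the size of the walk, counted with repetitions. -/
theorem wp_moveAlong (E : Env W n s nl A₀ A₁ p Δ) (hB : Base n s A₀ A₁ p σ)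
    (h5 : ∀ c, σ.arr 5 c = 0) (hV : ValidCol nl s p (σ.arr 4))
    (hH : HoleCol n s (σ.arr 4) (σ.reg 4)) (hroot : σ.reg 4 < n)
    (hs : Stuck nl s p (σ.arr 4) (σ.reg 4))
    (hw : IsWalkFrom nl (σ.reg 4) (tab (σ.reg 7) (σ.arr 12)))
    (hns : ¬ StuckAlong nl s p (σ.arr 4) (σ.reg 4) (tab (σ.reg 7) (σ.arr 12))) {T : ℕ}
    (hT : partSize nl (σ.arr 12) (σ.reg 7) ≤ T) (hTW : T < W) :
    wp W moveAlong (60 * T + 5) σ fun _ σ' => Coloured n s nl A₀ A₁ p σ' := by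
  have hle := le_partSize (nl := nl) (σ.arr 12) (σ.reg 7)
  obtain ⟨I, hI⟩ : ∃ I : ℕ → State → Prop, I = fun k σ' => Base n s A₀ A₁ p σ' ∧
      (∀ a, a ≠ 4 → σ'.arr a = σ.arr a) ∧ σ'.reg 7 = σ.reg 7 ∧ ValidCol nl s p (σ'.arr 4) ∧
      (σ'.reg 37 = σ.reg 7 ∧ 1 ≤ k ∧ (∀ v < n, σ'.arr 4 v ≠ 0) ∨
      ∃ T', σ'.reg 37 + T' = σ.reg 7 ∧ σ'.reg 24 < n ∧ HoleCol n s (σ'.arr 4) (σ'.reg 24) ∧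
        Stuck nl s p (σ'.arr 4) (σ'.reg 24) ∧
        IsWalkFrom nl (σ'.reg 24) (tab T' fun t => σ.arr 12 (σ'.reg 37 + t)) ∧
        ¬ StuckAlong nl s p (σ'.arr 4) (σ'.reg 24) (tab T' fun t => σ.arr 12 (σ'.reg 37 + t)) ∧
        60 * partSize nl (σ.arr 12) (σ.reg 7) + 1 ≤
          k + 60 * partSize nl (σ.arr 12) (σ'.reg 37)) := ⟨_, rfl⟩
  simp only [moveAlong, wp_block_cons, wp_copy, wp_block_nil]
  simp only [reg_setReg, Nat.reduceEqDiff, if_false, hB.reg2]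
  refine ⟨by omega, by omega, wp_loop I ?_ ?_⟩
  · rw [hI]
    refine ⟨(hB.setReg (by decide)).setReg (by decide), fun _ _ => rfl, by simp, hV,
      Or.inr ⟨σ.reg 7, by simp, by simpa, by simpa using hH, by simpa using hs, by simpa using hw,
        by simpa using hns, by simp [partSize] at hT ⊢; omega⟩⟩
  · intro k σ' hIk
    rw [hI] at hIk
    obtain ⟨hB', ha, h7, hV', h⟩ := hIk
    rw [holds_lt, h7]
    rcases h with ⟨h37, hk, hc⟩ | ⟨T', hT', h24, hH', hs', hw', hns', hk⟩
    · exact ⟨hk, fun h => by omega, fun _ => ⟨hB', hV', hc⟩⟩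
    have hmono : partSize nl (σ.arr 12) (σ'.reg 37) ≤ partSize nl (σ.arr 12) (σ.reg 7) :=
      Finset.sum_le_sum_of_subset (Finset.range_mono (by omega))
    rcases T' with _ | T'
    -- On an empty remaining walk `StuckAlong` is just `Stuck`, so the walk cannot be used up
    -- without success.
    · exact absurd hs' hns'
    refine ⟨by omega, fun hlt => ?_, fun h => by omega⟩
    have hmono' : partSize nl (σ.arr 12) (σ'.reg 37 + 1) ≤ partSize nl (σ.arr 12) (σ.reg 7) :=
      Finset.sum_le_sum_of_subset (Finset.range_mono (by omega))
    rw [partSize_succ] at hmono'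
    rw [tab_succ] at hw' hns'
    simp only [Nat.add_zero] at hw' hns'
    obtain ⟨hu, hw'⟩ := hw'
    have hns'' := fun h => hns' ⟨hs', h⟩
    obtain ⟨v, hv⟩ : ∃ v, σ'.reg 24 = v := ⟨_, rfl⟩
    obtain ⟨col, hcol⟩ : ∃ col, σ'.arr 4 = col := ⟨_, rfl⟩
    obtain ⟨u, hu'⟩ : ∃ u, σ.arr 12 (σ'.reg 37) = u := ⟨_, rfl⟩
    rw [hv] at h24 hu
    rw [hv, hcol] at hH' hs'
    rw [hcol] at hV'
    rw [hu'] at hu hw' hmono'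
    rw [hv, hcol, hu'] at hns''
    have hun := E.inst.graph.lt hu
    have huv : u ≠ v := fun e => E.inst.graph.irrefl v (e ▸ hu)
    simp only [wp_block_cons, wp_load, wp_store, wp_add, wp_copy, reg_setReg, reg_setArr,
      arr_setReg, Nat.reduceEqDiff, if_false, if_true, hB'.reg2, hB'.reg3,
      ha 12 (by decide), hv, hcol, hu']
    refine ⟨by omega, by omega, by omega, by omega, by omega, by omega, by omega, ?_⟩
    generalize hτ : State.setReg _ 37 _ = τ
    have hτB : Base n s A₀ A₁ p τ := by
      rw [← hτ]
      repeat' first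
        | exact hB' | refine Base.setReg ?_ (by decide) | refine Base.setArr ?_ (by decide)
    have hτ4 : τ.arr 4 = moveHole col v u := by rw [← hτ]; simp [hcol, moveHole]
    have hτa : ∀ a, a ≠ 4 → τ.arr a = σ.arr a := fun a h => by rw [← hτ]; simp [h, ha a h]
    have hτ24 : τ.reg 24 = u := by rw [← hτ]; simp
    have hτ7 : τ.reg 7 = σ.reg 7 := by rw [← hτ]; simp [h7]
    have hτ37 : τ.reg 37 = σ'.reg 37 + 1 := by rw [← hτ]; simp
    have hcu : col u ≠ 0 := fun h => huv ((hH'.hole u hun).1 h)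
    refine wp_of_spec (wp_tryColour (v := u) E hτB hτ24 hun fun c => ?_) (by omega) ?_
    · rw [hτa 5 (by decide)]; exact h5 c
    intro k₁ σ₁ hk₁ hTry
    have hB₁ := hTry.base hτB
    have hV₁ := hTry.validCol E.inst.graph (hτ4 ▸ E.inst.validCol_moveHole hV' hs' hu hcu)
    have hH₁ := hH'.moveHole E.inst.graph hu
    have hcol₁ := hTry.col
    have hres := hTry.res
    rw [hτ4, hτ24] at hcol₁ hres
    have h7₁ : σ₁.reg 7 = σ.reg 7 := by rw [hTry.reg 7 (by decide), hτ7]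
    have h37₁ : σ₁.reg 37 = σ'.reg 37 + 1 := by rw [hTry.reg 37 (by decide), hτ37]
    have h24₁ : σ₁.reg 24 = u := by rw [hTry.reg 24 (by decide), hτ24]
    have ha₁ : ∀ a, a ≠ 4 → σ₁.arr a = σ.arr a := fun a h => by rw [hTry.arr a h, hτa a h]
    simp only [wp_cond, holds_eq, hB₁.reg2, wp_skip, wp_copy, wp_block_nil]
    refine ⟨by omega, fun h0 => ?_, fun h0 => ⟨by clear hres; omega, ?_⟩⟩
    · rcases hres with ⟨-, hst⟩ | ⟨i, -, h', -⟩
      -- The failed attempt writes `0` into the hole and changes nothing.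
      · have h4 : σ₁.arr 4 = moveHole col v u := by
          rw [hcol₁, h0, show (0 : ℕ) = moveHole col v u u by simp [moveHole],
            Function.update_eq_self]
        rw [hI]
        refine ⟨hB₁, ha₁, h7₁, hV₁, Or.inr ⟨T', by omega, ?_⟩⟩
        have hshift : (fun t => σ.arr 12 (σ'.reg 37 + (t + 1))) =
            fun t => σ.arr 12 (σ'.reg 37 + 1 + t) := by
          funext t
          rw [show σ'.reg 37 + (t + 1) = σ'.reg 37 + 1 + t by omega]
        rw [hshift] at hns'' hw'
        rw [h24₁, h4, h37₁, partSize_succ, hu']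
        exact ⟨hun, hH₁, hst, hw', hns'', by omega⟩
      · omega
    · rw [hI]
      refine ⟨hB₁.setReg (by decide), ha₁, by simpa using h7₁, hV₁,
        Or.inl ⟨by simp [h7₁], by clear hres; omega, fun x hx => ?_⟩⟩
      rw [arr_setReg, hcol₁]
      by_cases hxu : x = u
      · rwa [hxu, Function.update_self]
      · rw [Function.update_of_ne hxu]
        exact fun h => hxu ((hH₁.hole x hx).1 h)

/-- Copy the parts into array `3`. -/
def output : Program :=
  block [cp 36 2, .loop (.lt 36 0) (block [ld 38 4 36, sb 38 38 3, st 3 36 38, ad 36 36 3])]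

theorem wp_output (E : Env W n s nl A₀ A₁ p Δ) (h : Coloured n s nl A₀ A₁ p σ) :
    wp W output (5 * n + 2) σ fun _ σ' => ∀ v < n, σ'.arr 3 v = σ.arr 4 v - 1 := by
  have hword := E.word
  have hsize := le_size (n := n) (nl := nl)
  have hn := E.inst.pos
  simp only [output, wp_block_cons, wp_copy, wp_block_nil]
  refine ⟨by omega, wp_loop (fun k σ' => Base n s A₀ A₁ p σ' ∧ σ'.arr 4 = σ.arr 4 ∧
    σ'.reg 36 ≤ n ∧ (∀ v < σ'.reg 36, σ'.arr 3 v = σ.arr 4 v - 1) ∧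
    5 * n + 1 ≤ k + 5 * σ'.reg 36)
    ⟨h.base.setReg (by decide), rfl, by simp [h.base.reg2], by simp [h.base.reg2],
      by simp [h.base.reg2]⟩ ?_⟩
  rintro k σ' ⟨hB, h4, hle, hout, hk⟩
  rw [holds_lt, hB.reg0]
  refine ⟨by omega, fun hlt => ?_, fun hge => ?_⟩
  · obtain ⟨I, hI⟩ : ∃ I : ℕ → State → Prop, I = (fun k σ' => Base n s A₀ A₁ p σ' ∧
      σ'.arr 4 = σ.arr 4 ∧ σ'.reg 36 ≤ n ∧ (∀ v < σ'.reg 36, σ'.arr 3 v = σ.arr 4 v - 1) ∧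
      5 * n + 1 ≤ k + 5 * σ'.reg 36) := ⟨_, rfl⟩
    rw [← hI]
    simp only [wp_block_cons, wp_load, wp_store, wp_add, wp_sub, wp_block_nil, reg_setReg,
      reg_setArr, Nat.reduceEqDiff, if_false, if_true, hB.reg3, h4]
    rw [hI]
    refine ⟨by omega, by omega, by omega, by omega, by omega, ?_, by simpa, by simp; omega, ?_,
      by simp; omega⟩
    · repeat' first
        | exact hB | refine Base.setReg ?_ (by decide) | refine Base.setArr ?_ (by decide)
    · intro v hv
      simp only [reg_setReg, if_true] at hv
      simp only [arr_setReg, arr_setArr, if_true, Function.update_apply]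
      split_ifs with h
      · rw [h]
      · exact hout v (by omega)
  · intro v hv
    exact hout v (by omega)

end RAM

/-! ### Closed walks along segments of the path. -/

namespace RAM

open NatGraph

variable {n s Δ : ℕ} {nl : ℕ → List ℕ} {p : ℕ → ℕ} {path pos col : ℕ → ℕ} {L : ℕ}

/-- The distance between two positions. -/
def gap (x y : ℕ) : ℕ := (y - x) + (x - y)

/-- The position after `t` steps from `x` towards `y`. -/
def step (x y t : ℕ) : ℕ := if x ≤ y then x + t else x - t

/-- The closed walk from `r` along the path between the positions `x` and `y`. -/
def segWalk (path : ℕ → ℕ) (r x y : ℕ) : List ℕ :=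
  tab (gap x y + 1) (fun t => path (step x y t)) ++ [r]

theorem step_zero (x y : ℕ) : step x y 0 = x := by simp [step]

theorem step_gap (x y : ℕ) : step x y (gap x y) = y := by
  unfold step gap; split_ifs <;> omega

theorem step_bounds {x y t : ℕ} (ht : t ≤ gap x y) :
    x ≤ step x y t ∧ step x y t ≤ y ∨ y ≤ step x y t ∧ step x y t ≤ x := by
  unfold step gap at *; split_ifs <;> omega

theorem step_inj {x y t t' : ℕ} (ht : t ≤ gap x y) (ht' : t' ≤ gap x y)
    (h : step x y t = step x y t') : t = t' := by
  unfold step gap at *; split_ifs at h <;> omega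

theorem step_succ {x y t : ℕ} (ht : t < gap x y) :
    step x y (t + 1) = step x y t + 1 ∨ step x y t = step x y (t + 1) + 1 := by
  unfold step gap at *; split_ifs <;> omega

theorem step_symm {x y t : ℕ} (ht : t ≤ gap x y) : step y x t = step x y (gap x y - t) := by
  unfold step gap at *; split_ifs <;> omega

theorem gap_comm (x y : ℕ) : gap x y = gap y x := by unfold gap; omega

theorem segWalk_reverse (path : ℕ → ℕ) (r x y : ℕ) : segWalk path r y x =
    tab (gap x y + 1) (fun t => path (step x y (gap x y - t))) ++ [r] := by
  unfold segWalk tab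
  rw [gap_comm y x]
  congr 1
  refine List.map_congr_left fun t ht => ?_
  rw [step_symm (by have := List.mem_range.1 ht; omega)]

theorem PathInv.adj_of (G : NatGraph n nl) (h : PathInv n nl path pos L) {q q' : ℕ}
    (hq : 1 ≤ q) (hqL : q ≤ L) (hq' : 1 ≤ q') (hqL' : q' ≤ L) (hqq : q' = q + 1 ∨ q = q' + 1) :
    path q' ∈ nl (path q) := by
  rcases hqq with rfl | rfl
  · exact h.adj q hq (by omega)
  · exact G.symm (h.adj q' hq' (by omega))

/-- A vertex of the path that is different from the last one, and its position. -/
structure Inner (L x : ℕ) : Prop where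
  one_le : 1 ≤ x
  lt : x < L

theorem seg_inj (hP : PathInv n nl path pos L) {x y : ℕ} (hx : Inner L x) (hy : Inner L y) :
    ∀ t ≤ gap x y, ∀ t' ≤ gap x y, path (step x y t) = path (step x y t') → t = t' := by
  intro t ht t' ht' e
  have h1 := step_bounds ht
  have h2 := step_bounds ht'
  obtain ⟨_, _⟩ := hx
  obtain ⟨_, _⟩ := hy
  exact step_inj ht ht' (hP.inj (by omega) (by omega) (by omega) (by omega) e)

theorem seg_ne (hP : PathInv n nl path pos L) {x y : ℕ} (hx : Inner L x) (hy : Inner L y) :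
    ∀ t ≤ gap x y, path (step x y t) ≠ path L := by
  intro t ht e
  have h1 := step_bounds ht
  obtain ⟨_, _⟩ := hx
  obtain ⟨_, _⟩ := hy
  have := hP.inj (by omega) (by omega) (by omega) (by omega) e
  omega

theorem seg_adj (G : NatGraph n nl) (hP : PathInv n nl path pos L) {x y : ℕ} (hx : Inner L x)
    (hy : Inner L y) :
    ∀ t < gap x y, path (step x y (t + 1)) ∈ nl (path (step x y t)) := by
  intro t ht
  have h1 := step_bounds ht.le
  have h2 := step_bounds (show t + 1 ≤ gap x y from ht)
  obtain ⟨_, _⟩ := hx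
  obtain ⟨_, _⟩ := hy
  exact hP.adj_of G (by omega) (by omega) (by omega) (by omega) (step_succ ht)

theorem isWalkFrom_segWalk (G : NatGraph n nl) (hP : PathInv n nl path pos L) {x y : ℕ}
    (hx : Inner L x) (hy : Inner L y) (hxn : path x ∈ nl (path L)) (hyn : path y ∈ nl (path L)) :
    IsWalkFrom nl (path L) (segWalk path (path L) x y) :=
  Instance.isWalkFrom_closed G (by rwa [step_zero]) (seg_adj G hP hx hy) (by rwa [step_gap])

theorem isWalkFrom_segWalk_append (G : NatGraph n nl) (hP : PathInv n nl path pos L) {x y : ℕ}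
    (hx : Inner L x) (hy : Inner L y) (hxn : path x ∈ nl (path L)) (hyn : path y ∈ nl (path L))
    {w : List ℕ} (hw : IsWalkFrom nl (path L) w) :
    IsWalkFrom nl (path L) (segWalk path (path L) x y ++ w) := by
  rw [isWalkFrom_append]
  refine ⟨isWalkFrom_segWalk G hP hx hy hxn hyn, ?_⟩
  rw [segWalk, Instance.getLastD_closed]
  exact hw

/-- The total size of the vertices in a list. -/
def listSize (nl : ℕ → List ℕ) (w : List ℕ) : ℕ := (w.map fun v => (nl v).length + 1).sum

@[simp] theorem listSize_append (w w' : List ℕ) :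
    listSize nl (w ++ w') = listSize nl w + listSize nl w' := by simp [listSize]

theorem partSize_eq_listSize (f : ℕ → ℕ) (T : ℕ) : partSize nl f T = listSize nl (tab T f) := by
  induction T with
  | zero => simp [partSize, listSize, tab]
  | succ T ih => rw [partSize_succ, tab_succ', listSize_append, ih]; simp [listSize]

theorem listSize_segWalk (hP : PathInv n nl path pos L) {x y : ℕ} (hx : Inner L x)
    (hy : Inner L y) : listSize nl (segWalk path (path L) x y) ≤ 2 * size n nl := by
  rw [segWalk, listSize_append, ← partSize_eq_listSize]
  have h1 : partSize nl (fun t => path (step x y t)) (gap x y + 1) ≤ size n nl := by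
    refine partSize_le (fun k hk => ?_) fun k hk k' hk' e =>
      seg_inj hP hx hy k (by omega) k' (by omega) e
    have := step_bounds (show k ≤ gap x y by omega)
    obtain ⟨_, _⟩ := hx
    obtain ⟨_, _⟩ := hy
    exact hP.lt _ (by omega) (by omega)
  have h2 := length_lt_size (nl := nl) (hP.lt L hP.one_le le_rfl)
  simp [listSize]
  omega

/-- The ear runs along the path from `a` to `b` and the feeder from `h` to `a`. By `hord` the
position `a` lies between the other two, so ear and feeder meet only there. The optional first turn
handles the case that `h` and `a` have the same colour, in which `b` must have another one. -/
theorem not_stuckAlong_segWalk (I : NatGraph.Instance n nl s p Δ) (hP : PathInv n nl path pos L)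
    (hf : HoleCol n s col (path L)) {a b h : ℕ} (ha : Inner L a) (hb : Inner L b) (hh : Inner L h)
    (hord : h < a ∧ a + 2 ≤ b ∨ b + 2 ≤ a ∧ a < h) (han : path a ∈ nl (path L))
    (hbn : path b ∈ nl (path L)) (hhn : path h ∈ nl (path L))
    (hgap : ∀ q, a < q ∧ q < b ∨ b < q ∧ q < a → path q ∉ nl (path L))
    (hcol : ¬ (col (path h) = col (path a) ∧ col (path b) = col (path a))) :
    ¬ StuckAlong nl s p col (path L)
      ((if col (path h) = col (path a) then segWalk path (path L) a b else []) ++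
        (segWalk path (path L) a b ++ (segWalk path (path L) a b ++
          (segWalk path (path L) h a ++ segWalk path (path L) b a)))) := by
  have hear : Instance.IsEar n nl (path L) (gap a b) fun t => path (step a b t) := by
    refine ⟨by unfold gap; omega, seg_inj hP ha hb, by rwa [step_zero], by rwa [step_gap],
      fun t h1 h2 => hgap _ ?_, seg_adj I.graph hP ha hb, seg_ne hP ha hb⟩
    unfold step gap at *; split_ifs <;> omega
  have hfeed : Instance.IsFeeder nl (path L) (gap a b) (fun t => path (step a b t)) (gap h a)
      fun t => path (step h a t) := by
    refine ⟨seg_inj hP hh ha, by rwa [step_zero], seg_adj I.graph hP hh ha, seg_ne hP hh ha,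
      by rw [step_gap, step_zero], fun t ht t' ht' e => ?_, by unfold gap; omega⟩
    have h1 := step_bounds ht.le
    have h2 := step_bounds ht'
    obtain ⟨_, _⟩ := ha
    obtain ⟨_, _⟩ := hb
    obtain ⟨_, _⟩ := hh
    have h3 := hP.inj (by omega) (by omega) (by omega) (by omega) e
    unfold step gap at *
    split_ifs at h3 <;> omega
  rw [segWalk_reverse path (path L) a b]
  split_ifs with heq
  · refine I.not_stuckAlong_ear' hear hfeed hf (by simpa only [step_zero]) ?_
    simp only [step_gap, step_zero]
    exact fun h => hcol ⟨heq, h⟩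
  · rw [List.nil_append]
    exact I.not_stuckAlong_ear hear hfeed hf (by simpa only [step_zero])

/-- Around a stuck vertex each part occurs at least `p i + 1 ≥ 1` times, and there are at least two
parts. -/
theorem exists_col_ne (I : NatGraph.Instance n nl s p Δ) {v : ℕ} (h : Stuck nl s p col v)
    (c : ℕ) : ∃ u ∈ nl v, col u ≠ c := by
  have h2 := I.two_le
  have key : ∀ i < s, ∃ u ∈ nl v, col u = i + 1 := fun i hi => by
    have h1 : 0 < colCount nl col v (i + 1) := by have := h i hi; omega
    obtain ⟨u, hu, he⟩ := List.countP_pos_iff.1 h1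
    exact ⟨u, hu, by simpa using he⟩
  by_cases hc : c = 1
  · obtain ⟨u, hu, he⟩ := key 1 (by omega)
    exact ⟨u, hu, by omega⟩
  · obtain ⟨u, hu, he⟩ := key 0 (by omega)
    exact ⟨u, hu, by omega⟩

/-- The path neighbours of position `b` are adjacent to `path b`, and the scan carries adjacency
from one position to the next, away from `b` on either side. -/
theorem adj_of_scan (G : NatGraph n nl) (hP : PathInv n nl path pos L) {lo b : ℕ} (hlo : 1 ≤ lo)
    (hb : lo ≤ b) (hbL : b < L)
    (hscan : ∀ q, lo ≤ q → q + 1 < L → q ≠ b → q + 1 ≠ b →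
      (path q ∈ nl (path b) ↔ path (q + 1) ∈ nl (path b))) :
    ∀ q, lo ≤ q → q < L → q ≠ b → path q ∈ nl (path b) := by
  have hup : ∀ t, b + 1 + t < L → path (b + 1 + t) ∈ nl (path b) := by
    intro t
    induction t with
    | zero => exact fun h => hP.adj_of G (by omega) (by omega) (by omega) (by omega) (Or.inl rfl)
    | succ t ih =>
      exact fun h => (hscan (b + 1 + t) (by omega) (by omega) (by omega) (by omega)).1
        (ih (by omega))
  have hdown : ∀ t, lo + 1 + t ≤ b → path (b - 1 - t) ∈ nl (path b) := by
    intro t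
    induction t with
    | zero =>
      exact fun h => hP.adj_of G (by omega) (by omega) (by omega) (by omega) (Or.inr (by omega))
    | succ t ih =>
      intro h
      refine (hscan (b - 1 - (t + 1)) (by omega) (by omega) (by omega) (by omega)).2 ?_
      rw [show b - 1 - (t + 1) + 1 = b - 1 - t by omega]
      exact ih (by omega)
  intro q h1 h2 h3
  rcases Nat.lt_or_ge q b with h | h
  · have := hdown (b - 1 - q) (by omega)
    rwa [show b - 1 - (b - 1 - q) = q by omega] at this
  · have := hup (q - (b + 1)) (by omega)
    rwa [show b + 1 + (q - (b + 1)) = q by omega] at this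

theorem card_erase_image (hP : PathInv n nl path pos L) {lo b : ℕ} (hlo : 1 ≤ lo) (hb : lo ≤ b)
    (hbL : b ≤ L) : (((Finset.Icc lo L).erase b).image path).card = L - lo := by
  rw [Finset.card_image_of_injOn, Finset.card_erase_of_mem (by simp; omega), Nat.card_Icc]
  · omega
  · intro q hq q' hq' e
    simp at hq hq'
    exact hP.inj (by omega) (by omega) (by omega) (by omega) e

theorem erase_image_subset (G : NatGraph n nl) {lo b : ℕ} (hb : path b ∈ nl (path L))
    (hall : ∀ q, lo ≤ q → q < L → q ≠ b → path q ∈ nl (path b)) :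
    ((Finset.Icc lo L).erase b).image path ⊆ (nl (path b)).toFinset := by
  intro v hv
  simp only [Finset.mem_image, Finset.mem_erase, Finset.mem_Icc] at hv
  obtain ⟨q, ⟨h1, h2, h3⟩, rfl⟩ := hv
  rw [List.mem_toFinset]
  rcases Nat.lt_or_ge q L with h | h
  · exact hall q h2 h h1
  · obtain rfl : q = L := by omega
    exact G.symm hb

/-- This pays for an unsuccessful scan: if `path b` is adjacent to the whole segment, the length of
the segment is at most its degree. -/
theorem sub_le_length (G : NatGraph n nl) (hP : PathInv n nl path pos L) {lo b : ℕ}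
    (hlo : 1 ≤ lo) (hb : lo ≤ b) (hbL : b < L) (hbn : path b ∈ nl (path L))
    (hall : ∀ q, lo ≤ q → q < L → q ≠ b → path q ∈ nl (path b)) :
    L - lo ≤ (nl (path b)).length := by
  rw [← card_erase_image hP hlo hb hbL.le]
  exact (Finset.card_le_card (erase_image_subset G hbn hall)).trans (List.toFinset_card_le _)

/-- The neighbours of the last vertex of the path do not form a clique. -/
theorem not_clique (I : NatGraph.Instance n nl s p Δ) (hP : PathInv n nl path pos L) {lo : ℕ}
    (hlo : 1 ≤ lo) (hloL : lo ≤ L) (hdeg : (nl (path L)).length = Δ)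
    (hN : ∀ v, v ∈ nl (path L) ↔ ∃ q, lo ≤ q ∧ q < L ∧ path q = v)
    (hall : ∀ b, lo ≤ b → b < L → ∀ q, lo ≤ q → q < L → q ≠ b → path q ∈ nl (path b)) :
    False := by
  have hsub : ∀ b, lo ≤ b → b ≤ L →
      ((Finset.Icc lo L).erase b).image path ⊆ (nl (path b)).toFinset := by
    intro b hb hbL
    rcases Nat.lt_or_ge b L with h | h
    · exact erase_image_subset I.graph ((hN _).2 ⟨b, hb, h, rfl⟩) (hall b hb h)
    · obtain rfl : b = L := by omega
      intro v hv
      simp only [Finset.mem_image, Finset.mem_erase, Finset.mem_Icc] at hv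
      obtain ⟨q, ⟨h1, h2, h3⟩, rfl⟩ := hv
      rw [List.mem_toFinset]
      exact (hN _).2 ⟨q, h2, by omega, rfl⟩
  have hΔ : Δ ≤ L - lo := by
    rw [← hdeg, ← card_erase_image hP hlo hloL le_rfl,
      ← List.toFinset_card_of_nodup (I.graph.nodup _)]
    refine Finset.card_le_card fun v hv => ?_
    obtain ⟨q, h1, h2, rfl⟩ := (hN v).1 (List.mem_toFinset.1 hv)
    exact Finset.mem_image_of_mem _ (by simp; omega)
  -- The segment has `Δ` other vertices, which already exhaust the degree bound; inclusion is
  -- therefore equality.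
  have heq : ∀ b, lo ≤ b → b ≤ L →
      ((Finset.Icc lo L).erase b).image path = (nl (path b)).toFinset := by
    intro b hb hbL
    refine Finset.eq_of_subset_of_card_le (hsub b hb hbL) ?_
    rw [card_erase_image hP hlo hb hbL]
    exact (List.toFinset_card_le _).trans ((I.deg_le _).trans hΔ)
  -- The segment is closed under adjacency, so by connectedness it contains every vertex, and the
  -- graph would be complete.
  have hmem : ∀ v < n, ∃ q, lo ≤ q ∧ q ≤ L ∧ path q = v := by
    refine I.conn {v | ∃ q, lo ≤ q ∧ q ≤ L ∧ path q = v}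
      ⟨path L, hP.lt L hP.one_le le_rfl, L, hloL, le_rfl, rfl⟩ ?_
    rintro v ⟨b, hb, hbL, rfl⟩ u hu
    rw [← List.mem_toFinset, ← heq b hb hbL] at hu
    simp only [Finset.mem_image, Finset.mem_erase, Finset.mem_Icc] at hu
    obtain ⟨q, ⟨-, h2, h3⟩, rfl⟩ := hu
    exact ⟨q, h2, h3, rfl⟩
  obtain ⟨u, hu, v, hv, huv, hnot⟩ := I.not_complete
  obtain ⟨b, hb, hbL, rfl⟩ := hmem u hu
  obtain ⟨q, hq, hqL, rfl⟩ := hmem v hv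
  refine hnot (List.mem_toFinset.1 (hsub b hb hbL (Finset.mem_image_of_mem _ ?_)))
  simp only [Finset.mem_erase, Finset.mem_Icc]
  exact ⟨fun e => huv (by rw [e]), hq, hqL⟩

/-- The walk around a diamond. -/
def diamondWalk (r u v w : ℕ) : List ℕ := [v, r, w, u, v, r, w, u, v]

theorem isWalkFrom_diamondWalk (G : NatGraph n nl) {r u v w : ℕ} (hvr : v ∈ nl r)
    (hwr : w ∈ nl r) (huw : u ∈ nl w) (huv : u ∈ nl v) :
    IsWalkFrom nl r (diamondWalk r u v w) := by
  have h1 := G.symm hvr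
  have h2 := G.symm huv
  simp [diamondWalk, IsWalkFrom, *]

/-- The feeding walk follows the path from `g` to `u`. Since `u` and `w` are consecutive positions,
it either avoids `w` or passes it immediately before `u`. -/
theorem not_stuckAlong_segWalk_diamond (I : NatGraph.Instance n nl s p Δ)
    (hP : PathInv n nl path pos L) (hf : HoleCol n s col (path L)) {b u w g : ℕ}
    (hu : Inner L u) (hw : Inner L w) (hg : Inner L g) (huw : u = w + 1 ∨ w = u + 1)
    (hbn : path b ∈ nl (path L)) (hun : path u ∈ nl (path L)) (hwn : path w ∈ nl (path L))
    (hgn : path g ∈ nl (path L)) (hub : path u ∈ nl (path b)) (hwb : path w ∉ nl (path b))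
    (hwb' : path w ≠ path b) (hcu : col (path u) = col (path b))
    (hcw : col (path w) = col (path b)) (hcg : col (path g) ≠ col (path b)) :
    ¬ StuckAlong nl s p col (path L)
      (segWalk path (path L) g u ++ diamondWalk (path L) (path u) (path b) (path w)) := by
  have huw' : path u ∈ nl (path w) := by
    obtain ⟨_, _⟩ := hu
    obtain ⟨_, _⟩ := hw
    exact hP.adj_of I.graph (by omega) (by omega) (by omega) (by omega) huw
  refine I.not_stuckAlong_diamond' hbn hun hwn huw' hub hwb hwb' hf hcu hcw (seg_inj hP hg hu)
    (by rwa [step_zero]) (seg_adj I.graph hP hg hu) (seg_ne hP hg hu) (by rw [step_gap])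
    (by rwa [step_zero]) ?_
  have hgu : g ≠ u := by rintro rfl; exact hcg hcu
  have hgw : g ≠ w := by rintro rfl; exact hcg hcw
  by_cases hbet : g < w ∧ w < u ∨ u < w ∧ w < g
  · right
    refine ⟨gap g u - 1, by unfold gap; omega, ?_, ?_⟩
    · congr 1
      unfold step gap; split_ifs <;> omega
    · rw [Nat.sub_add_cancel (by unfold gap; omega), step_gap]
  · left
    intro t ht e
    have h1 := step_bounds ht
    obtain ⟨_, _⟩ := hu
    obtain ⟨_, _⟩ := hw
    obtain ⟨_, _⟩ := hg
    have h3 := hP.inj (by omega) (by omega) (by omega) (by omega) e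
    omega

end RAM

/-! ### Gaps between the positions of the neighbours. -/

namespace RAM

open NatGraph

variable {W n s Δ : ℕ} {nl : ℕ → List ℕ} {A₀ A₁ p : ℕ → ℕ} {σ : State}

/-- What is known about the path when its last vertex cannot be coloured. -/
structure StuckState (n s : ℕ) (nl : ℕ → List ℕ) (A₀ A₁ p : ℕ → ℕ) (σ : State) : Prop where
  base : Base n s A₀ A₁ p σ
  path : PathInv n nl (σ.arr 6) (σ.arr 7) (σ.reg 5)
  last : σ.reg 4 = σ.arr 6 (σ.reg 5)
  max : ∀ u ∈ nl (σ.reg 4), σ.arr 7 u ≠ 0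
  hole : HoleCol n s (σ.arr 4) (σ.reg 4)
  stuck : Stuck nl s p (σ.arr 4) (σ.reg 4)

theorem StuckState.of_frame (h : StuckState n s nl A₀ A₁ p σ) {σ' : State}
    (hr : ∀ x < 6, σ'.reg x = σ.reg x) (ha : ∀ a < 8, σ'.arr a = σ.arr a) :
    StuckState n s nl A₀ A₁ p σ' := by
  obtain ⟨h1, h2, h3, h4, h5, h6⟩ := h
  refine ⟨h1.of_frame (fun x hx => hr x (by omega)) fun a h => ha a (by omega), ?_, ?_, ?_, ?_, ?_⟩
  all_goals
    simpa only [hr 4 (by decide), hr 5 (by decide), ha 4 (by decide), ha 6 (by decide),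
      ha 7 (by decide)]

theorem StuckState.pos_nbr (h : StuckState n s nl A₀ A₁ p σ) (G : NatGraph n nl) {u : ℕ}
    (hu : u ∈ nl (σ.reg 4)) : Inner (σ.reg 5) (σ.arr 7 u) ∧ σ.arr 6 (σ.arr 7 u) = u := by
  obtain ⟨h1, h2⟩ := h.path.path_pos u (h.max u hu)
  have h3 := h.max u hu
  refine ⟨⟨by omega, lt_of_le_of_ne h1 fun e => ?_⟩, h2⟩
  rw [e, ← h.last] at h2
  exact G.irrefl _ (h2 ▸ hu)

/-- Mark the positions of the neighbours of the last vertex of the path in array `10`, and find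
the highest gap between these positions: it lies between the registers `43` and `44`, and
register `43` holds `0` if there is no gap. -/
def findGap : Program :=
  block [forNbr 4 (block [ld 40 7 22, st 10 40 3]), sb 41 5 3, ld 42 10 41,
    .loop (.ne 42 2) (block [sb 41 41 3, ld 42 10 41]),
    st 10 2 3, cp 43 41, ld 42 10 43,
    .loop (.eq 42 2) (block [sb 43 43 3, ld 42 10 43]), ad 44 41 3]

/-- The result of `findGap`. -/
structure GapPost (nl : ℕ → List ℕ) (σ σ' : State) : Prop where
  reg : ∀ x < 20, σ'.reg x = σ.reg x
  arr : ∀ a, a ≠ 10 → σ'.arr a = σ.arr a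
  lt : σ'.reg 43 < σ'.reg 44
  lt_last : σ'.reg 44 < σ.reg 5
  above : ∀ q, σ'.reg 44 ≤ q → q < σ.reg 5 → σ.arr 6 q ∈ nl (σ.reg 4)
  between : ∀ q, σ'.reg 43 < q → q < σ'.reg 44 → σ.arr 6 q ∉ nl (σ.reg 4)
  below : σ'.reg 43 ≠ 0 → σ.arr 6 (σ'.reg 43) ∈ nl (σ.reg 4) ∧ σ'.reg 43 + 2 ≤ σ'.reg 44

/-- Two descents in the array of marks suffice: the first stops at the highest unmarked position
below the last vertex, the second at the next marked one. -/
theorem wp_findGap (E : Env W n s nl A₀ A₁ p Δ) (h : StuckState n s nl A₀ A₁ p σ)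
    (h10 : ∀ q, σ.arr 10 q = 0) :
    wp W findGap (30 * size n nl) σ fun _ σ' => GapPost nl σ σ' := by
  have hword := E.word
  have hG := E.inst.graph
  have hB := h.base
  have hP := h.path
  have hlast := h.last
  have h1L := hP.one_le
  have hroot : σ.reg 4 < n := by rw [hlast]; exact hP.lt _ h1L le_rfl
  have hdeg := length_lt_size (nl := nl) hroot
  have hLsize := (le_partSize (nl := nl) (fun k => σ.arr 6 (k + 1)) (σ.reg 5)).trans hP.partSize_le
  have h2L : 2 ≤ σ.reg 5 := by
    have h1 := E.inst.length_eq h.stuck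
    have h2 := E.inst.three_le
    obtain ⟨u, hu⟩ := List.exists_mem_of_length_pos (l := nl (σ.reg 4)) (by omega)
    obtain ⟨⟨h3, h4⟩, -⟩ := h.pos_nbr hG hu
    omega
  have hmark : ∀ q, 1 ≤ q → q < σ.reg 5 →
      ((∃ u ∈ nl (σ.reg 4), σ.arr 7 u = q) ↔ σ.arr 6 q ∈ nl (σ.reg 4)) := by
    intro q hq hqL
    constructor
    · rintro ⟨u, hu, rfl⟩
      rwa [(h.pos_nbr hG hu).2]
    · intro hq'
      exact ⟨_, hq', hP.pos_path q hq hqL.le⟩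
  have hprev : σ.arr 6 (σ.reg 5 - 1) ∈ nl (σ.reg 4) := by
    rw [hlast]
    exact hP.adj_of hG h1L le_rfl (by omega) (by omega) (Or.inr (by omega))
  simp only [findGap, wp_block_cons]
  refine wp_of_spec (wp_forNbr E (T := 2) (fun pre σ' =>
    (∀ q, σ'.arr 10 q ≠ 0 ↔ ∃ u ∈ pre, σ.arr 7 u = q) ∧
    (∀ x < 20, σ'.reg x = σ.reg x) ∧ ∀ a, a ≠ 10 → σ'.arr a = σ.arr a)
    hB hroot (by decide) ?_ ?_) (by omega) ?_
  · intro a b c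
    refine ⟨by simp [h10], fun x hx => ?_, by simp⟩
    simp only [reg_setReg]
    rw [if_neg (by omega), if_neg (by omega), if_neg (by omega)]
  · rintro pre u suf σ' hps hB' ⟨hm, hr, ha⟩
    simp only [wp_block_cons, wp_load, wp_store, wp_block_nil, reg_setReg, arr_setReg,
      Nat.reduceEqDiff, if_true, if_false, ha 7 (by decide), hB'.reg3]
    refine ⟨by omega, by omega, ?_, by simp, by simp, fun z => ⟨fun q => ?_, fun x hx => ?_,
      fun a h => ?_⟩⟩
    · repeat' first
        | exact hB' | refine Base.setReg ?_ (by decide) | refine Base.setArr ?_ (by decide)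
    · simp only [arr_setReg, arr_setArr, if_true, Function.update_apply, List.mem_append,
        List.mem_singleton]
      split_ifs with hq
      · simp [hq]
      · rw [hm]
        constructor
        · rintro ⟨v, hv, e⟩
          exact ⟨v, Or.inl hv, e⟩
        · rintro ⟨v, hv | rfl, e⟩
          · exact ⟨v, hv, e⟩
          · exact absurd e.symm hq
    · simp only [reg_setReg, reg_setArr]
      rw [if_neg (by omega), if_neg (by omega), if_neg (by omega), hr x hx]
    · simp [h, ha a h]
  rintro k₁ σ₁ hk₁ ⟨hB₁, hm₁, hr₁, ha₁⟩
  -- Neighbours lie on the path and have nonzero positions; the unmarked cell `0` stops the first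
  -- descent.
  have hmk0 : σ₁.arr 10 0 = 0 := by
    by_contra hne
    obtain ⟨u, hu, e⟩ := (hm₁ 0).1 hne
    exact h.max u hu e
  obtain ⟨mk, hmk⟩ : ∃ mk, σ₁.arr 10 = mk := ⟨_, rfl⟩
  rw [hmk] at hm₁ hmk0
  have hmn : ∀ q, 1 ≤ q → q < σ.reg 5 → (mk q ≠ 0 ↔ σ.arr 6 q ∈ nl (σ.reg 4)) := fun q h1 h2 =>
    (hm₁ q).trans (hmark q h1 h2)
  simp only [wp_sub, wp_load, reg_setReg, arr_setReg, if_true,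
    hB₁.reg3, hr₁ 5 (by decide), hmk]
  refine ⟨by omega, by omega, ?_⟩
  obtain ⟨L, hL⟩ : ∃ L, σ.reg 5 = L + 1 := ⟨σ.reg 5 - 1, by omega⟩
  obtain ⟨I, hI⟩ : ∃ I : ℕ → State → Prop, I = fun k σ' => Base n s A₀ A₁ p σ' ∧
      σ'.arr = σ₁.arr ∧ (∀ x < 20, σ'.reg x = σ₁.reg x) ∧ σ'.reg 41 ≤ L ∧
      σ'.reg 42 = mk (σ'.reg 41) ∧ (∀ q, σ'.reg 41 < q → q ≤ L → mk q ≠ 0) ∧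
      3 * σ'.reg 41 + (3 * L + 10) ≤ k := ⟨_, rfl⟩
  refine wp_loop I ?_ fun k σ' hIk => ?_
  · rw [hI]
    refine ⟨(hB₁.setReg (by decide)).setReg (by decide), rfl, fun x hx => ?_, by simp [hL],
      by simp, fun q h1 h2 => ?_, by simp; omega⟩
    · simp only [reg_setReg]
      rw [if_neg (by omega), if_neg (by omega)]
    · simp at h1
      omega
  rw [hI] at hIk
  obtain ⟨hB', ha', hr', h41, h42, habove, hk⟩ := hIk
  rw [holds_ne, h42, hB'.reg2]
  refine ⟨by omega, fun hne => ?_, fun hz => ?_⟩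
  · have h0 : σ'.reg 41 ≠ 0 := fun e => hne (e ▸ hmk0)
    simp only [wp_block_cons, wp_sub, wp_load, wp_block_nil, reg_setReg, arr_setReg,
      if_true, hB'.reg3, ha', hmk]
    rw [hI]
    refine ⟨by omega, by omega, (hB'.setReg (by decide)).setReg (by decide), ha', fun x hx => ?_,
      by simp; omega, by simp, fun q h1 h2 => ?_, by simp; omega⟩
    · simp only [reg_setReg]
      rw [if_neg (by omega), if_neg (by omega), hr' x hx]
    · simp at h1
      rcases Nat.lt_or_ge (σ'.reg 41) q with h' | h'
      · exact habove q h' h2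
      · rwa [show q = σ'.reg 41 by omega]
  rw [not_not] at hz
  obtain ⟨t, ht⟩ : ∃ t, σ'.reg 41 = t := ⟨_, rfl⟩
  rw [ht] at h41 habove hz hk
  -- The predecessor of the last vertex on the path is its neighbour, so the top position is marked.
  have htL : t < L := by
    rcases h41.lt_or_eq with h' | rfl
    · exact h'
    · rw [hL, Nat.add_sub_cancel] at hprev
      exact absurd hz ((hmn t (by omega) (by omega)).2 hprev)
  simp only [wp_store, wp_copy, reg_setReg, reg_setArr, arr_setReg, arr_setArr,
    if_true, hB'.reg2, hB'.reg3, ht, ha', hmk]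
  refine ⟨by omega, by omega, by omega, ?_⟩
  -- Cell `0` is now marked as a sentinel for the second descent; stopping there means that no
  -- neighbour lies below.
  obtain ⟨J, hJ⟩ : ∃ J : ℕ → State → Prop, J = fun k σ' => Base n s A₀ A₁ p σ' ∧
      (∀ a, a ≠ 10 → σ'.arr a = σ₁.arr a) ∧ σ'.arr 10 = Function.update mk 0 1 ∧
      (∀ x < 20, σ'.reg x = σ₁.reg x) ∧ σ'.reg 41 = t ∧
      σ'.reg 42 = Function.update mk 0 1 (σ'.reg 43) ∧ σ'.reg 43 ≤ t ∧
      (∀ q, σ'.reg 43 < q → q ≤ t → mk q = 0) ∧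
      3 * σ'.reg 43 + 5 ≤ k := ⟨_, rfl⟩
  refine wp_loop J ?_ fun k₂ σ₂ hJk => ?_
  · rw [hJ]
    refine ⟨?_, fun a h => ?_, ?_, fun x hx => ?_, by simp [ht], by simp, by simp,
      fun q h1 h2 => ?_, by simp; omega⟩
    · repeat' first
        | exact hB' | refine Base.setReg ?_ (by decide) | refine Base.setArr ?_ (by decide)
    · simp [h, ha']
    · simp [ha', hmk]
    · simp only [reg_setReg, reg_setArr]
      rw [if_neg (by omega), if_neg (by omega), hr' x hx]
    · simp at h1
      omega
  rw [hJ] at hJk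
  obtain ⟨hB₂, ha₂, h10₂, hr₂, h41₂, h42₂, h43₂, hbet, hk₂⟩ := hJk
  rw [holds_eq, h42₂, hB₂.reg2]
  refine ⟨by omega, fun hz' => ?_, fun hnz => ?_⟩
  · have h0 : σ₂.reg 43 ≠ 0 := fun e => by simp [e] at hz'
    rw [Function.update_of_ne h0] at hz'
    simp only [wp_block_cons, wp_sub, wp_load, wp_block_nil, reg_setReg, arr_setReg,
      if_true, hB₂.reg3, h10₂]
    rw [hJ]
    refine ⟨by omega, by omega, (hB₂.setReg (by decide)).setReg (by decide), ha₂, h10₂,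
      fun x hx => ?_, by simp [h41₂], by simp, by simp; omega, fun q h1 h2 => ?_, by simp; omega⟩
    · simp only [reg_setReg]
      rw [if_neg (by omega), if_neg (by omega), hr₂ x hx]
    · simp at h1
      rcases Nat.lt_or_ge (σ₂.reg 43) q with h' | h'
      · exact hbet q h' h2
      · rwa [show q = σ₂.reg 43 by omega]
  · simp only [wp_add, wp_block_nil, hB₂.reg3, h41₂]
    refine ⟨by omega, by omega, fun x hx => ?_, fun a h => ?_, ?_, ?_, fun q h1 h2 => ?_,
      fun q h1 h2 => ?_, fun h0 => ?_⟩
    · simp only [reg_setReg]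
      rw [if_neg (by omega), hr₂ x hx, hr₁ x hx]
    · rw [arr_setReg, ha₂ a h, ha₁ a h]
    · simp; omega
    · simp; omega
    · simp only [reg_setReg, if_true] at h1
      exact (hmn q (by omega) (by omega)).1 (habove q (by omega) (by omega))
    · simp at h1 h2
      exact fun h' => (hmn q (by omega) (by omega)).2 h' (hbet q h1 (by omega))
    · simp only [reg_setReg, Nat.reduceEqDiff, if_false, if_true] at h0 ⊢
      rw [Function.update_of_ne h0] at hnz
      refine ⟨(hmn _ (by omega) (by omega)).1 hnz, ?_⟩
      have : σ₂.reg 43 ≠ t := fun e => hnz (e ▸ hz)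
      omega

/-! ### Writing walks into memory. -/

/-- Append the vertex in register `r` to the walk. -/
def appendVertex (r : ℕ) : Program := block [st 12 7 r, ad 7 7 3]

/-- The walk in array `12`. -/
def walkOf (σ : State) : List ℕ := tab (σ.reg 7) (σ.arr 12)

theorem walkOf_append {σ σ' : State} {v : ℕ} (h7 : σ'.reg 7 = σ.reg 7 + 1)
    (h12 : σ'.arr 12 = Function.update (σ.arr 12) (σ.reg 7) v) : walkOf σ' = walkOf σ ++ [v] := by
  rw [walkOf, walkOf, h7, h12, tab_succ']
  congr 1
  · refine List.map_congr_left fun t ht => ?_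
    rw [Function.update_of_ne (by have := List.mem_range.1 ht; omega)]
  · simp

theorem length_walkOf (σ : State) : (walkOf σ).length = σ.reg 7 := by simp [walkOf]

/-- The state `σ'` arises from `σ` by appending `w` to the walk. -/
structure Appended (w : List ℕ) (σ σ' : State) : Prop where
  reg : ∀ x, x ≠ 7 → x ≠ 45 → x ≠ 46 → σ'.reg x = σ.reg x
  arr : ∀ a, a ≠ 12 → σ'.arr a = σ.arr a
  walk : walkOf σ' = walkOf σ ++ w

theorem Appended.reg7 {w : List ℕ} {σ σ' : State} (h : Appended w σ σ') :
    σ'.reg 7 = σ.reg 7 + w.length := by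
  rw [← length_walkOf, h.walk, List.length_append, length_walkOf]

theorem Appended.base {w : List ℕ} {σ σ' : State} (h : Appended w σ σ')
    (hB : Base n s A₀ A₁ p σ) : Base n s A₀ A₁ p σ' :=
  hB.of_frame (fun x _ => h.reg x (by omega) (by omega) (by omega)) fun a _ => h.arr a (by omega)

theorem Appended.trans {w w' : List ℕ} {σ σ' σ'' : State} (h : Appended w σ σ')
    (h' : Appended w' σ' σ'') : Appended (w ++ w') σ σ'' where
  reg x h1 h2 h3 := by rw [h'.reg x h1 h2 h3, h.reg x h1 h2 h3]
  arr a h1 := by rw [h'.arr a h1, h.arr a h1]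
  walk := by rw [h'.walk, h.walk, List.append_assoc]

theorem Appended.refl (σ : State) : Appended [] σ σ :=
  ⟨fun _ _ _ _ => rfl, fun _ _ => rfl, by simp⟩

theorem wp_appendVertex (hB : Base n s A₀ A₁ p σ) {r : ℕ} (hT : σ.reg 7 + 1 < W) :
    wp W (appendVertex r) 2 σ fun _ σ' => Appended [σ.reg r] σ σ' := by
  simp only [appendVertex, wp_block_cons, wp_store, wp_add, wp_block_nil, reg_setArr, hB.reg3]
  refine ⟨by omega, hT, by omega, fun x h _ _ => ?_, fun a h => ?_, walkOf_append ?_ ?_⟩ <;> simp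
  · exact fun h' => absurd h' h
  · exact fun h' => absurd h' h

/-- Append the closed walk along the path between the positions in the registers `rx`, `ry`. -/
def appendSeg (rx ry : ℕ) : Program :=
  block [cp 45 rx, ld 46 6 45, st 12 7 46, ad 7 7 3,
    .loop (.ne 45 ry) (block [.cond (.lt 45 ry) (ad 45 45 3) (sb 45 45 3), ld 46 6 45,
      st 12 7 46, ad 7 7 3]),
    appendVertex 4]

theorem wp_appendSeg (hB : Base n s A₀ A₁ p σ) {rx ry x y : ℕ} (hrx : σ.reg rx = x)
    (hry : σ.reg ry = y) (hy7 : ry ≠ 7) (hy45 : ry ≠ 45) (hy46 : ry ≠ 46)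
    (hyW : y + 1 < W) (hT : σ.reg 7 + gap x y + 2 < W) :
    wp W (appendSeg rx ry) (6 * gap x y + 10) σ fun _ σ' =>
      Appended (segWalk (σ.arr 6) (σ.reg 4) x y) σ σ' := by
  obtain ⟨I, hI⟩ : ∃ I : ℕ → State → Prop, I = fun k σ' => ∃ t ≤ gap x y,
    σ'.reg 45 = step x y t ∧
    Appended (tab (t + 1) fun t => σ.arr 6 (step x y t)) σ σ' ∧
    6 * gap x y + 4 ≤ k + 6 * t := ⟨_, rfl⟩
  simp only [appendSeg, wp_block_cons, wp_copy, wp_load, wp_store, wp_add, reg_setReg, arr_setReg,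
    reg_setArr, Nat.reduceEqDiff, if_true, if_false, hrx, hB.reg3]
  refine ⟨by omega, by omega, by omega, by omega, by omega, wp_loop I ?_ fun k σ₁ hIk => ?_⟩
  · rw [hI]
    refine ⟨0, Nat.zero_le _, by simp [step_zero], ⟨fun r h1 h2 h3 => by simp [h1, h2, h3],
      fun a h => by simp [h], ?_⟩, by omega⟩
    exact walkOf_append (by simp) (by simp [step_zero])
  rw [hI] at hIk
  obtain ⟨t, ht, h45, hA, hk⟩ := hIk
  have hB₁ := hA.base hB
  have h7₁ := hA.reg7
  have hlen : (tab (t + 1) fun t => σ.arr 6 (step x y t)).length = t + 1 := by simp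
  rw [hlen] at h7₁
  have hbounds := step_bounds ht
  rw [holds_ne, h45, hA.reg ry hy7 hy45 hy46, hry]
  refine ⟨by omega, fun hne => ?_, fun heq => ?_⟩
  · have htlt : t < gap x y := lt_of_le_of_ne ht fun e => hne (by rw [e, step_gap])
    have hstep : ∀ z, z = step x y (t + 1) →
        6 ≤ k - 1 - 1 → wp W (block [ld 46 6 45, st 12 7 46, ad 7 7 3]) (k - 1 - 1 - 1)
          (σ₁.setReg 45 z) I := by
      intro z hz hk'
      simp only [wp_block_cons, wp_load, wp_store, wp_add, wp_block_nil, reg_setReg, arr_setReg,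
        reg_setArr, Nat.reduceEqDiff, if_true, if_false, hB₁.reg3]
      refine ⟨by omega, by omega, by omega, by omega, ?_⟩
      rw [hI]
      refine ⟨t + 1, htlt, by simp [hz], ?_, by omega⟩
      rw [tab_succ']
      refine hA.trans ⟨fun r h1 h2 h3 => by simp [h1, h2, h3], fun a h => by simp [h], ?_⟩
      exact walkOf_append (by simp) (by simp [hz, hA.arr 6])
    rw [wp_block_cons]
    simp only [wp_cond, holds_lt, wp_add, wp_sub, h45, hA.reg ry hy7 hy45 hy46, hry, hB₁.reg3]
    refine ⟨by omega, fun hlt => ⟨by omega, by omega, hstep _ ?_ (by omega)⟩,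
      fun hge => ⟨by omega, hstep _ ?_ (by omega)⟩⟩
    · unfold step gap at *; split_ifs at * <;> omega
    · unfold step gap at *; split_ifs at * <;> omega
  · rw [not_not] at heq
    obtain rfl : t = gap x y := by
      by_contra hne
      unfold step gap at *; split_ifs at * <;> omega
    refine wp_of_spec (wp_appendVertex hB₁ (by omega)) (by omega) fun k₂ σ₂ _ hA₂ => ?_
    rw [wp_block_nil]
    have := hA.trans hA₂
    rwa [hA.reg 4 (by decide) (by decide) (by decide)] at this

end RAM

/-! ### The walk in the presence of a gap. -/

namespace RAM

open NatGraph

variable {W n s Δ : ℕ} {nl : ℕ → List ℕ} {A₀ A₁ p : ℕ → ℕ} {σ : State}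

theorem StuckState.root_lt (h : StuckState n s nl A₀ A₁ p σ) : σ.reg 4 < n := by
  rw [h.last]
  exact h.path.lt _ h.path.one_le le_rfl

theorem StuckState.last_le (h : StuckState n s nl A₀ A₁ p σ) : σ.reg 5 ≤ size n nl :=
  (le_partSize (nl := nl) (fun k => σ.arr 6 (k + 1)) (σ.reg 5)).trans h.path.partSize_le

/-- Given a gap between the registers `43` and `44`, find the position of a third neighbour of the
last vertex of the path, in such a way that the three neighbours do not all have the same
colour. -/
def chooseThird : Program :=
  block [cp 47 2, ld 48 6 43, ld 48 4 48,
    forNbr 4 (block [ld 49 7 22, .cond (.eq 49 43) .skip (.cond (.eq 49 44) .skip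
      (block [ld 50 4 22, .cond (.eq 47 2) (cp 47 49) (.cond (.eq 50 48) .skip (cp 47 49))]))])]

/-- The result of `chooseThird`. -/
structure ThirdPost (nl : ℕ → List ℕ) (σ σ' : State) : Prop where
  reg : ∀ x, x < 20 ∨ 41 ≤ x ∧ x < 47 → σ'.reg x = σ.reg x
  arr : σ'.arr = σ.arr
  inner : Inner (σ.reg 5) (σ'.reg 47)
  mem : σ.arr 6 (σ'.reg 47) ∈ nl (σ.reg 4)
  ne : σ'.reg 47 ≠ σ.reg 43
  ne' : σ'.reg 47 ≠ σ.reg 44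
  col : ¬ (σ.arr 4 (σ.arr 6 (σ'.reg 47)) = σ.arr 4 (σ.arr 6 (σ.reg 43)) ∧
    σ.arr 4 (σ.arr 6 (σ.reg 44)) = σ.arr 4 (σ.arr 6 (σ.reg 43)))

/-- A candidate is replaced whenever a neighbour outside the two given positions differs in colour
from the one at register `43`. If none differs, the neighbour at register `44` must, because at
least two colours occur around a stuck vertex. -/
theorem wp_chooseThird (E : Env W n s nl A₀ A₁ p Δ) (h : StuckState n s nl A₀ A₁ p σ) :
    wp W chooseThird (20 * size n nl) σ fun _ σ' => ThirdPost nl σ σ' := by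
  have hG := E.inst.graph
  have hB := h.base
  have hdeg := length_lt_size (nl := nl) h.root_lt
  obtain ⟨i, hi⟩ : ∃ i, σ.reg 43 = i := ⟨_, rfl⟩
  obtain ⟨j, hj⟩ : ∃ j, σ.reg 44 = j := ⟨_, rfl⟩
  obtain ⟨r, hr⟩ : ∃ r, σ.reg 4 = r := ⟨_, rfl⟩
  obtain ⟨path, hpath⟩ : ∃ path, σ.arr 6 = path := ⟨_, rfl⟩
  obtain ⟨pos, hpos⟩ : ∃ pos, σ.arr 7 = pos := ⟨_, rfl⟩
  obtain ⟨col, hcol⟩ : ∃ col, σ.arr 4 = col := ⟨_, rfl⟩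
  have hpn : ∀ {u}, u ∈ nl r → Inner (σ.reg 5) (pos u) ∧ path (pos u) = u := fun {u} hu => by
    have := h.pos_nbr hG (hr ▸ hu)
    rwa [hpath, hpos] at this
  simp only [chooseThird, wp_block_cons, wp_copy, wp_load, reg_setReg, arr_setReg,
    Nat.reduceEqDiff, if_true, if_false, hB.reg2, hi, hpath, hcol]
  refine ⟨by omega, by omega, by omega, ?_⟩
  generalize hτ : State.setReg _ 48 _ = τ
  have hτB : Base n s A₀ A₁ p τ := by
    rw [← hτ]
    repeat' first | exact hB | refine Base.setReg ?_ (by decide)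
  have hτa : τ.arr = σ.arr := by rw [← hτ]; rfl
  have hτr : ∀ x, x < 20 ∨ 41 ≤ x ∧ x < 47 → τ.reg x = σ.reg x := fun x hx => by
    rw [← hτ]
    simp only [reg_setReg]
    rw [if_neg (by omega), if_neg (by omega), if_neg (by omega)]
  have hτ47 : τ.reg 47 = 0 := by rw [← hτ]; simp
  have hτ48 : τ.reg 48 = col (path i) := by rw [← hτ]; simp
  have hτ4 : τ.reg 4 = r := by rw [hτr 4 (by decide), hr]
  refine wp_of_spec (wp_forNbr E (T := 8) (fun pre σ' => σ'.arr = σ.arr ∧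
    (∀ x, x < 20 ∨ 41 ≤ x ∧ x < 47 → σ'.reg x = σ.reg x) ∧ σ'.reg 48 = col (path i) ∧
    (σ'.reg 47 = 0 ∧ (∀ u ∈ pre, pos u = i ∨ pos u = j) ∨
      ∃ u₀ ∈ nl r, σ'.reg 47 = pos u₀ ∧ pos u₀ ≠ i ∧ pos u₀ ≠ j ∧
        (col u₀ ≠ col (path i) ∨
          ∀ u ∈ pre, pos u = i ∨ pos u = j ∨ col u = col (path i))))
    hτB (by rw [hτ4, ← hr]; exact h.root_lt) (by decide) ?_ ?_)
    (by rw [hτ4, ← hr]; have := hdeg; omega) ?_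
  · intro a b c
    refine ⟨hτa, fun x hx => ?_, by simp [hτ48], Or.inl ⟨by simp [hτ47], by simp⟩⟩
    simp only [reg_setReg]
    rw [if_neg (by omega), if_neg (by omega), if_neg (by omega), hτr x hx]
  · rintro pre u suf σ' hps hB' ⟨ha, hreg, h48, hinv⟩
    rw [hτ4] at hps
    have hu : u ∈ nl r := by rw [hps]; simp
    have hupos := (hpn hu).1.one_le
    obtain ⟨J, hJ⟩ : ∃ J : State → Prop, J = fun σ'' => Base n s A₀ A₁ p σ'' ∧
      σ''.reg 20 = σ'.reg 20 ∧ σ''.reg 21 = σ'.reg 21 ∧ σ''.arr = σ.arr ∧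
      (∀ x, x < 20 ∨ 41 ≤ x ∧ x < 47 → σ''.reg x = σ.reg x) ∧ σ''.reg 48 = col (path i) ∧
      (σ''.reg 47 = 0 ∧ (∀ v ∈ pre ++ [u], pos v = i ∨ pos v = j) ∨
      ∃ u₀ ∈ nl r, σ''.reg 47 = pos u₀ ∧ pos u₀ ≠ i ∧ pos u₀ ≠ j ∧
        (col u₀ ≠ col (path i) ∨
          ∀ v ∈ pre ++ [u], pos v = i ∨ pos v = j ∨ col v = col (path i))) := ⟨_, rfl⟩
    refine wp_mono (Q := fun _ => J) ?_ ?_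
    · simp only [wp_block_cons, wp_load, wp_cond, wp_skip, wp_copy, wp_block_nil, holds_eq,
        reg_setReg, arr_setReg, Nat.reduceEqDiff, if_true, if_false, hB'.reg2, ha, hpos, hcol,
        hreg 43 (by decide), hreg 44 (by decide), hi, hj, h48]
      have hkeep : pos u = i ∨ pos u = j ∨ (σ'.reg 47 ≠ 0 ∧ col u = col (path i)) →
          (σ'.reg 47 = 0 ∧ (∀ v ∈ pre ++ [u], pos v = i ∨ pos v = j) ∨
          ∃ u₀ ∈ nl r, σ'.reg 47 = pos u₀ ∧ pos u₀ ≠ i ∧ pos u₀ ≠ j ∧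
          (col u₀ ≠ col (path i) ∨
          ∀ v ∈ pre ++ [u], pos v = i ∨ pos v = j ∨ col v = col (path i))) := by
        intro hd
        rcases hinv with ⟨h1, h2⟩ | ⟨u₀, h1, h2, h3, h4, h5⟩
        · left
          refine ⟨h1, fun x hx => ?_⟩
          rcases List.mem_append.1 hx with hx | hx
          · exact h2 x hx
          · obtain rfl := List.mem_singleton.1 hx
            rcases hd with hd | hd | ⟨hd, -⟩
            · exact Or.inl hd
            · exact Or.inr hd
            · exact absurd h1 hd
        · right
          refine ⟨u₀, h1, h2, h3, h4, h5.imp_right fun h5 x hx => ?_⟩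
          rcases List.mem_append.1 hx with hx | hx
          · exact h5 x hx
          · obtain rfl := List.mem_singleton.1 hx
            rcases hd with hd | hd | ⟨-, hd⟩
            · exact Or.inl hd
            · exact Or.inr (Or.inl hd)
            · exact Or.inr (Or.inr hd)
      have hframe : ∀ a : ℕ, ∀ x, x < 20 ∨ 41 ≤ x ∧ x < 47 →
          ((σ'.setReg 22 u).setReg 49 a).reg x = σ.reg x := fun a x hx => by
        simp only [reg_setReg]
        rw [if_neg (by omega), if_neg (by omega), hreg x hx]
      have hframe' : ∀ a b c : ℕ, ∀ x, x < 20 ∨ 41 ≤ x ∧ x < 47 →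
          ((((σ'.setReg 22 u).setReg 49 a).setReg 50 b).setReg 47 c).reg x = σ.reg x :=
        fun a b c x hx => by
          simp only [reg_setReg]
          rw [if_neg (by omega), if_neg (by omega), if_neg (by omega), if_neg (by omega), hreg x hx]
      have hframe'' : ∀ a b : ℕ, ∀ x, x < 20 ∨ 41 ≤ x ∧ x < 47 →
          (((σ'.setReg 22 u).setReg 49 a).setReg 50 b).reg x = σ.reg x := fun a b x hx => by
        simp only [reg_setReg]
        rw [if_neg (by omega), if_neg (by omega), if_neg (by omega), hreg x hx]
      rw [hJ]
      refine ⟨by omega, by omega, fun hui => ⟨?_, by simp, by simp, ha, hframe _, by simp [h48],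
        hkeep (Or.inl hui)⟩, fun hui => ⟨by omega, fun huj => ⟨?_, by simp, by simp, ha, hframe _,
        by simp [h48], hkeep (Or.inr (Or.inl huj))⟩, fun huj => ⟨by omega, by omega,
        fun h0 => ⟨by omega, ?_, by simp, by simp, ha, hframe' _ _ _, by simp [h48], Or.inr ?_⟩,
        fun h0 => ⟨by omega, fun hc => ⟨?_, by simp, by simp, ha, hframe'' _ _, by simp [h48],
          hkeep (Or.inr (Or.inr ⟨h0, hc⟩))⟩, fun hc => ⟨by omega, ?_, by simp, by simp, ha,
          hframe' _ _ _, by simp [h48], Or.inr ?_⟩⟩⟩⟩⟩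
      any_goals repeat' first | exact hB' | refine Base.setReg ?_ (by decide)
      · refine ⟨u, hu, by simp, hui, huj, ?_⟩
        by_cases hc : col u = col (path i)
        · right
          intro x hx
          rcases List.mem_append.1 hx with hx | hx
          · rcases hinv with ⟨-, h2⟩ | ⟨u₀, h1, h2, -⟩
            · exact (h2 x hx).imp_right Or.inl
            · have := (hpn h1).1.one_le
              omega
          · obtain rfl := List.mem_singleton.1 hx
            exact Or.inr (Or.inr hc)
        · exact Or.inl hc
      · exact ⟨u, hu, by simp, hui, huj, Or.inl hc⟩
    · intro _ σ'' _ hσ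
      rw [hJ] at hσ
      obtain ⟨h1, h2, h3, h4, h5, h6, h7⟩ := hσ
      refine ⟨h1, h2, h3, fun z => ⟨h4, fun x hx => ?_, by simp [h6], by simpa using h7⟩⟩
      rw [reg_setReg, if_neg (by omega), h5 x hx]
  · rintro k₁ σ₁ - ⟨hB₁, ha₁, hr₁, -, hinv⟩
    rw [hτ4] at hinv
    rw [wp_block_nil]
    have hlen := E.inst.length_eq h.stuck
    have h3 := E.inst.three_le
    rw [hr] at hlen
    rcases hinv with ⟨-, hall⟩ | ⟨u₀, h1, h2, h3, h4, h5⟩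
    · exfalso
      -- Without a third neighbour the stuck vertex would have degree at most two, contrary to `3 ≤
      -- Δ`.
      have hsub : (nl r).toFinset ⊆ {path i, path j} := by
        intro u hu
        have hu' := List.mem_toFinset.1 hu
        rw [Finset.mem_insert, Finset.mem_singleton, ← (hpn hu').2]
        exact (hall u hu').imp (fun e => by rw [e]) fun e => by rw [e]
      have := Finset.card_le_card hsub
      rw [List.toFinset_card_of_nodup (hG.nodup r)] at this
      have := Finset.card_le_two (a := path i) (b := path j)
      omega
    · refine ⟨hr₁, ha₁, ?_, ?_, by rwa [h2, hi], by rwa [h2, hj], ?_⟩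
      · rw [h2]; exact (hpn h1).1
      · rw [h2, hpath, hr, (hpn h1).2]; exact h1
      · rw [h2, hpath, hcol, hi, hj, (hpn h1).2]
        rintro ⟨e1, e2⟩
        rcases h5 with h5 | h5
        · exact h5 e1
        · have hst := h.stuck
          rw [hcol, hr] at hst
          obtain ⟨u, hu, hne⟩ := exists_col_ne E.inst hst (col (path i))
          have hpu := (hpn hu).2
          rcases h5 u hu with e | e | e
          · rw [e] at hpu; exact hne (by rw [hpu])
          · rw [e] at hpu; exact hne (by rw [← hpu, e2])
          · exact hne e

/-- The result of the construction of a walk. -/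
structure WalkPost (n s : ℕ) (nl : ℕ → List ℕ) (p : ℕ → ℕ) (σ σ' : State) : Prop where
  reg : ∀ x < 7, σ'.reg x = σ.reg x
  arr : ∀ a < 10, σ'.arr a = σ.arr a
  walk : IsWalkFrom nl (σ.reg 4) (walkOf σ')
  not_stuck : ¬ StuckAlong nl s p (σ.arr 4) (σ.reg 4) (walkOf σ')
  size_le : listSize nl (walkOf σ') ≤ 12 * size n nl

/-- All bounds refer to one fixed initial state and to the uniform length `L`, so that consecutive
segments can be appended by repeated use. -/
theorem wp_appendSeg_chain {k : ℕ} {Q : ℕ → State → Prop} (hB : Base n s A₀ A₁ p σ)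
    {w : List ℕ} {σ₁ : State} (hA : Appended w σ σ₁) {rx ry x y L : ℕ} (hrx : σ.reg rx = x)
    (hry : σ.reg ry = y) (hx : Inner L x) (hy : Inner L y) (hx' : 46 < rx ∨ rx < 7)
    (hy' : 46 < ry ∨ ry < 7) (hT : σ.reg 7 + w.length + L + 3 < W) (hk : 6 * L + 10 ≤ k)
    (hQ : ∀ k' σ', k ≤ k' + (6 * L + 10) →
      Appended (w ++ segWalk (σ.arr 6) (σ.reg 4) x y) σ σ' → Q k' σ') :
    wp W (appendSeg rx ry) k σ₁ Q := by
  obtain ⟨hx1, hx2⟩ := hx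
  obtain ⟨hy1, hy2⟩ := hy
  have hgap : gap x y ≤ L := by unfold gap; omega
  refine wp_of_spec (wp_appendSeg (x := x) (y := y) (hA.base hB)
    (by rw [hA.reg rx (by omega) (by omega) (by omega), hrx])
    (by rw [hA.reg ry (by omega) (by omega) (by omega), hry]) (by omega) (by omega) (by omega)
    (by omega) (by rw [hA.reg7]; omega)) (by omega) fun k' σ' hk' hA' => hQ k' σ' (by omega) ?_
  have := hA.trans hA'
  rwa [hA.arr 6 (by decide), hA.reg 4 (by decide) (by decide) (by decide)] at this

theorem length_segWalk {path : ℕ → ℕ} {L r x y : ℕ} (hx : Inner L x) (hy : Inner L y) :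
    (segWalk path r x y).length ≤ L + 1 := by
  obtain ⟨hx1, hx2⟩ := hx
  obtain ⟨hy1, hy2⟩ := hy
  simp [segWalk, gap]
  omega

/-- The walk that is used if there is a gap. -/
def gapWalk : Program :=
  block [chooseThird, cp 51 43, cp 52 44,
    .cond (.lt 44 47) (block [cp 51 44, cp 52 43]) .skip,
    ld 53 6 47, ld 53 4 53, ld 54 6 51, ld 54 4 54,
    .cond (.eq 53 54) (appendSeg 51 52) .skip,
    appendSeg 51 52, appendSeg 51 52, appendSeg 47 51, appendSeg 52 51]

/-- The third neighbour lies outside the gap, and the ear is oriented to start at the end of the gap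
nearer to it. -/
theorem wp_gapWalk (E : Env W n s nl A₀ A₁ p Δ) (h : StuckState n s nl A₀ A₁ p σ)
    (h7 : σ.reg 7 = 0) (hij : σ.reg 43 + 2 ≤ σ.reg 44) (h0 : σ.reg 43 ≠ 0)
    (hjL : σ.reg 44 < σ.reg 5) (hi : σ.arr 6 (σ.reg 43) ∈ nl (σ.reg 4))
    (hj : σ.arr 6 (σ.reg 44) ∈ nl (σ.reg 4))
    (hgap : ∀ q, σ.reg 43 < q → q < σ.reg 44 → σ.arr 6 q ∉ nl (σ.reg 4)) :
    wp W gapWalk (150 * size n nl) σ fun _ σ' => WalkPost n s nl p σ σ' := by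
  have hword := E.word
  have hG := E.inst.graph
  have hB := h.base
  have hLs := h.last_le
  have hone := h.path.one_le
  have hP := h.path
  have hhole := h.hole
  have hlast := h.last
  simp only [gapWalk, wp_block_cons]
  refine wp_of_spec (wp_chooseThird E h) (by omega) fun k₁ σ₁ hk₁ hT => ?_
  have hB₁ : Base n s A₀ A₁ p σ₁ :=
    hB.of_frame (fun x hx => hT.reg x (by omega)) fun a _ => by rw [hT.arr]
  obtain ⟨hin, hmem, hne, hne', hcol⟩ := hT.3, hT.4, hT.5, hT.6, hT.7
  have hi' := hT.reg 43 (by decide)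
  have hj' := hT.reg 44 (by decide)
  have h4' := hT.reg 4 (by decide)
  have h7' := hT.reg 7 (by decide)
  rw [h7] at h7'
  obtain ⟨i, hi₀⟩ : ∃ i, σ.reg 43 = i := ⟨_, rfl⟩
  obtain ⟨j, hj₀⟩ : ∃ j, σ.reg 44 = j := ⟨_, rfl⟩
  obtain ⟨t, ht₀⟩ : ∃ t, σ₁.reg 47 = t := ⟨_, rfl⟩
  obtain ⟨L, hL₀⟩ : ∃ L, σ.reg 5 = L := ⟨_, rfl⟩
  obtain ⟨path, hpath⟩ : ∃ path, σ.arr 6 = path := ⟨_, rfl⟩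
  obtain ⟨col, hcol₀⟩ : ∃ col, σ.arr 4 = col := ⟨_, rfl⟩
  have hroot : σ.reg 4 = path L := by rw [hlast, hpath, hL₀]
  simp only [hi₀, hj₀, hL₀, hpath, hcol₀, hroot] at hij h0 hjL hi hj hgap hLs hone hP hhole
  simp only [hi₀, hj₀, ht₀, hL₀, hpath, hcol₀, hroot] at hin hmem hne hne' hcol hi' hj' h4'
  have hii : Inner L i := ⟨by omega, by omega⟩
  have hjj : Inner L j := ⟨by omega, by omega⟩
  -- Both orientations are treated at once: `a` is the end of the gap nearer to the third position
  -- `t`, and `b` the other end.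
  have main : ∀ a b k (τ : State), Base n s A₀ A₁ p τ → τ.reg 51 = a → τ.reg 52 = b →
      τ.reg 47 = t → τ.reg 7 = 0 → τ.reg 4 = path L → τ.arr = σ.arr →
      (∀ x < 7, τ.reg x = σ.reg x) → Inner L a → Inner L b →
      (t < a ∧ a + 2 ≤ b ∨ b + 2 ≤ a ∧ a < t) → path a ∈ nl (path L) → path b ∈ nl (path L) →
      (∀ q, a < q ∧ q < b ∨ b < q ∧ q < a → path q ∉ nl (path L)) →
      ¬ (col (path t) = col (path a) ∧ col (path b) = col (path a)) → 120 * size n nl ≤ k →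
      wp W (block [ld 53 6 47, ld 53 4 53, ld 54 6 51, ld 54 4 54,
        .cond (.eq 53 54) (appendSeg 51 52) .skip,
        appendSeg 51 52, appendSeg 51 52, appendSeg 47 51, appendSeg 52 51]) k τ
        fun _ σ' => WalkPost n s nl p σ σ' := by
    intro a b k τ hτB h51 h52 h47 h7τ h4τ hτa hτr ha hb hord han hbn hgap' hcol' hk
    simp only [wp_block_cons, wp_load, reg_setReg, arr_setReg, Nat.reduceEqDiff, if_true, if_false,
      h47, h51, hτa, hpath, hcol₀]
    refine ⟨by omega, by omega, by omega, by omega, ?_⟩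
    generalize hυ : State.setReg _ 54 _ = υ
    have hυB : Base n s A₀ A₁ p υ := by
      rw [← hυ]
      repeat' first | exact hτB | refine Base.setReg ?_ (by decide)
    have hυa : υ.arr = σ.arr := by rw [← hυ]; exact hτa
    have hυr : ∀ x, x ≠ 53 → x ≠ 54 → υ.reg x = τ.reg x := fun x h1 h2 => by
      rw [← hυ]; simp [h1, h2]
    have hυ53 : υ.reg 53 = col (path t) := by rw [← hυ]; simp
    have hυ54 : υ.reg 54 = col (path a) := by rw [← hυ]; simp
    have hυ47 : υ.reg 47 = t := by rw [hυr 47 (by decide) (by decide), h47]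
    have hυ51 : υ.reg 51 = a := by rw [hυr 51 (by decide) (by decide), h51]
    have hυ52 : υ.reg 52 = b := by rw [hυr 52 (by decide) (by decide), h52]
    have hυ7 : υ.reg 7 = 0 := by rw [hυr 7 (by decide) (by decide), h7τ]
    have hυ4 : υ.reg 4 = path L := by rw [hυr 4 (by decide) (by decide), h4τ]
    have hυ6 : υ.arr 6 = path := by rw [hυa, hpath]
    have l1 := length_segWalk (path := path) (r := path L) ha hb
    have l2 := length_segWalk (path := path) (r := path L) hin ha
    have l3 := length_segWalk (path := path) (r := path L) hb ha
    obtain ⟨w₀, hw₀⟩ : ∃ w₀, w₀ = if col (path t) = col (path a) then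
      segWalk path (path L) a b else [] := ⟨_, rfl⟩
    have l0 : w₀.length ≤ L + 1 := by
      rw [hw₀]; split_ifs
      · exact l1
      · simp
    have hrest : ∀ k' σ', 100 * size n nl ≤ k' → Appended w₀ υ σ' →
        wp W (appendSeg 51 52) k' σ' fun k' σ' => wp W (appendSeg 51 52) k' σ' fun k' σ' =>
          wp W (appendSeg 47 51) k' σ' fun k' σ' => wp W (appendSeg 52 51) k' σ' fun k' σ' =>
          wp W (block []) k' σ' fun _ σ' => WalkPost n s nl p σ σ' := by
      intro k' σ' hk' hA
      refine wp_appendSeg_chain hυB hA hυ51 hυ52 ha hb (by decide) (by decide) (by omega)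
        (by omega) fun k₂ σ₂ hk₂ hA₂ => ?_
      rw [hυ6, hυ4] at hA₂
      refine wp_appendSeg_chain hυB hA₂ hυ51 hυ52 ha hb (by decide) (by decide)
        (by simp only [List.length_append]; omega) (by omega) fun k₃ σ₃ hk₃ hA₃ => ?_
      rw [hυ6, hυ4] at hA₃
      refine wp_appendSeg_chain hυB hA₃ hυ47 hυ51 hin ha (by decide) (by decide)
        (by simp only [List.length_append]; omega) (by omega) fun k₄ σ₄ hk₄ hA₄ => ?_
      rw [hυ6, hυ4] at hA₄
      refine wp_appendSeg_chain hυB hA₄ hυ52 hυ51 hb ha (by decide) (by decide)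
        (by simp only [List.length_append]; omega) (by omega) fun k₅ σ₅ hk₅ hA₅ => ?_
      rw [hυ6, hυ4] at hA₅
      rw [wp_block_nil]
      have hwalk : walkOf σ₅ = w₀ ++ (segWalk path (path L) a b ++ (segWalk path (path L) a b ++
          (segWalk path (path L) t a ++ segWalk path (path L) b a))) := by
        rw [hA₅.walk, walkOf, hυ7]
        simp [tab]
      have hnil : IsWalkFrom nl (path L) [] := trivial
      refine ⟨fun x hx => ?_, fun x hx => ?_, ?_, ?_, ?_⟩
      · rw [hA₅.reg x (by omega) (by omega) (by omega), hυr x (by omega) (by omega), hτr x hx]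
      · rw [hA₅.arr x (by omega), hυa]
      · rw [hwalk, hroot]
        have := isWalkFrom_segWalk_append hG hP ha hb han hbn
          (isWalkFrom_segWalk_append hG hP ha hb han hbn
            (isWalkFrom_segWalk_append hG hP hin ha hmem han
              (isWalkFrom_segWalk hG hP hb ha hbn han)))
        rw [hw₀]
        split_ifs
        · exact isWalkFrom_segWalk_append hG hP ha hb han hbn this
        · exact this
      · rw [hwalk, hroot, hcol₀, hw₀]
        exact not_stuckAlong_segWalk E.inst hP hhole ha hb hin hord han hbn hmem hgap' hcol'
      · rw [hwalk]
        simp only [listSize_append]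
        have s1 := listSize_segWalk hP ha hb
        have s2 := listSize_segWalk hP hin ha
        have s3 := listSize_segWalk hP hb ha
        have s0 : listSize nl w₀ ≤ 2 * size n nl := by
          rw [hw₀]; split_ifs
          · exact s1
          · simp [listSize]
        omega
    simp only [wp_cond, holds_eq, wp_skip, hυ53, hυ54]
    refine ⟨by omega, fun he => ?_, fun he => ?_⟩
    · refine wp_appendSeg_chain hυB (Appended.refl υ) hυ51 hυ52 ha hb (by decide) (by decide)
        (by simp; omega) (by omega) fun k' σ' hk' hA => hrest k' σ' (by omega) ?_
      rw [hυ6, hυ4] at hA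
      rw [hw₀, if_pos he]
      exact hA
    · refine hrest _ _ (by omega) ?_
      rw [hw₀, if_neg he]
      exact Appended.refl υ
  simp only [wp_block_cons] at main
  refine wp_copy.2 ⟨by omega, wp_copy.2 ⟨by omega, wp_cond.2 ⟨by omega, fun hlt => wp_block_cons.2
    (wp_copy.2 ⟨by omega, wp_block_cons.2 (wp_copy.2 ⟨by omega, wp_block_nil.2 ?_⟩)⟩),
    fun hge => wp_skip.2 ?_⟩⟩⟩
  · simp only [holds_lt, reg_setReg, Nat.reduceEqDiff, if_false, hj', ht₀] at hlt
    refine main j i _ _ ?_ (by simp [hj']) (by simp [hi']) (by simp [ht₀]) (by simp [h7']) (by simp [h4'])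
      hT.arr (fun x hx => ?_) hjj hii (by omega) hj hi (fun q hq => hgap q (by omega) (by omega))
      (fun hc => hcol ⟨hc.1.trans hc.2.symm, hc.2.symm⟩) (by omega)
    · repeat' first | exact hB₁ | refine Base.setReg ?_ (by decide)
    · simp only [reg_setReg]
      rw [if_neg (by omega), if_neg (by omega), if_neg (by omega), if_neg (by omega),
        hT.reg x (by omega)]
  · simp only [holds_lt, reg_setReg, Nat.reduceEqDiff, if_false, hj', ht₀] at hge
    -- The third position is neither an end of the gap nor above it, and there are no neighbours
    -- inside.
    have hti : t < i := by
      by_contra hlt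
      exact hgap t (by omega) (by omega) hmem
    refine main i j _ _ ?_ (by simp [hi']) (by simp [hj']) (by simp [ht₀]) (by simp [h7']) (by simp [h4'])
      hT.arr (fun x hx => ?_) hii hjj (by omega) hi hj (fun q hq => hgap q (by omega) (by omega))
      hcol (by omega)
    · repeat' first | exact hB₁ | refine Base.setReg ?_ (by decide)
    · simp only [reg_setReg]
      rw [if_neg (by omega), if_neg (by omega), hT.reg x (by omega)]

end RAM

/-! ### Searching for a diamond. -/

namespace RAM

open NatGraph

variable {W n s Δ : ℕ} {nl : ℕ → List ℕ} {A₀ A₁ p : ℕ → ℕ} {σ : State}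

/-- Write the content of register `c` into array `11` at the positions of the neighbours of the
vertex in register `r`. -/
def markNbrs (r c : ℕ) : Program := forNbr r (block [ld 49 7 22, st 11 49 c])

theorem wp_markNbrs (E : Env W n s nl A₀ A₁ p Δ) (hB : Base n s A₀ A₁ p σ) {r c v d : ℕ}
    (hr : 23 < r) (hc : c < 4) (hv : σ.reg r = v) (hvn : v < n) (hd : σ.reg c = d) :
    wp W (markNbrs r c) (5 * (nl v).length + 4) σ fun _ σ' =>
      (∀ x, x < 20 ∨ 49 < x ∨ x = 43 ∨ x = 44 → σ'.reg x = σ.reg x) ∧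
      (∀ a, a ≠ 11 → σ'.arr a = σ.arr a) ∧
      ∀ q, (σ'.arr 11 q = d ∧ ∃ u ∈ nl v, σ.arr 7 u = q) ∨
        (σ'.arr 11 q = σ.arr 11 q ∧ ∀ u ∈ nl v, σ.arr 7 u ≠ q) := by
  refine wp_of_spec (wp_forNbr E (T := 2) (fun pre σ' =>
    (∀ x, x < 20 ∨ 49 < x ∨ x = 43 ∨ x = 44 → σ'.reg x = σ.reg x) ∧
    (∀ a, a ≠ 11 → σ'.arr a = σ.arr a) ∧
    ∀ q, (σ'.arr 11 q = d ∧ ∃ u ∈ pre, σ.arr 7 u = q) ∨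
      (σ'.arr 11 q = σ.arr 11 q ∧ ∀ u ∈ pre, σ.arr 7 u ≠ q)) hB (by omega) (by omega) ?_ ?_)
    (by rw [hv]) fun k' σ' _ h => by rw [hv] at h; exact h.2
  · intro a b c
    refine ⟨fun x hx => ?_, by simp, by simp⟩
    simp only [reg_setReg]
    rw [if_neg (by omega), if_neg (by omega), if_neg (by omega)]
  · rintro pre u suf σ' hps hB' ⟨h1, h2, h3⟩
    simp only [wp_block_cons, wp_load, wp_store, wp_block_nil, reg_setReg, arr_setReg,
      Nat.reduceEqDiff, if_true, if_false, h2 7 (by decide)]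
    rw [if_neg (by omega), if_neg (by omega), h1 c (by omega), hd]
    refine ⟨by omega, by omega, ?_, by simp, by simp, fun z => ⟨fun x hx => ?_, fun a ha => ?_,
      fun q => ?_⟩⟩
    · repeat' first
        | exact hB' | refine Base.setReg ?_ (by decide) | refine Base.setArr ?_ (by decide)
    · simp only [reg_setReg, reg_setArr]
      rw [if_neg (by omega), if_neg (by omega), if_neg (by omega), h1 x hx]
    · simp [ha, h2 a ha]
    · simp only [arr_setReg, arr_setArr, if_true, Function.update_apply]
      split_ifs with hq
      · exact Or.inl ⟨rfl, u, by simp, hq.symm⟩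
      · rcases h3 q with ⟨e, v', hv', e'⟩ | ⟨e, hne⟩
        · exact Or.inl ⟨e, v', by simp [hv'], e'⟩
        · refine Or.inr ⟨e, fun x hx => ?_⟩
          rcases List.mem_append.1 hx with hx | hx
          · exact hne x hx
          · obtain rfl := List.mem_singleton.1 hx
            exact Ne.symm hq

/-- Look for two consecutive positions between register `44` and register `58`, different from
register `55`, exactly one of which is marked in array `11`; the marked one is left in
register `56`, the other one in register `57`. -/
def scanPairs : Program :=
  block [cp 60 44, .loop (.lt 60 58) (block [ad 61 60 3,
    .cond (.eq 60 55) .skip (.cond (.eq 61 55) .skip (block [ld 62 11 60, ld 63 11 61,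
      .cond (.eq 62 63) .skip (.cond (.eq 62 2) (block [cp 56 61, cp 57 60])
        (block [cp 56 60, cp 57 61]))])), cp 60 61])]

/-- The positions `u` and `w` are consecutive, and exactly the first one is marked. -/
structure MarkedPair (lo L b : ℕ) (mk : ℕ → ℕ) (u w : ℕ) : Prop where
  le_left : lo ≤ u
  lt_left : u < L
  le_right : lo ≤ w
  lt_right : w < L
  ne_right : w ≠ b
  next : u = w + 1 ∨ w = u + 1
  marked : mk u ≠ 0
  not_marked : mk w = 0

theorem wp_scanPairs (hB : Base n s A₀ A₁ p σ) {lo L b : ℕ} {mk : ℕ → ℕ} (h44 : σ.reg 44 = lo)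
    (h55 : σ.reg 55 = b) (h56 : σ.reg 56 = 0) (h58 : σ.reg 58 + 1 = L)
    (hloL : lo < L) (hLW : L < W) (hmk : σ.arr 11 = mk)
    (hle : ∀ q, mk q ≤ 1) :
    wp W scanPairs (11 * (L - lo) + 1) σ fun _ σ' => Base n s A₀ A₁ p σ' ∧ σ'.arr = σ.arr ∧
      (∀ x, x < 56 ∨ x = 58 ∨ x = 59 → σ'.reg x = σ.reg x) ∧
      (σ'.reg 56 = 0 ∧ (∀ q, lo ≤ q → q + 1 < L → q ≠ b → q + 1 ≠ b → mk q = mk (q + 1)) ∨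
        MarkedPair lo L b mk (σ'.reg 56) (σ'.reg 57)) := by
  simp only [scanPairs, wp_block_cons, wp_copy, h44]
  refine ⟨by omega, ?_⟩
  obtain ⟨I, hI⟩ : ∃ I : ℕ → State → Prop, I = fun k σ' => Base n s A₀ A₁ p σ' ∧ σ'.arr = σ.arr ∧
      (∀ x, x < 56 ∨ x = 58 ∨ x = 59 → σ'.reg x = σ.reg x) ∧ lo ≤ σ'.reg 60 ∧ σ'.reg 60 < L ∧
      11 * (L - σ'.reg 60) ≤ k ∧
      (σ'.reg 56 = 0 ∧ (∀ q, lo ≤ q → q < σ'.reg 60 → q ≠ b → q + 1 ≠ b → mk q = mk (q + 1)) ∨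
        MarkedPair lo L b mk (σ'.reg 56) (σ'.reg 57)) := ⟨_, rfl⟩
  refine wp_loop I ?_ fun k σ' hIk => ?_
  · rw [hI]
    refine ⟨hB.setReg (by decide), rfl, fun x hx => ?_, by simp, by simpa, by simp,
      Or.inl ⟨by simp [h56], fun q h1 h2 => ?_⟩⟩
    · rw [reg_setReg, if_neg (by omega)]
    · simp at h2; omega
  rw [hI] at hIk
  obtain ⟨hB', ha, hr, h1, h2, hk, hor⟩ := hIk
  rw [holds_lt, hr 58 (by decide)]
  refine ⟨by omega, fun hlt => ?_, fun hge => ?_⟩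
  · obtain ⟨q, hq⟩ : ∃ q, σ'.reg 60 = q := ⟨_, rfl⟩
    rw [hq] at h1 h2 hk hor hlt
    have hkeep : q = b ∨ q + 1 = b ∨ mk q = mk (q + 1) → (σ'.reg 56 = 0 ∧
        (∀ q', lo ≤ q' → q' < q + 1 → q' ≠ b → q' + 1 ≠ b → mk q' = mk (q' + 1)) ∨
        MarkedPair lo L b mk (σ'.reg 56) (σ'.reg 57)) := by
      intro hd
      refine hor.imp_left fun ⟨h, h'⟩ => ⟨h, fun q' e1 e2 e3 e4 => ?_⟩
      rcases Nat.lt_succ_iff_lt_or_eq.1 e2 with e | rfl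
      · exact h' q' e1 e e3 e4
      · rcases hd with hd | hd | hd
        · exact absurd hd e3
        · exact absurd hd e4
        · exact hd
    simp only [wp_block_cons, wp_add, wp_load, wp_copy, wp_cond, wp_skip, wp_block_nil, holds_eq,
      reg_setReg, arr_setReg, Nat.reduceEqDiff, if_true, if_false, hq, hB'.reg3, hB'.reg2,
      hr 55 (by decide), h55, ha, hmk]
    rw [hI]
    refine ⟨by omega, by omega, by omega, fun e => ⟨by omega, ?_, ha, fun x hx => ?_, by simp; omega,
      by simp; omega, by simp; omega, ?_⟩, fun e => ⟨by omega, fun e' => ⟨by omega, ?_, ha,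
      fun x hx => ?_, by simp; omega, by simp; omega, by simp; omega, ?_⟩, fun e' => ⟨by omega,
      by omega, by omega, fun em => ⟨by omega, ?_, ha, fun x hx => ?_, by simp; omega,
      by simp; omega, by simp; omega, ?_⟩, fun em => ⟨by omega, fun ez => ⟨by omega, by omega,
      by omega, ?_, ha, fun x hx => ?_, by simp; omega, by simp; omega, by simp; omega, ?_⟩,
      fun ez => ⟨by omega, by omega, by omega, ?_, ha, fun x hx => ?_, by simp; omega,
      by simp; omega, by simp; omega, ?_⟩⟩⟩⟩⟩
    any_goals (repeat' first | exact hB' | refine Base.setReg ?_ (by decide))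
    · simp only [reg_setReg]
      rw [if_neg (by omega), if_neg (by omega), hr x hx]
    · simpa using hkeep (Or.inl e)
    · simp only [reg_setReg]
      rw [if_neg (by omega), if_neg (by omega), hr x hx]
    · simpa using hkeep (Or.inr (Or.inl e'))
    · simp only [reg_setReg]
      rw [if_neg (by omega), if_neg (by omega), if_neg (by omega), if_neg (by omega), hr x hx]
    · simpa using hkeep (Or.inr (Or.inr em))
    · simp only [reg_setReg]
      rw [if_neg (by omega), if_neg (by omega), if_neg (by omega), if_neg (by omega),
        if_neg (by omega), if_neg (by omega), hr x hx]
    · right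
      simp only [reg_setReg, Nat.reduceEqDiff, if_true, if_false]
      exact ⟨by omega, by omega, by omega, by omega, e, by omega, fun h => em (by rw [ez, h]), ez⟩
    · simp only [reg_setReg]
      rw [if_neg (by omega), if_neg (by omega), if_neg (by omega), if_neg (by omega),
        if_neg (by omega), if_neg (by omega), hr x hx]
    · right
      simp only [reg_setReg, Nat.reduceEqDiff, if_true, if_false]
      have := hle q
      have := hle (q + 1)
      exact ⟨by omega, by omega, by omega, by omega, e', by omega, ez, by omega⟩
  · rw [wp_block_nil]
    refine ⟨hB', ha, hr, hor.imp_left fun ⟨h, h'⟩ => ⟨h, fun q e1 e2 => h' q e1 (by omega)⟩⟩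

/-- Find a neighbour of the last vertex of the path and two consecutive vertices of the path exactly
one of which is adjacent to that neighbour, when the neighbours of the last vertex occupy the
positions from register `44` on. -/
def findDiamond : Program :=
  block [cp 55 44, cp 56 2, sb 58 5 3, .loop (.eq 56 2) (block [ld 59 6 55, markNbrs 59 3,
    scanPairs, markNbrs 59 2, .cond (.eq 56 2) (ad 55 55 3) .skip])]

/-- The vertex `v` is adjacent to the last vertex of the path, and to exactly one of the vertices
at the consecutive positions `u` and `w`. -/
structure IsDiamond (nl : ℕ → List ℕ) (path : ℕ → ℕ) (L lo v u w : ℕ) : Prop where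
  vertex : ∃ b, path b = v
  mem : v ∈ nl (path L)
  le_left : lo ≤ u
  lt_left : u < L
  le_right : lo ≤ w
  lt_right : w < L
  next : u = w + 1 ∨ w = u + 1
  adj : path u ∈ nl v
  not_adj : path w ∉ nl v
  ne : path w ≠ v

/-- A scan without result shows that `path b` is adjacent to the whole segment, so its cost is
proportional to the degree of `path b`. Only the last, successful scan is not covered in this way,
and it costs at most a multiple of the length of the path. -/
theorem wp_findDiamond (E : Env W n s nl A₀ A₁ p Δ) (h : StuckState n s nl A₀ A₁ p σ) {lo : ℕ}
    (h44 : σ.reg 44 = lo) (hlo : 1 ≤ lo) (hloL : lo < σ.reg 5)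
    (hN : ∀ v, v ∈ nl (σ.reg 4) ↔ ∃ q, lo ≤ q ∧ q < σ.reg 5 ∧ σ.arr 6 q = v)
    (h11 : ∀ q, σ.arr 11 q = 0) :
    wp W findDiamond (60 * size n nl) σ fun _ σ' => (∀ x < 20, σ'.reg x = σ.reg x) ∧
      (∀ a, a ≠ 11 → σ'.arr a = σ.arr a) ∧
      IsDiamond nl (σ.arr 6) (σ.reg 5) lo (σ'.reg 59) (σ'.reg 56) (σ'.reg 57) := by
  have hword := E.word
  have hG := E.inst.graph
  have hB := h.base
  have hLs := h.last_le
  have hone := h.path.one_le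
  have hP := h.path
  have hlast := h.last
  have hdeg := E.inst.length_eq h.stuck
  obtain ⟨L, hL⟩ : ∃ L, σ.reg 5 = L := ⟨_, rfl⟩
  obtain ⟨path, hpath⟩ : ∃ path, σ.arr 6 = path := ⟨_, rfl⟩
  obtain ⟨pos, hpos⟩ : ∃ pos, σ.arr 7 = pos := ⟨_, rfl⟩
  have hroot : σ.reg 4 = path L := by rw [hlast, hpath, hL]
  rw [hroot] at hdeg hN
  rw [hL] at hloL hLs hone hP hN ⊢
  rw [hpath] at hP hN ⊢
  rw [hpos] at hP
  have hps : ∀ b, lo ≤ b → b ≤ L → partSize nl (fun t => path (lo + t)) (b - lo) ≤ size n nl :=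
    fun b h1 h2 => partSize_le (fun t ht => hP.lt _ (by omega) (by omega)) fun t ht t' ht' e => by
      have := hP.inj (by omega) (by omega) (by omega) (by omega) e
      omega
  simp only [findDiamond, wp_block_cons, wp_copy, wp_sub, reg_setReg, Nat.reduceEqDiff, if_false,
    h44, hB.reg2, hB.reg3, hL]
  refine ⟨by omega, by omega, by omega, ?_⟩
  obtain ⟨I, hI⟩ : ∃ I : ℕ → State → Prop, I = fun k σ' => Base n s A₀ A₁ p σ' ∧
      (∀ x, x < 20 ∨ x = 44 → σ'.reg x = σ.reg x) ∧ σ'.reg 58 = L - 1 ∧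
      (∀ a, a ≠ 11 → σ'.arr a = σ.arr a) ∧ (∀ q, σ'.arr 11 q = 0) ∧
      (σ'.reg 56 = 0 ∧ lo ≤ σ'.reg 55 ∧
        (∀ b, lo ≤ b → b < σ'.reg 55 → ∀ q, lo ≤ q → q < L → q ≠ b → path q ∈ nl (path b)) ∧
        50 * size n nl + 5 ≤
          k + 22 * partSize nl (fun t => path (lo + t)) (σ'.reg 55 - lo) ∨
        σ'.reg 56 ≠ 0 ∧ 1 ≤ k ∧
          IsDiamond nl path L lo (σ'.reg 59) (σ'.reg 56) (σ'.reg 57)) := ⟨_, rfl⟩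
  refine wp_loop I ?_ fun k σ' hIk => ?_
  · rw [hI]
    refine ⟨?_, fun x hx => ?_, by simp, fun a _ => rfl, h11, Or.inl ⟨by simp, by simp,
      fun b h1 h2 => ?_, by simp [partSize]; omega⟩⟩
    · repeat' first | exact hB | refine Base.setReg ?_ (by decide)
    · simp only [reg_setReg]
      rw [if_neg (by omega), if_neg (by omega), if_neg (by omega)]
    · simp at h2
      omega
  rw [hI] at hIk
  obtain ⟨hB', hr', h58', ha', h11', hor⟩ := hIk
  rw [holds_eq, hB'.reg2]
  rcases hor with ⟨h56, hlob, hcl, hk⟩ | ⟨h56, hk, hD⟩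
  swap
  · refine ⟨hk, fun e => absurd e h56, fun _ => ?_⟩
    rw [wp_block_nil]
    exact ⟨fun x hx => hr' x (Or.inl hx), ha', hD⟩
  obtain ⟨b, hb⟩ : ∃ b, σ'.reg 55 = b := ⟨_, rfl⟩
  rw [hb] at hlob hcl hk
  -- Running past the segment would show that the neighbours of the last vertex form a clique.
  have hbL : b < L := by
    by_contra hge
    exact not_clique E.inst hP hlo hloL.le hdeg hN fun b' h1 h2 => hcl b' h1 (by omega)
  have hps' := hps (b + 1) (by omega) hbL
  rw [show b + 1 - lo = b - lo + 1 by omega, partSize_succ, show lo + (b - lo) = b by omega] at hps'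
  have hbn : path b ∈ nl (path L) := (hN _).2 ⟨b, hlob, hbL, rfl⟩
  refine ⟨by omega, fun _ => ?_, fun e => absurd h56 e⟩
  simp only [wp_block_cons, wp_load, hb, ha' 6 (by decide), hpath]
  refine ⟨by omega, ?_⟩
  refine wp_of_spec (wp_markNbrs E (v := path b) (d := 1) (hB'.setReg (by decide)) (by decide)
    (by decide) (by simp) (hP.lt b (by omega) hbL.le) (by simpa using hB'.reg3)) (by omega) ?_
  rintro k₁ σ₁ hk₁ ⟨hr₁, ha₁, hm₁⟩
  have hB₁ : Base n s A₀ A₁ p σ₁ := (hB'.setReg (x := 59) (v := path b) (by decide)).of_frame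
    (fun x hx => hr₁ x (by omega)) fun a _ => ha₁ a (by omega)
  simp only [arr_setReg, ha' 7 (by decide), hpos, h11'] at hm₁
  have hmk1 : ∀ q, σ₁.arr 11 q ≤ 1 := fun q => by
    rcases hm₁ q with ⟨e, -⟩ | ⟨e, -⟩ <;> omega
  have hmk : ∀ q, 1 ≤ q → q ≤ L → (σ₁.arr 11 q ≠ 0 ↔ path q ∈ nl (path b)) := by
    intro q h1 h2
    rcases hm₁ q with ⟨e, u, hu, he⟩ | ⟨e, hne⟩
    · refine iff_of_true (by omega) ?_
      obtain ⟨-, h3⟩ := hP.path_pos u (by omega)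
      rwa [← he, h3]
    · refine iff_of_false (by omega) fun hmem => hne _ hmem (hP.pos_path q h1 h2)
  refine wp_of_spec (wp_scanPairs hB₁ (L := L) (mk := σ₁.arr 11) (b := b)
    (by rw [hr₁ 44 (by decide), reg_setReg, if_neg (by decide), hr' 44 (by decide), h44])
    (by rw [hr₁ 55 (by decide), reg_setReg, if_neg (by decide), hb])
    (by rw [hr₁ 56 (by decide), reg_setReg, if_neg (by decide), h56])
    (by rw [hr₁ 58 (by decide), reg_setReg, if_neg (by decide), h58']; omega)
    hloL (by omega) rfl hmk1) (by omega) ?_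
  rintro k₂ σ₂ hk₂ ⟨hB₂, ha₂, hr₂, hor₂⟩
  have h59 : σ₂.reg 59 = path b := by rw [hr₂ 59 (by decide), hr₁ 59 (by decide)]; simp
  refine wp_of_spec (wp_markNbrs E (v := path b) (d := 0) hB₂ (by decide)
    (by decide) h59 (hP.lt b (by omega) hbL.le) hB₂.reg2) (by omega) ?_
  rintro k₃ σ₃ hk₃ ⟨hr₃, ha₃, hm₃⟩
  have hB₃ : Base n s A₀ A₁ p σ₃ := hB₂.of_frame
    (fun x hx => hr₃ x (by omega)) fun a _ => ha₃ a (by omega)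
  have ha₃' : ∀ a, a ≠ 11 → σ₃.arr a = σ.arr a := fun a h => by
    rw [ha₃ a h, ha₂, ha₁ a h, arr_setReg, ha' a h]
  have hr₃' : ∀ x, x < 20 ∨ x = 44 → σ₃.reg x = σ.reg x := fun x hx => by
    rw [hr₃ x (by omega), hr₂ x (by omega), hr₁ x (by omega), reg_setReg, if_neg (by omega),
      hr' x hx]
  have h58₃ : σ₃.reg 58 = L - 1 := by
    rw [hr₃ 58 (by decide), hr₂ 58 (by decide), hr₁ 58 (by decide), reg_setReg,
      if_neg (by decide), h58']
  have h55₃ : σ₃.reg 55 = b := by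
    rw [hr₃ 55 (by decide), hr₂ 55 (by decide), hr₁ 55 (by decide), reg_setReg,
      if_neg (by decide), hb]
  -- The second marking writes `0` at exactly the positions marked before, so array `11` is clear
  -- for the next round.
  have h11₃ : ∀ q, σ₃.arr 11 q = 0 := fun q => by
    have h7 : σ₂.arr 7 = pos := by rw [ha₂, ha₁ 7 (by decide), arr_setReg, ha' 7 (by decide), hpos]
    rcases hm₃ q with ⟨e, -⟩ | ⟨e, hne⟩
    · exact e
    · rw [h7] at hne
      rw [e, ha₂]
      rcases hm₁ q with ⟨-, u, hu, he⟩ | ⟨e', -⟩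
      · exact absurd he (hne u hu)
      · exact e'
  have h56₃ := hr₃ 56 (by decide)
  have h57₃ := hr₃ 57 (by decide)
  have h59₃ := hr₃ 59 (by decide)
  rw [h59] at h59₃
  simp only [wp_block_nil, wp_cond, wp_skip, wp_add, holds_eq, hB₃.reg2, hB₃.reg3, h56₃, h55₃]
  rcases hor₂ with ⟨h0, hall⟩ | hpair
  · have hadj := adj_of_scan hG hP hlo hlob hbL fun q e1 e2 e3 e4 => by
      rw [← hmk q (by omega) (by omega), ← hmk (q + 1) (by omega) (by omega), hall q e1 e2 e3 e4]
    have hsub := sub_le_length hG hP hlo hlob hbL hbn hadj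
    refine ⟨by omega, fun _ => ⟨by omega, by omega, ?_⟩, fun e => absurd h0 e⟩
    rw [hI]
    refine ⟨hB₃.setReg (by decide), fun x hx => ?_, by simpa, ha₃', h11₃, Or.inl ⟨?_, ?_,
      fun b' e1 e2 => ?_, ?_⟩⟩
    · rw [reg_setReg, if_neg (by omega), hr₃' x hx]
    · simpa using h56₃.trans h0
    · simp; omega
    · simp only [reg_setReg, if_true] at e2
      rcases Nat.lt_succ_iff_lt_or_eq.1 e2 with e2 | rfl
      · exact hcl b' e1 e2
      · exact hadj
    · simp only [reg_setReg, if_true]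
      rw [show b + 1 - lo = b - lo + 1 by omega, partSize_succ, show lo + (b - lo) = b by omega]
      omega
  · obtain ⟨e1, e2, e3, e4, e5, e6, e7, e8⟩ := hpair
    refine ⟨by omega, fun e => by omega, fun e => ?_⟩
    rw [hI]
    refine ⟨hB₃, hr₃', h58₃, ha₃', h11₃, Or.inr ⟨by omega, by omega, ?_⟩⟩
    rw [h59₃, h56₃, h57₃]
    refine ⟨⟨b, rfl⟩, hbn, e1, e2, e3, e4, e6, (hmk _ (by omega) (by omega)).1 e7,
      fun hmem => (hmk _ (by omega) (by omega)).2 hmem e8, fun e => e5 ?_⟩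
    exact hP.inj (by omega) (by omega) (by omega) (by omega) e

end RAM

/-! ### The walk around a diamond and the choice of the walk. -/

namespace RAM

open NatGraph

variable {W n s Δ : ℕ} {nl : ℕ → List ℕ} {A₀ A₁ p : ℕ → ℕ} {σ : State}

theorem wp_appendVertices (hB : Base n s A₀ A₁ p σ) (rs : List ℕ)
    (hrs : ∀ r ∈ rs, r ≠ 7 ∧ r ≠ 45 ∧ r ≠ 46) (hT : σ.reg 7 + rs.length < W) :
    wp W (block (rs.map appendVertex)) (2 * rs.length) σ fun _ σ' =>
      Appended (rs.map σ.reg) σ σ' := by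
  induction rs generalizing σ with
  | nil => exact wp_block_nil.2 (Appended.refl σ)
  | cons r rs ih =>
    simp only [List.length_cons] at hT ⊢
    rw [List.map_cons, wp_block_cons]
    refine wp_of_spec (wp_appendVertex hB (r := r) (by omega)) (by omega) fun k σ₁ hk hA => ?_
    have h7 := hA.reg7
    simp only [List.length_singleton] at h7
    refine wp_of_spec (ih (hA.base hB) (fun r hr => hrs r (by simp [hr])) (by omega)) (by omega)
      fun _ σ₂ _ hA₂ => ?_
    have := hA.trans hA₂
    rwa [List.map_congr_left (g := σ.reg) fun r hr => by
      obtain ⟨h1, h2, h3⟩ := hrs r (by simp [hr])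
      exact hA.reg r h1 h2 h3] at this

/-- Find the position of a neighbour of the last vertex of the path whose colour is different from
the content of register `68`. -/
def chooseFar : Program :=
  forNbr 4 (block [ld 50 4 22, .cond (.eq 50 68) .skip (ld 69 7 22)])

theorem wp_chooseFar (E : Env W n s nl A₀ A₁ p Δ) (h : StuckState n s nl A₀ A₁ p σ) :
    wp W chooseFar (10 * size n nl) σ fun _ σ' =>
      (∀ x, x < 20 ∨ 50 < x ∧ x < 69 → σ'.reg x = σ.reg x) ∧ σ'.arr = σ.arr ∧
      ∃ u ∈ nl (σ.reg 4), σ'.reg 69 = σ.arr 7 u ∧ σ.arr 4 u ≠ σ.reg 68 := by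
  have hdeg := length_lt_size (nl := nl) h.root_lt
  have hB := h.base
  refine wp_of_spec (wp_forNbr E (T := 3) (fun pre σ' =>
    (∀ x, x < 20 ∨ 50 < x ∧ x < 69 → σ'.reg x = σ.reg x) ∧ σ'.arr = σ.arr ∧
      ((∀ u ∈ pre, σ.arr 4 u = σ.reg 68) ∨
        ∃ u ∈ nl (σ.reg 4), σ'.reg 69 = σ.arr 7 u ∧ σ.arr 4 u ≠ σ.reg 68))
    hB h.root_lt (by decide) ?_ ?_) (by omega) ?_
  · intro a b c
    refine ⟨fun x hx => ?_, by simp, by simp⟩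
    simp only [reg_setReg]
    rw [if_neg (by omega), if_neg (by omega), if_neg (by omega)]
  · rintro pre u suf σ' hps hB' ⟨h1, h2, h3⟩
    simp only [wp_block_cons, wp_load, wp_cond, wp_skip, wp_block_nil, holds_eq, reg_setReg,
      arr_setReg, Nat.reduceEqDiff, if_true, if_false, h2, h1 68 (by decide)]
    refine ⟨by omega, by omega, fun e => ⟨?_, by simp, by simp, fun z => ⟨fun x hx => ?_, trivial, ?_⟩⟩,
      fun e => ⟨by omega, ?_, by simp, by simp, fun z => ⟨fun x hx => ?_, trivial, Or.inr
        ⟨u, by rw [hps]; simp, by simp, e⟩⟩⟩⟩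
    any_goals (repeat' first | exact hB' | refine Base.setReg ?_ (by decide))
    · rw [if_neg (by omega), if_neg (by omega), if_neg (by omega), h1 x hx]
    · refine h3.imp_left fun h3 x hx => ?_
      rcases List.mem_append.1 hx with hx | hx
      · exact h3 x hx
      · obtain rfl := List.mem_singleton.1 hx
        exact e
    · rw [if_neg (by omega), if_neg (by omega), if_neg (by omega), if_neg (by omega), h1 x hx]
  · rintro k₁ σ₁ - ⟨-, h1, h2, h3⟩
    refine ⟨h1, h2, h3.resolve_left fun h3 => ?_⟩
    obtain ⟨u, hu, hne⟩ := exists_col_ne E.inst h.stuck (σ.reg 68)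
    exact hne (h3 u hu)

/-- The walk that is used if there is no gap. -/
def diamondProgram : Program :=
  block [ld 64 6 56, ld 65 6 57, ld 66 4 64, ld 67 4 65, ld 68 4 59,
    .cond (.eq 66 68) (.cond (.eq 67 68) (block [chooseFar, appendSeg 69 56]) .skip) .skip,
    block ([59, 4, 65, 64, 59, 4, 65, 64, 59].map appendVertex)]

/-- Only if `u`, `v`, `w` share a colour is a feeding segment put in front; it starts at a neighbour
of the last vertex with a different colour. -/
theorem wp_diamondProgram (E : Env W n s nl A₀ A₁ p Δ) (h : StuckState n s nl A₀ A₁ p σ) {lo : ℕ}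
    (h7 : σ.reg 7 = 0) (hlo : 1 ≤ lo)
    (hD : IsDiamond nl (σ.arr 6) (σ.reg 5) lo (σ.reg 59) (σ.reg 56) (σ.reg 57))
    (hN : ∀ q, lo ≤ q → q < σ.reg 5 → σ.arr 6 q ∈ nl (σ.reg 4)) :
    wp W diamondProgram (60 * size n nl) σ fun _ σ' => WalkPost n s nl p σ σ' := by
  have hword := E.word
  have hG := E.inst.graph
  have hB := h.base
  have hLs := h.last_le
  have hone := h.path.one_le
  have hP := h.path
  have hlast := h.last
  have hhole := h.hole
  obtain ⟨L, hL⟩ : ∃ L, σ.reg 5 = L := ⟨_, rfl⟩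
  obtain ⟨path, hpath⟩ : ∃ path, σ.arr 6 = path := ⟨_, rfl⟩
  obtain ⟨col, hcol⟩ : ∃ col, σ.arr 4 = col := ⟨_, rfl⟩
  obtain ⟨v, hv⟩ : ∃ v, σ.reg 59 = v := ⟨_, rfl⟩
  obtain ⟨u, hu⟩ : ∃ u, σ.reg 56 = u := ⟨_, rfl⟩
  obtain ⟨w, hw⟩ : ∃ w, σ.reg 57 = w := ⟨_, rfl⟩
  have hroot : σ.reg 4 = path L := by rw [hlast, hpath, hL]
  simp only [hL, hpath, hcol, hv, hu, hw, hroot] at hD hN hLs hone hP hhole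
  have hD' := hD
  obtain ⟨⟨b, hbv⟩, hvr, d1, d2, d3, d4, hnext, huv, hwv, hwv'⟩ := hD'
  have hun := hN u d1 d2
  have hwn := hN w d3 d4
  have hui : Inner L u := ⟨by omega, d2⟩
  have hwi : Inner L w := ⟨by omega, d4⟩
  have huw : path u ∈ nl (path w) :=
    hP.adj_of hG (by omega) (by omega) (by omega) (by omega) hnext
  have hdw := isWalkFrom_diamondWalk hG hvr hwn huw huv
  have hsz : listSize nl (diamondWalk (path L) (path u) v (path w)) ≤ 9 * size n nl := by
    have s1 := length_lt_size (nl := nl) (hG.lt hvr)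
    have s2 := length_lt_size (nl := nl) (hG.lt hun)
    have s3 := length_lt_size (nl := nl) (hG.lt hwn)
    have s4 := length_lt_size (nl := nl) (hP.lt L hone le_rfl)
    simp [listSize, diamondWalk]
    omega
  simp only [diamondProgram, wp_block_cons, wp_load, reg_setReg, arr_setReg, Nat.reduceEqDiff,
    if_true, if_false, hu, hw, hv, hpath, hcol]
  refine ⟨by omega, by omega, by omega, by omega, by omega, ?_⟩
  generalize hυ : State.setReg _ 68 _ = υ
  have hυr : ∀ x < 64, υ.reg x = σ.reg x := fun x hx => by
    rw [← hυ]
    simp only [reg_setReg]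
    rw [if_neg (by omega), if_neg (by omega), if_neg (by omega), if_neg (by omega),
      if_neg (by omega)]
  have hυa : υ.arr = σ.arr := by rw [← hυ]; rfl
  have h64 : υ.reg 64 = path u := by rw [← hυ]; simp
  have h65 : υ.reg 65 = path w := by rw [← hυ]; simp
  have h66 : υ.reg 66 = col (path u) := by rw [← hυ]; simp
  have h67 : υ.reg 67 = col (path w) := by rw [← hυ]; simp
  have h68 : υ.reg 68 = col v := by rw [← hυ]; simp
  clear hυ
  have hυS : StuckState n s nl A₀ A₁ p υ :=
    h.of_frame (fun x hx => hυr x (by omega)) fun a _ => by rw [hυa]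
  -- The common ending of all branches; `w₀` is the feeding segment or empty.
  have hrest : ∀ k τ w₀, 20 ≤ k → (∀ x, x < 7 ∨ x = 59 ∨ x = 64 ∨ x = 65 → τ.reg x = υ.reg x) →
      (∀ a < 10, τ.arr a = σ.arr a) → walkOf τ = w₀ → w₀.length ≤ L + 1 →
      IsWalkFrom nl (path L) (w₀ ++ diamondWalk (path L) (path u) v (path w)) →
      ¬ StuckAlong nl s p col (path L) (w₀ ++ diamondWalk (path L) (path u) v (path w)) →
      listSize nl w₀ ≤ 2 * size n nl →
      wp W (block ([59, 4, 65, 64, 59, 4, 65, 64, 59].map appendVertex)) k τ fun k' σ' =>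
        wp W (block []) k' σ' fun _ σ' => WalkPost n s nl p σ σ' := by
    intro k τ w₀ hk hτr hτa hτw hlen hwalk hns hls
    have hτB : Base n s A₀ A₁ p τ := hυS.base.of_frame (fun x hx => hτr x (by omega)) fun a _ => by
      rw [hτa a (by omega), hυa]
    have hτ7 : τ.reg 7 = w₀.length := by rw [← length_walkOf, hτw]
    refine wp_of_spec (wp_appendVertices hτB _ (by decide) (by simp; omega)) (by simpa using by omega)
      fun k' σ' _ hA => ?_
    rw [wp_block_nil]
    have hwσ : walkOf σ' = w₀ ++ diamondWalk (path L) (path u) v (path w) := by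
      rw [hA.walk, hτw]
      simp only [List.map_cons, List.map_nil, diamondWalk, hτr 59 (by decide), hτr 4 (by decide),
        hτr 64 (by decide), hτr 65 (by decide), h64, h65, hυr 59 (by decide), hυr 4 (by decide),
        hv, hroot]
    refine ⟨fun x hx => ?_, fun a ha => ?_, ?_, ?_, ?_⟩
    · rw [hA.reg x (by omega) (by omega) (by omega), hτr x (by omega), hυr x (by omega)]
    · rw [hA.arr a (by omega), hτa a ha]
    · rwa [hwσ, hroot]
    · rwa [hwσ, hroot, hcol]
    · rw [hwσ, listSize_append]
      omega
  have hrest' : ∀ k, 20 ≤ k → ¬ (col (path u) = col v ∧ col (path w) = col v) →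
      wp W (block ([59, 4, 65, 64, 59, 4, 65, 64, 59].map appendVertex)) k υ fun k' σ' =>
        wp W (block []) k' σ' fun _ σ' => WalkPost n s nl p σ σ' := fun k hk hne =>
    hrest k υ [] hk (fun _ _ => rfl) (fun a _ => by rw [hυa])
      (by rw [walkOf, hυr 7 (by decide), h7]; rfl) (by simp) hdw
      (E.inst.not_stuckAlong_diamond hvr hun hwn huw huv hwv hwv' hhole hne) (by simp [listSize])
  simp only [wp_cond, wp_skip, holds_eq, h66, h67, h68]
  refine ⟨by omega, fun e1 => ⟨by omega, fun e2 => ?_, fun e2 => hrest' _ (by omega)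
    fun e => e2 e.2⟩, fun e1 => hrest' _ (by omega) fun e => e1 e.1⟩
  simp only [wp_block_cons]
  refine wp_of_spec (wp_chooseFar E hυS) (by omega) ?_
  rintro k₁ σ₁ hk₁ ⟨hr₁, ha₁, g, hg, h69, hcg⟩
  have hgpos := hυS.pos_nbr hG hg
  rw [hυr 5 (by decide), hL, hυa, hpath] at hgpos
  rw [hυa] at h69 hcg
  obtain ⟨hgi, hgp⟩ := hgpos
  rw [← h69] at hgi hgp
  rw [hυr 4 (by decide), hroot] at hg
  rw [hcol, h68] at hcg
  obtain ⟨y, hy⟩ : ∃ y, σ₁.reg 69 = y := ⟨_, rfl⟩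
  rw [hy] at hgi hgp
  subst hgp
  have hB₁ : Base n s A₀ A₁ p σ₁ := hυS.base.of_frame (fun x hx => hr₁ x (by omega)) fun a _ => by
    rw [ha₁]
  have hw₁ : walkOf σ₁ = [] := by rw [walkOf, hr₁ 7 (by decide), hυr 7 (by decide), h7]; rfl
  have hlen := length_segWalk (path := path) (r := path L) hgi hui
  refine wp_appendSeg_chain hB₁ (Appended.refl σ₁) hy
    (by rw [hr₁ 56 (by decide), hυr 56 (by decide), hu]) hgi hui (by decide) (by decide)
    (by rw [hr₁ 7 (by decide), hυr 7 (by decide), h7]; simp; omega) (by omega)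
    fun k₂ σ₂ hk₂ hA => ?_
  rw [wp_block_nil]
  rw [List.nil_append, ha₁, hυa, hpath, hr₁ 4 (by decide), hυr 4 (by decide), hroot] at hA
  subst hbv
  refine hrest k₂ σ₂ _ (by omega) (fun x hx => ?_) (fun a ha => ?_)
    (by rw [hA.walk, hw₁, List.nil_append]) hlen (isWalkFrom_segWalk_append hG hP hgi hui hg hun hdw)
    (not_stuckAlong_segWalk_diamond E.inst hP hhole hui hwi hgi hnext hvr hun hwn hg huv hwv hwv'
      e1 e2 hcg) (listSize_segWalk hP hgi hui)
  · rw [hA.reg x (by omega) (by omega) (by omega), hr₁ x (by omega)]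
  · rw [hA.arr a (by omega), ha₁, hυa]

/-- Construct a walk along which the hole can be moved to a vertex that can be coloured. -/
def buildWalk : Program :=
  block [findGap, .cond (.eq 43 2) (block [findDiamond, diamondProgram]) gapWalk]

theorem WalkPost.of_frame {σ₁ σ₂ : State} (h : WalkPost n s nl p σ₁ σ₂)
    (hr : ∀ x < 7, σ₁.reg x = σ.reg x) (ha : ∀ a < 10, σ₁.arr a = σ.arr a) :
    WalkPost n s nl p σ σ₂ := by
  obtain ⟨h1, h2, h3, h4, h5⟩ := h
  rw [hr 4 (by decide)] at h3 h4
  rw [ha 4 (by decide)] at h4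
  exact ⟨fun x hx => (h1 x hx).trans (hr x hx), fun a hx => (h2 a hx).trans (ha a hx), h3, h4, h5⟩

theorem wp_buildWalk (E : Env W n s nl A₀ A₁ p Δ) (h : StuckState n s nl A₀ A₁ p σ)
    (h7 : σ.reg 7 = 0) (h10 : ∀ q, σ.arr 10 q = 0) (h11 : ∀ q, σ.arr 11 q = 0) :
    wp W buildWalk (190 * size n nl) σ fun _ σ' => WalkPost n s nl p σ σ' := by
  have hG := E.inst.graph
  have hLs := h.last_le
  have hone := h.path.one_le
  simp only [buildWalk, wp_block_cons, wp_cond, wp_block_nil, holds_eq]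
  refine wp_of_spec (wp_findGap E h h10) (by omega) fun k₁ σ₁ hk₁ hT => ?_
  have hS : StuckState n s nl A₀ A₁ p σ₁ :=
    h.of_frame (fun x hx => hT.reg x (by omega)) fun a ha => hT.arr a (by omega)
  have hr5 := hT.reg 5 (by decide)
  have hr4 := hT.reg 4 (by decide)
  have ha6 := hT.arr 6 (by decide)
  have h7' := (hT.reg 7 (by decide)).trans h7
  obtain ⟨-, -, hlt, hltL, habove, hbet, hbelow⟩ := id hT
  rw [← hr5] at hltL habove
  rw [← hr4, ← ha6] at habove hbet hbelow
  rw [hS.base.reg2]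
  refine ⟨by omega, fun h0 => ?_, fun h0 => ?_⟩
  · rw [h0] at hlt hbet
    -- No neighbour lies strictly between position `0` and register `44`, so the neighbours are
    -- exactly the final segment.
    have hN : ∀ v, v ∈ nl (σ₁.reg 4) ↔
        ∃ q, σ₁.reg 44 ≤ q ∧ q < σ₁.reg 5 ∧ σ₁.arr 6 q = v := by
      intro v
      refine ⟨fun hv => ?_, fun ⟨q, e1, e2, e3⟩ => e3 ▸ habove q e1 e2⟩
      obtain ⟨⟨e1, e2⟩, e3⟩ := hS.pos_nbr hG hv
      refine ⟨_, ?_, e2, e3⟩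
      by_contra hge
      refine hbet _ e1 (by omega) ?_
      rwa [e3]
    refine wp_of_spec (wp_findDiamond E hS rfl hlt hltL hN fun q => ?_) (by omega) ?_
    · rw [hT.arr 11 (by decide), h11]
    rintro k₂ σ₂ hk₂ ⟨hr₂, ha₂, hD⟩
    have hS₂ : StuckState n s nl A₀ A₁ p σ₂ :=
      hS.of_frame (fun x hx => hr₂ x (by omega)) fun a ha => ha₂ a (by omega)
    rw [← hr₂ 5 (by decide), ← ha₂ 6 (by decide)] at hD habove
    rw [← hr₂ 4 (by decide)] at habove
    refine wp_of_spec (wp_diamondProgram E hS₂ ((hr₂ 7 (by decide)).trans h7') hlt hD habove)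
      (by omega) fun k₃ σ₃ _ hW => hW.of_frame (fun x hx => ?_) fun a ha => ?_
    · rw [hr₂ x (by omega), hT.reg x (by omega)]
    · rw [ha₂ a (by omega), hT.arr a (by omega)]
  · obtain ⟨hmem, h2⟩ := hbelow h0
    refine wp_of_spec (wp_gapWalk E hS h7' h2 h0 hltL hmem (habove _ le_rfl hltL) hbet) (by omega)
      fun k₃ σ₃ _ hW => hW.of_frame (fun x hx => hT.reg x (by omega)) fun a ha =>
        hT.arr a (by omega)

end RAM

/-! ### The complete algorithm. -/

namespace RAM

open NatGraph

variable {W n s Δ : ℕ} {nl : ℕ → List ℕ} {A₀ A₁ p : ℕ → ℕ} {σ : State}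

/-- The partition algorithm. -/
def partitionProgram : Program :=
  block [ct 3 1, findPath, search, greedy,
    .cond (.eq 29 2) (block [cp 7 2, buildWalk, moveAlong]) .skip, output]

/-- The linear costs `30 + 30 + 60 + 190` of the phases, `60 * 12` for moving the hole and `5` for
the output add up to `1035`; the remaining credits cover the additive constants. -/
theorem wp_partitionProgram (E : Env W n s nl A₀ A₁ p Δ) (h0 : σ.reg 0 = n) (h1 : σ.reg 1 = s)
    (h2 : σ.reg 2 = 0) (ha0 : σ.arr 0 = A₀) (ha1 : σ.arr 1 = A₁) (ha2 : σ.arr 2 = p)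
    (ha : ∀ a, 3 ≤ a → ∀ i, σ.arr a i = 0) :
    wp W partitionProgram (1060 * size n nl) σ fun _ σ' => ∃ col, ValidCol nl s p col ∧
      ∀ v < n, col v = σ'.arr 3 v + 1 := by
  have hword := E.word
  have hn := E.inst.pos
  have hsize := le_size (n := n) (nl := nl)
  simp only [partitionProgram, wp_block_cons, wp_const]
  refine ⟨by omega, by omega, ?_⟩
  generalize hτ : State.setReg σ 3 1 = τ
  have hB : Base n s A₀ A₁ p τ := by
    rw [← hτ]
    constructor <;> simp [h0, h1, h2, ha0, ha1, ha2]
  have hτa : τ.arr = σ.arr := by rw [← hτ]; rfl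
  refine wp_of_spec (wp_findPath E hB fun v => by rw [hτa]; exact ha 7 (by decide) v) (by omega)
    fun k₁ σ₁ hk₁ h₁ => ?_
  have hroot : σ₁.reg 4 < n := by
    rw [h₁.last]
    exact h₁.path.lt _ h₁.path.one_le le_rfl
  have hz₁ : ∀ a, 3 ≤ a → a ≠ 6 → a ≠ 7 → ∀ i, σ₁.arr a i = 0 := fun a e1 e2 e3 i => by
    rw [h₁.arr a e2 e3, hτa, ha a e1]
  refine wp_of_spec (wp_search E h₁.base hroot (hz₁ 9 (by decide) (by decide) (by decide)))
    (by omega) fun k₂ σ₂ hk₂ h₂ => ?_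
  have hz₂ : ∀ a, 3 ≤ a → a < 6 ∨ 9 < a → ∀ i, σ₂.arr a i = 0 := fun a e1 e2 i => by
    rw [h₂.arr a (by omega) (by omega), hz₁ a e1 (by omega) (by omega)]
  refine wp_of_spec (wp_greedy E h₂.base (by rw [h₂.reg4]; exact h₂.order)
    (hz₂ 4 (by decide) (by decide)) (hz₂ 5 (by decide) (by decide))) (by omega)
    fun k₃ σ₃ hk₃ h₃ => ?_
  have hfin : ∀ k σ', 5 * n + 2 ≤ k → Coloured n s nl A₀ A₁ p σ' → wp W output k σ' fun k' σ'' =>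
      wp W (block []) k' σ'' fun _ σ'' => ∃ col, ValidCol nl s p col ∧
        ∀ v < n, col v = σ''.arr 3 v + 1 := by
    intro k σ' hk hC
    refine wp_of_spec (wp_output E hC) hk fun k' σ'' _ hout => wp_block_nil.2
      ⟨σ'.arr 4, hC.valid, fun v hv => ?_⟩
    have := hC.ne_zero v hv
    rw [hout v hv]
    omega
  simp only [wp_cond, wp_skip, holds_eq, h₃.base.reg2]
  refine ⟨by omega, fun h29 => ?_, fun h29 => hfin _ _ (by omega) ⟨h₃.base, h₃.valid, ?_⟩⟩
  · obtain ⟨-, hr0, hst⟩ := h₃.root.resolve_right fun h => h.1 h29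
    have hr4 : σ₃.reg 4 = σ₂.reg 4 := h₃.reg 4 (by decide)
    have hS : StuckState n s nl A₀ A₁ p (σ₃.setReg 7 0) := by
      have e4 : σ₃.reg 4 = σ₁.reg 4 := hr4.trans h₂.reg4
      have e5 : σ₃.reg 5 = σ₁.reg 5 := (h₃.reg 5 (by decide)).trans h₂.reg5
      have e6 : σ₃.arr 6 = σ₁.arr 6 := by
        rw [h₃.arr 6 (by decide), h₂.arr 6 (by decide) (by decide)]
      have e7 : σ₃.arr 7 = σ₁.arr 7 := by
        rw [h₃.arr 7 (by decide), h₂.arr 7 (by decide) (by decide)]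
      refine ⟨h₃.base.setReg (by decide), ?_, ?_, ?_, ?_, ?_⟩ <;>
        simp only [reg_setReg, arr_setReg, Nat.reduceEqDiff, if_false, e6, e7, e5]
      · exact h₁.path
      · exact e4.trans h₁.last
      · rw [e4]; exact h₁.max
      · refine ⟨h₃.valid.le, fun x hx => ⟨fun e => ?_, fun e => by rw [e, hr4]; exact hr0⟩⟩
        by_contra hne
        exact h₃.coloured x hx (by rwa [← hr4]) e
      · rw [hr4]; exact hst
    have hz₃ : ∀ a, 3 ≤ a → a ≠ 4 → a < 6 ∨ 9 < a → ∀ i, σ₃.arr a i = 0 := fun a e1 e2 e3 i => by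
      rw [h₃.arr a e2, hz₂ a e1 e3]
    simp only [wp_block_cons, wp_copy, h₃.base.reg2]
    refine ⟨by omega, wp_of_spec (wp_buildWalk E hS (by simp)
      (hz₃ 10 (by decide) (by decide) (by decide)) (hz₃ 11 (by decide) (by decide) (by decide)))
      (by omega) fun k₄ σ₄ hk₄ hW => ?_⟩
    obtain ⟨w1, w2, w3, w4, w5⟩ := hW
    have hH := hS.hole
    have hsk := hS.stuck
    have hlt := hS.root_lt
    rw [← w1 4 (by decide)] at w3 w4 hH hsk hlt
    rw [← w2 4 (by decide)] at w4 hH hsk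
    refine wp_of_spec (wp_moveAlong E (T := 12 * size n nl) (hS.base.of_frame
      (fun x hx => w1 x (by omega)) fun a _ => w2 a (by omega)) (fun c => ?_) ?_ hH hlt hsk w3 w4
      (by rw [partSize_eq_listSize]; exact w5) (by omega)) (by omega)
      fun k₅ σ₅ hk₅ hC => wp_block_nil.2 (hfin _ _ (by omega) hC)
    · rw [w2 5 (by decide), arr_setReg, hz₃ 5 (by decide) (by decide) (by decide)]
    · rw [w2 4 (by decide)]
      exact h₃.valid
  · intro v hv
    obtain ⟨-, hr0⟩ := h₃.root.resolve_left fun h => h29 h.1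
    by_cases e : v = σ₂.reg 4
    · rw [e]; exact hr0
    · exact h₃.coloured v hv e

end RAM

/-! ### Transfer to Mathlib graphs and the input format. -/

open NatGraph

/-- Adjacency lists of natural numbers. -/
def natLists {n : ℕ} (adj : Fin n → List (Fin n)) (v : ℕ) : List ℕ :=
  if h : v < n then (adj ⟨v, h⟩).map Fin.val else []

/-- Extension of a finite sequence by zeros. -/
def extendZero {s : ℕ} (p : Fin s → ℕ) (i : ℕ) : ℕ := if h : i < s then p ⟨i, h⟩ else 0

section

variable {n : ℕ} {G : SimpleGraph (Fin n)} {adj : Fin n → List (Fin n)}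

theorem natLists_val (adj : Fin n → List (Fin n)) (v : Fin n) :
    natLists adj v = (adj v).map Fin.val := by simp [natLists]

theorem mem_natLists (h : IsAdjacencyLists G adj) {u v : ℕ} :
    u ∈ natLists adj v ↔ ∃ (hu : u < n) (hv : v < n), G.Adj ⟨v, hv⟩ ⟨u, hu⟩ := by
  unfold natLists
  split_ifs with hv
  · simp only [List.mem_map, (h _).2]
    constructor
    · rintro ⟨w, hw, rfl⟩
      exact ⟨w.2, hv, hw⟩
    · rintro ⟨hu, _, hw⟩
      exact ⟨_, hw, rfl⟩
  · simp [hv]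

theorem natGraph_natLists (h : IsAdjacencyLists G adj) : NatGraph n (natLists adj) where
  nodup v := by
    unfold natLists
    split_ifs with hv
    · exact (h _).1.map Fin.val_injective
    · exact List.nodup_nil
  lt hu := ((mem_natLists h).1 hu).1
  symm hu := by
    obtain ⟨h1, h2, h3⟩ := (mem_natLists h).1 hu
    exact (mem_natLists h).2 ⟨h2, h1, h3.symm⟩
  irrefl v hv := by
    obtain ⟨h1, h2, h3⟩ := (mem_natLists h).1 hv
    exact h3.ne rfl

theorem length_adj [DecidableRel G.Adj] (h : IsAdjacencyLists G adj) (v : Fin n) :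
    (adj v).length = G.degree v := by
  rw [← List.toFinset_card_of_nodup (h v).1, ← SimpleGraph.card_neighborFinset_eq_degree]
  congr 1
  ext w
  simp [(h v).2]

theorem instance_natLists [DecidableRel G.Adj] {s : ℕ} {p : Fin s → ℕ}
    (h : IsAdjacencyLists G adj) (hc : G.Connected) (ht : G ≠ ⊤) (hΔ : 3 ≤ G.maxDegree)
    (hs : 2 ≤ s) (hp : (G.maxDegree : ℤ) - (s : ℤ) ≤ ∑ i, (p i : ℤ)) :
    NatGraph.Instance n (natLists adj) s (extendZero p) G.maxDegree where
  graph := natGraph_natLists h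
  deg_le v := by
    unfold natLists
    split_ifs with hv
    · rw [List.length_map, length_adj h]
      exact G.degree_le_maxDegree _
    · simp
  le_sum := by
    have e : ∑ i ∈ Finset.range s, (extendZero p i + 1) = ∑ i, p i + s := by
      rw [Finset.sum_add_distrib, Finset.sum_range]
      simp [extendZero]
    rw [e]
    zify
    linarith
  three_le := hΔ
  two_le := hs
  pos := by
    obtain ⟨v⟩ := hc.nonempty
    exact v.pos
  conn A hA hcl v hv := by
    obtain ⟨u, hu, huA⟩ := hA
    obtain ⟨w⟩ := hc.preconnected ⟨u, hu⟩ ⟨v, hv⟩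
    have key : ∀ {x y : Fin n}, G.Walk x y → x.val ∈ A → y.val ∈ A := by
      intro x y w
      induction w with
      | nil => exact id
      | cons hxy _ ih => exact fun hx => ih (hcl _ hx _ ((mem_natLists h).2 ⟨_, _, hxy⟩))
    exact key w huA
  not_complete := by
    by_contra hcon
    push Not at hcon
    refine ht ?_
    ext u v
    rw [SimpleGraph.top_adj]
    refine ⟨fun e => e.ne, fun hne => ?_⟩
    obtain ⟨_, _, e⟩ := (mem_natLists h).1
      (hcon u u.2 v v.2 fun e => hne (Fin.ext e))
    exact e

theorem size_natLists [DecidableRel G.Adj] (h : IsAdjacencyLists G adj) :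
    RAM.size n (natLists adj) = n + 2 * G.edgeFinset.card := by
  rw [RAM.size, Finset.sum_range, ← G.sum_degrees_eq_twice_card_edges, Finset.sum_add_distrib]
  simp [natLists_val, length_adj h, add_comm]

theorem inputState_offset_succ {s : ℕ} (adj : Fin n → List (Fin n)) (p : Fin s → ℕ) {v : ℕ}
    (hv : v < n) : (inputState adj p).arr 0 (v + 1) =
      (inputState adj p).arr 0 v + (natLists adj v).length := by
  have e : ∀ u : Fin n, (if u.val < v + 1 then (adj u).length else 0) =
      (if u.val < v then (adj u).length else 0) +
        if (⟨v, hv⟩ : Fin n) = u then (adj u).length else 0 := by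
    intro u
    simp only [Fin.ext_iff]
    split_ifs <;> omega
  simp only [inputState, if_true, if_pos hv.le, if_pos (show v + 1 ≤ n from hv)]
  rw [Finset.sum_congr rfl fun u _ => e u, Finset.sum_add_distrib, Finset.sum_ite_eq]
  simp [natLists, hv]

theorem inputState_offset {s : ℕ} (adj : Fin n → List (Fin n)) (p : Fin s → ℕ) {v : ℕ}
    (hv : v ≤ n) : (inputState adj p).arr 0 v = (((List.finRange n).take v).flatMap adj).length := by
  induction v with
  | zero => simp [inputState]
  | succ v ih =>
    rw [inputState_offset_succ adj p hv, ih (Nat.le_of_lt hv),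
      List.take_succ_eq_append_getElem (by simpa using hv), List.flatMap_append,
      List.length_append]
    simp [natLists, show v < n from hv]

theorem inputState_get {s : ℕ} (adj : Fin n → List (Fin n)) (p : Fin s → ℕ) {v : ℕ}
    (hv : v < n) (k : ℕ) (hk : k < (natLists adj v).length) :
    (inputState adj p).arr 1 ((inputState adj p).arr 0 v + k) = (natLists adj v)[k] := by
  have hk' : k < (adj ⟨v, hv⟩).length := by simpa [natLists, hv] using hk
  -- Splitting the vertices at `v` splits the concatenation: the lists of the smaller vertices have
  -- total length equal to the offset.
  obtain ⟨l₁, l₂, hl₁, e⟩ : ∃ l₁ l₂, (List.finRange n).take v = l₁ ∧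
      List.finRange n = l₁ ++ ⟨v, hv⟩ :: l₂ := by
    refine ⟨_, (List.finRange n).drop (v + 1), rfl, ?_⟩
    conv_lhs => rw [← List.take_append_drop v (List.finRange n)]
    rw [List.drop_eq_getElem_cons (by simpa using hv)]
    simp
  have h1 : ∀ i, (inputState adj p).arr 1 i =
      (((List.finRange n).flatMap adj).map Fin.val).getD i 0 := fun i => rfl
  rw [inputState_offset adj p hv.le, h1, hl₁, e, ← List.length_map (f := Fin.val)]
  simp only [List.flatMap_append, List.flatMap_cons, List.map_append]
  rw [List.getD_append_right _ _ _ _ (by omega), Nat.add_sub_cancel_left,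
    List.getD_append _ _ _ _ (by simpa using hk')]
  simp [natLists, hv, hk']

end

/-- For the vertex set `X` of a subgraph, the degree in the subgraph is at most the number of
neighbours in `X`, since the former neighbours embed into the filtered list. -/
theorem isDegenerate_induce {n d : ℕ} {G : SimpleGraph (Fin n)} {adj : Fin n → List (Fin n)}
    (h : IsAdjacencyLists G adj) {A : Set ℕ} (hA : DegenerateOn (natLists adj) A d)
    {V : Set (Fin n)} (hV : ∀ v ∈ V, v.val ∈ A) : (G.induce V).IsDegenerate d := by
  classical
  intro H hH
  obtain ⟨x, hx⟩ := hH
  obtain ⟨X, hX⟩ : ∃ X : Finset ℕ, ∀ u, u ∈ X ↔ ∃ y ∈ H.verts, y.1.val = u :=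
    ⟨H.verts.toFinset.image fun y => y.1.val, by simp⟩
  obtain ⟨v, hv, hcount⟩ := hA X ⟨_, (hX _).2 ⟨x, hx, rfl⟩⟩ (by
    intro u hu
    obtain ⟨y, -, rfl⟩ := (hX u).1 hu
    exact hV _ y.2)
  obtain ⟨y, hy, rfl⟩ := (hX v).1 hv
  refine ⟨y, hy, ?_⟩
  have hinj : Set.InjOn (fun z : V => z.1.val) (H.neighborSet y) := fun a _ b _ e =>
    Subtype.ext (Fin.ext e)
  rw [← hinj.encard_image]
  have hsub : (fun z : V => z.1.val) '' H.neighborSet y ⊆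
      (((natLists adj y.1.val).filter (· ∈ X)).toFinset : Finset ℕ) := by
    rintro _ ⟨z, hz, rfl⟩
    have hz' : H.Adj y z := hz
    have hadj : G.Adj y.1 z.1 := H.adj_sub hz'
    simp only [List.coe_toFinset, Set.mem_ofPred_eq, List.mem_filter, decide_eq_true_eq]
    exact ⟨(mem_natLists h).2 ⟨z.1.2, y.1.2, hadj⟩, (hX _).2 ⟨z, H.edge_vert hz'.symm, rfl⟩⟩
  refine (Set.encard_le_encard hsub).trans ?_
  rw [Set.encard_coe_eq_coe_finsetCard, Nat.cast_le]
  refine (List.toFinset_card_le _).trans ?_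
  rw [← List.countP_eq_length_filter]
  exact hcount

theorem theorem3 :
    ∃ (P : RAM.Program) (C : ℕ),
      ∀ (n : ℕ) (G : SimpleGraph (Fin n)) [DecidableRel G.Adj] (adj : Fin n → List (Fin n))
        (s : ℕ) (p : Fin s → ℕ),
        IsAdjacencyLists G adj →
        G.Connected →
        G ≠ ⊤ →
        3 ≤ G.maxDegree →
        2 ≤ s →
        (G.maxDegree : ℤ) - (s : ℤ) ≤ ∑ i, (p i : ℤ) →
        ∀ W : ℕ, C * (n + G.edgeFinset.card) ≤ W → (inputState adj p).Fits W →
          ∃ (t : ℕ) (σ : RAM.State) (V : Fin s → Set (Fin n)),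
            RAM.Runs W P (inputState adj p) t σ ∧
            t ≤ C * (n + G.edgeFinset.card) ∧
            IsOutput σ V ∧
            (∀ v : Fin n, ∃! i : Fin s, v ∈ V i) ∧
            ∀ i : Fin s, (G.induce (V i)).IsDegenerate (p i) := by
  -- The size is `n + 2 * m`, hence at most `2 * (n + m)`; the factor `1060` of the running time
  -- doubles, and the word bound `1000 * size` is covered as well.
  refine ⟨RAM.partitionProgram, 2120, ?_⟩
  intro n G _ adj s p hadj hc ht hΔ hs hp W hW hfits
  have hsize := size_natLists hadj
  have E : RAM.Env W n s (natLists adj) ((inputState adj p).arr 0) ((inputState adj p).arr 1)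
      (extendZero p) G.maxDegree :=
    ⟨instance_natLists hadj hc ht hΔ hs hp, fun v hv => inputState_offset_succ adj p hv,
      fun v _ => hfits.2 0 v, fun v hv k hk => inputState_get adj p hv k hk, by omega⟩
  obtain ⟨t, σ, hrun, htime, col, hvalid, hcol⟩ := RAM.wp_partitionProgram E
    (σ := inputState adj p) rfl rfl rfl rfl rfl rfl fun a ha i => by
      simp only [inputState]
      rw [if_neg (by omega), if_neg (by omega), if_neg (by omega)]
  refine ⟨t, σ, fun i => {v | σ.arr 3 v = i}, hrun, by omega, fun v i => Iff.rfl, fun v => ?_,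
    fun i => ?_⟩
  · have h1 := hcol v v.2
    have h2 := hvalid.le v
    exact ⟨⟨σ.arr 3 v, by omega⟩, rfl, fun i hi => Fin.ext (Eq.symm hi)⟩
  · have hd := hvalid.deg i i.2
    rw [show extendZero p i = p i by simp [extendZero]] at hd
    refine isDegenerate_induce hadj hd fun v hv => ?_
    have hv' : σ.arr 3 v = i := hv
    rw [Set.mem_ofPred_eq, hcol v v.2, hv']
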